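/- **Setting.** Let $(M,g)$ be a smooth Riemannian spin manifold of even dimension $n$, with Levi-Civita connection $\nabla$, spinor bundle $\Sigma M$ (with fibre $\mathbb C^N$, where $\mathrm{C}\ell(\mathbb R^n)\otimes\mathbb C\simeq \operatorname{End}(\mathbb C^N)$ and $v\cdot v=-|v|^2$), spinorial covariant derivative $\nabla\psi=d\psi+\frac14\sum_{s,t}g(\nabla e_s,e_t)\,e^s\cdot e^t\cdot\psi$ and Dirac operator $\slashed D=\sum_i e^i\cdot\nabla_{e_i}$. Fix $p\in M$, an orthonormal basis $e_1(p),\dots,e_n(p)$ of $T_pM$, and normal geodesic coordinates $x\mapsto \exp_p(\sum_i x^ie_i(p))$, a diffeomorphism from a ball $B_r\subset\mathbb R^n$ onto an open neighbourhood $U_p$ of $p$. Let $e_1,\dots,e_n$ be the frame of $TM$ over $U_p$, and let $\tau$ be the trivialisation of $\Sigma M$ over $U_p$, obtained by parallel transport along the geodesics through $p$ from $(e_i(p))$, respectively from a basis of $\Sigma_pM$. Put $D^\gamma=\partial_{x^1}^{\gamma_1}\cdots\partial_{x^n}^{\gamma_n}$, and let $a_i^l,b_l^j$ be the vielbeins: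 $\frac{\partial}{\partial x^i}=\sum_l a_i^l e_l$ and $e_l=\sum_j b_l^j\frac{\partial}{\partial x^j}$. Write $R_{ijst}(p)=g(R(e_i,e_j)e_s,e_t)(p)$ with $R(U,V)=\nabla_U\nabla_V-\nabla_V\nabla_U-\nabla_{[U,V]}$. **Definitions.** A differential operator of order $m$ on $\Sigma M$, written over $U_p$ in the coordinates $x$ and the trivialisation $\tau$ as $P=\sum_{|\gamma|\le m}P_\gamma D^\gamma$, is *geometric* if for every $\gamma$ the matrix entries of $P_\gamma$ are linear combinations, with constant complex coefficients, of products of derivatives $D^\beta a_i^l$ and $D^{\beta}b_l^j$ whose total number of derivatives is $m-|\gamma|$. Let $c:\mathrm{C}\ell(T_pM)\otimes\mathbb C\to\operatorname{End}(\Lambda T_p^*M\otimes\mathbb C)$ be the algebra morphism with $c(v)=v\wedge\bullet-v^\sharp\lrcorner\,\bullet$; using $\operatorname{End}(\Sigma_pM)\simeq \mathrm{C}\ell(T_pM)\otimes\mathbb C$, set $c(P)=\sum_\gamma c(P_\gamma)D^\gamma$, acting on functions $B_r\to\Lambda T_p^*M\otimes\mathbb C$. For $0<\lambda<1$ let $U_\lambda$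 be multiplication by $\lambda^{-k}$ on forms of degree $k$, let $\mathfrak f_\lambda(x)=\lambda x$, and let $\widetilde{\mathbb P}^{\mathrm{Ge}}_\lambda$ be the operator $$\widetilde{\mathbb P}^{\mathrm{Ge}}_\lambda u=\Big(Q_\lambda\big(u\circ\mathfrak f_\lambda^{-1}\big)\Big)\circ\mathfrak f_\lambda,\qquad Q_\lambda=\lambda^m\sum_{|\gamma|\le m} U_\lambda\,c(P_\gamma)\,U_\lambda^{-1}\,D^\gamma .$$ The operator $P$ is *rescalable at $p$* if $\widetilde{\mathbb P}^{\mathrm{Ge}}_\lambda$ has a limit as $\lambda\to0^+$, i.e. if all its coefficients converge, with all their derivatives, locally uniformly on $B_r$. **Proposition 6.1.** The square $P=\slashed D^2$ of the Dirac operator (with $m=2$) is a geometric differential operator and it is rescalable at $p$; as $\lambda\to0^+$, the operators $\widetilde{\mathbb P}^{\mathrm{Ge}}_\lambda$ converge to $$-\sum_i\Big(\partial_{x^i}-\frac18\sum_{j,s,t}R_{ijst}(p)\,x^j\,e^s\wedge e^t\wedge\Big)^2 .$$ -/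

import Mathlib

open Set Filter Topology Manifold Bundle
open scoped ContDiff TensorProduct Matrix

noncomputable section

namespace Getzler

/-- The model space `ℝⁿ`. -/
abbrev E (n : ℕ) : Type := EuclideanSpace ℝ (Fin n)

/-! ### Clifford algebra, spinor module, exterior algebra -/

/-- The form `v ↦ -|v|²` on `ℝⁿ`, so that `v · v = -|v|²` in its Clifford algebra. -/
abbrev negSq (n : ℕ) : QuadraticForm ℝ (Fin n → ℝ) :=
  QuadraticMap.weightedSumSquares ℝ (fun _ : Fin n => (-1 : ℝ))

/-- The Clifford algebra of Euclidean `ℝⁿ`. -/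
abbrev Cl (n : ℕ) : Type := CliffordAlgebra (negSq n)

/-- A vector of `ℝⁿ` as an element of the Clifford algebra. -/
def clVec {n : ℕ} (v : Fin n → ℝ) : Cl n := CliffordAlgebra.ι (negSq n) v

/-- The generator `eⁱ` of the Clifford algebra. -/
def clGen {n : ℕ} (i : Fin n) : Cl n := clVec (Pi.single i 1)

/-- An identification `Cl(ℝⁿ) ⊗ ℂ ≃ End(ℂᴺ)`, i.e. a structure of spinor module on `ℂᴺ`.
It exists exactly when `n` is even and `N = 2^(n/2)`. -/
abbrev SpinorModule (n N : ℕ) : Type := (ℂ ⊗[ℝ] Cl n) ≃ₐ[ℂ] Matrix (Fin N) (Fin N) ℂ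

/-- Clifford multiplication by an element of `Cl(ℝⁿ)` on the spinor module. -/
def SpinorModule.act {n N : ℕ} (ρ : SpinorModule n N) (c : Cl n) : Matrix (Fin N) (Fin N) ℂ :=
  ρ ((1 : ℂ) ⊗ₜ[ℝ] c)

/-- The exterior algebra of `(ℝⁿ)*`, where `(ℝⁿ)*` is identified with `ℝⁿ` by the dual basis. -/
abbrev Ext (n : ℕ) : Type := ExteriorAlgebra ℝ (Fin n → ℝ)

/-- Exterior multiplication `v ∧ •`. -/
def extMul {n : ℕ} (v : Fin n → ℝ) : Module.End ℝ (Ext n) :=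
  LinearMap.mulLeft ℝ (ExteriorAlgebra.ι ℝ v)

/-- The linear form `⟨v, •⟩`. -/
def flat {n : ℕ} (v : Fin n → ℝ) : Module.Dual ℝ (Fin n → ℝ) :=
  (Pi.basisFun ℝ (Fin n)).toDual v

/-- Interior multiplication `v^♯ ⌟ •`. -/
def extContr {n : ℕ} (v : Fin n → ℝ) : Module.End ℝ (Ext n) :=
  CliffordAlgebra.contractLeft (Q := (0 : QuadraticForm ℝ (Fin n → ℝ))) (flat v)

theorem flat_self {n : ℕ} (v : Fin n → ℝ) : flat v v = -negSq n v := by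
  simp [flat, Module.Basis.toDual, Module.Basis.constr_apply_fintype,
    QuadraticMap.weightedSumSquares_apply]

/-- The endomorphism `v ∧ • - v^♯ ⌟ •`, depending linearly on `v`. -/
def cliffordEnd (n : ℕ) : (Fin n → ℝ) →ₗ[ℝ] Module.End ℝ (Ext n) where
  toFun v := extMul v - extContr v
  map_add' v w := by
    ext x
    simp [extMul, extContr, flat, add_mul]
    abel
  map_smul' r v := by
    ext x
    simp [extMul, extContr, flat, smul_sub]

theorem cliffordEnd_sq {n : ℕ} (v : Fin n → ℝ) :
    cliffordEnd n v * cliffordEnd n v = algebraMap ℝ _ (negSq n v) := by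
  refine LinearMap.ext fun x => ?_
  have h1 : extMul v (extMul v x) = 0 := by
    simp [extMul, ← mul_assoc]
  have h2 : extContr v (extContr v x) = 0 := CliffordAlgebra.contractLeft_contractLeft _ _
  have h3 : extContr v (extMul v x) = flat v v • x - extMul v (extContr v x) :=
    CliffordAlgebra.contractLeft_ι_mul (Q := (0 : QuadraticForm ℝ (Fin n → ℝ))) (d := flat v) v x
  simp only [cliffordEnd, LinearMap.coe_mk, AddHom.coe_mk, Module.End.mul_apply,
    LinearMap.sub_apply, map_sub, h1, h2, h3, flat_self, Module.algebraMap_end_apply]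
  module

/-- The Clifford map `c : Cl(ℝⁿ) → End(Λ(ℝⁿ)*)`, `c(v) = v ∧ • - v^♯ ⌟ •`. -/
def cliffordMap (n : ℕ) : Cl n →ₐ[ℝ] Module.End ℝ (Ext n) :=
  CliffordAlgebra.lift (negSq n) ⟨cliffordEnd n, cliffordEnd_sq⟩

/-- Complex matrices indexed by the basis `e^I = e^{i₁} ∧ ⋯ ∧ e^{iₖ}` of the exterior algebra. -/
abbrev ExtMat (n : ℕ) : Type := Matrix (Finset (Fin n)) (Finset (Fin n)) ℂ

/-- The complex matrix of an endomorphism of the exterior algebra in the basis `e^I`. -/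
def extToMat (n : ℕ) : Module.End ℝ (Ext n) →ₐ[ℝ] ExtMat n :=
  (Algebra.ofId ℝ ℂ).mapMatrix.comp
    (LinearMap.toMatrixAlgEquiv (Pi.basisFun ℝ (Fin n)).ExteriorAlgebra).toAlgHom

/-- The complexified Clifford map `Cl(ℝⁿ) ⊗ ℂ → End(Λ(ℝⁿ)* ⊗ ℂ)`. -/
def cliffordMapC (n : ℕ) : (ℂ ⊗[ℝ] Cl n) →ₐ[ℂ] ExtMat n :=
  Algebra.TensorProduct.lift (Algebra.ofId ℂ (ExtMat n)) ((extToMat n).comp (cliffordMap n))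
    (fun x _ => Algebra.commutes x _)

/-- The matrix of `eˢ ∧ •`. -/
def wedge {n : ℕ} (s : Fin n) : ExtMat n := extToMat n (extMul (Pi.single s 1))

/-- The Getzler rescaling map `U_λ`: multiplication by `λ^{-k}` on forms of degree `k`. -/
def getzlerU (n : ℕ) (lam : ℝ) : ExtMat n :=
  Matrix.diagonal fun I : Finset (Fin n) => (lam : ℂ) ^ (-(I.card : ℤ))

/-- `U_λ^♯ Q = U_λ Q U_λ⁻¹`, where `U_λ⁻¹ = U_{1/λ}`. -/
def getzlerConj {n : ℕ} (lam : ℝ) (Q : ExtMat n) : ExtMat n :=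
  getzlerU n lam * Q * getzlerU n lam⁻¹

/-! ### Differential operators on a ball of `ℝⁿ` -/

/-- The partial derivative `∂_i`. -/
def pd {n : ℕ} {F : Type*} [NormedAddCommGroup F] [NormedSpace ℝ F] (i : Fin n) (f : E n → F) :
    E n → F :=
  fun x => fderiv ℝ f x (EuclideanSpace.single i 1)

/-- The iterated partial derivative `D^γ = ∂_1^{γ_1} ⋯ ∂_n^{γ_n}`. -/
def pdPow {n : ℕ} {F : Type*} [NormedAddCommGroup F] [NormedSpace ℝ F] (γ : Fin n → ℕ)
    (f : E n → F) : E n → F :=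
  (List.finRange n).foldr (fun i h => (pd i)^[γ i] h) f

/-- The multi-indices `γ` with `|γ| ≤ m`. -/
def multiIdx (n m : ℕ) : Finset (Fin n → ℕ) :=
  (Finset.range (m + 1)).biUnion fun k => Finset.univ.piAntidiag k

/-- A family of coefficients `P_γ`, matrix valued functions of `x`. -/
abbrev Coeffs (n : ℕ) (κ : Type) : Type := (Fin n → ℕ) → E n → Matrix κ κ ℂ

/-- The differential operator `∑_{|γ| ≤ m} P_γ D^γ`. -/
def evalOp {n : ℕ} {κ : Type} [Fintype κ] (m : ℕ) (P : Coeffs n κ) (u : E n → κ → ℂ) :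
    E n → κ → ℂ :=
  fun x => ∑ γ ∈ multiIdx n m, P γ x *ᵥ pdPow γ u x

/-- The coefficients `P_γ`, `|γ| ≤ m`, are smooth on `V`. -/
def SmoothCoeffs {n : ℕ} {κ : Type} (V : Set (E n)) (m : ℕ) (P : Coeffs n κ) : Prop :=
  ∀ γ ∈ multiIdx n m, ∀ I J : κ, ContDiffOn ℝ ∞ (fun x => P γ x I J) V

/-- On `V`, the operator `T` is the differential operator `∑_{|γ| ≤ m} P_γ D^γ`
with smooth coefficients. -/
def IsDiffOp {n : ℕ} {κ : Type} [Fintype κ] (V : Set (E n)) (m : ℕ)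
    (T : (E n → κ → ℂ) → (E n → κ → ℂ)) (P : Coeffs n κ) : Prop :=
  SmoothCoeffs V m P ∧
    ∀ u : E n → κ → ℂ, ContDiffOn ℝ ∞ u V → ∀ x ∈ V, T u x = evalOp m P u x

/-- Convergence on `V`, as `λ → 0⁺`, of differential operators of order at most `m`
(defined for `0 < λ < 1`): all the coefficients converge, together with all their derivatives,
locally uniformly on `V`. -/
def DiffOpTendsto {n : ℕ} {κ : Type} [Fintype κ] (V : Set (E n)) (m : ℕ)
    (T : ℝ → (E n → κ → ℂ) → (E n → κ → ℂ)) (L : (E n → κ → ℂ) → (E n → κ → ℂ)) : Prop :=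
  ∃ (C : ℝ → Coeffs n κ) (C₀ : Coeffs n κ),
    (∀ lam ∈ Ioo (0 : ℝ) 1, IsDiffOp V m (T lam) (C lam)) ∧ IsDiffOp V m L C₀ ∧
    ∀ γ ∈ multiIdx n m, ∀ (I J : κ) (β : Fin n → ℕ),
      TendstoLocallyUniformlyOn (fun lam => pdPow β fun x => C lam γ x I J)
        (pdPow β fun x => C₀ γ x I J) (𝓝[>] 0) V

/-- The Getzler rescaled operator `λ^m 𝔣_λ^♯ U_λ^♯ c(P)` of an operator `P = ∑ P_γ D^γ` of order
`m` on spinors, where `𝔣_λ(x) = λ x`, `(𝔣_λ^♯ Q) u = Q (u ∘ 𝔣_λ⁻¹) ∘ 𝔣_λ`, the map `c` is applied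
to the coefficients and `End(ℂᴺ)` is identified with `Cl(ℝⁿ) ⊗ ℂ` by `κ`. -/
def getzlerRescale {n N : ℕ} (κ : SpinorModule n N) (m : ℕ) (P : Coeffs n (Fin N)) (lam : ℝ) :
    (E n → Finset (Fin n) → ℂ) → (E n → Finset (Fin n) → ℂ) :=
  fun u x =>
    evalOp m (fun γ y => ((lam : ℂ) ^ m) • getzlerConj lam (cliffordMapC n (κ.symm (P γ y))))
      (fun y => u (lam⁻¹ • y)) (lam • x)

/-- The operator `∂_i - (1/8) ∑_{j,s,t} R_{ijst} x^j eˢ ∧ eᵗ ∧`. -/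
def modelDeriv {n : ℕ} (R : Fin n → Fin n → Fin n → Fin n → ℝ) (i : Fin n)
    (u : E n → Finset (Fin n) → ℂ) : E n → Finset (Fin n) → ℂ :=
  fun x => pd i u x -
    (1 / 8 : ℂ) • ∑ j, ∑ s, ∑ t, ((R i j s t * x j : ℝ) : ℂ) • ((wedge s * wedge t) *ᵥ u x)

/-- The operator `-∑_i (∂_i - (1/8) ∑_{j,s,t} R_{ijst} x^j eˢ ∧ eᵗ ∧)²`. -/
def modelOp {n : ℕ} (R : Fin n → Fin n → Fin n → Fin n → ℝ)
    (u : E n → Finset (Fin n) → ℂ) : E n → Finset (Fin n) → ℂ :=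
  fun x => -∑ i, modelDeriv R i (modelDeriv R i u) x

/-! ### Polynomials in the jets of the vielbeins -/

/-- A jet `D^β a_i^l` (`inv = false`) or `D^β b_i^l` (`inv = true`) of a vielbein coefficient. -/
structure VielbeinJet (n : ℕ) where
  inv : Bool
  i : Fin n
  l : Fin n
  β : Fin n → ℕ

/-- The number of derivatives in a jet. -/
def VielbeinJet.order {n : ℕ} (J : VielbeinJet n) : ℕ := ∑ k, J.β k

/-- The value of a jet at `x`, for vielbeins `A = (a_i^l)` and `B = (b_i^l)`. -/
def VielbeinJet.eval {n : ℕ} (A B : E n → Matrix (Fin n) (Fin n) ℝ) (J : VielbeinJet n)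
    (x : E n) : ℝ :=
  pdPow J.β (fun y => if J.inv then B y J.i J.l else A y J.i J.l) x

/-- The functions which are linear combinations, with constant coefficients, of monomials
`∏_q D^{β_q}(a_{i_q}^{l_q}) ∏_q D^{γ_q}(b_{j_q}^{k_q})` of Gilkey order
`∑_q |β_q| + ∑_q |γ_q| = k`. -/
def geometricPoly {n : ℕ} (A B : E n → Matrix (Fin n) (Fin n) ℝ) (k : ℕ) :
    Submodule ℂ (E n → ℂ) :=
  Submodule.span ℂ {f | ∃ L : List (VielbeinJet n), (L.map VielbeinJet.order).sum = k ∧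
    f = fun x => (((L.map fun J => J.eval A B x).prod : ℝ) : ℂ)}

/-! ### Riemannian geometry in normal coordinates -/

section Manifold

variable {n : ℕ} {M : Type*} [TopologicalSpace M] [ChartedSpace (E n) M]

/-- The coordinate vector field `∂/∂x^i` of a chart. -/
def coordField (X : OpenPartialHomeomorph M (E n)) (i : Fin n) (q : M) : TangentSpace (𝓡 n) q :=
  VectorField.mpullback (𝓡 n) (𝓡 n) X
    (fun y : E n => (EuclideanSpace.single i 1 : TangentSpace (𝓡 n) y)) q

/-- The radial vector field `∑_i x^i ∂/∂x^i` of a chart. -/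
def radialField (X : OpenPartialHomeomorph M (E n)) (q : M) : TangentSpace (𝓡 n) q :=
  VectorField.mpullback (𝓡 n) (𝓡 n) X (fun y : E n => (y : TangentSpace (𝓡 n) y)) q

variable [IsManifold (𝓡 n) ∞ M]

/-- The curvature `R(U, V)W = ∇_U ∇_V W - ∇_V ∇_U W - ∇_{[U, V]} W` of a connection on `TM`. -/
def curvature (cov : CovariantDerivative (𝓡 n) (E n) (TangentSpace (𝓡 n) : M → Type _))
    (U V W : Π q : M, TangentSpace (𝓡 n) q) (q : M) : TangentSpace (𝓡 n) q :=
  cov (fun y => cov W y (V y)) q (U q) - cov (fun y => cov W y (U y)) q (V q) -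
    cov W q (VectorField.mlieBracket (𝓡 n) U V q)

/-- The geodesic equation `∑_k (x^k)'' ∂_k + ∑_{i,j} (x^i)' (x^j)' ∇_{∂_i} ∂_j = 0` in the chart
`X`, for a curve with values in the domain of `X`. -/
def IsGeodesicInChart (cov : CovariantDerivative (𝓡 n) (E n) (TangentSpace (𝓡 n) : M → Type _))
    (X : OpenPartialHomeomorph M (E n)) (c : ℝ → M) (s : Set ℝ) : Prop :=
  ∀ t ∈ s, c t ∈ X.source ∧
    ∑ k, (deriv^[2] (fun t' => X (c t') k) t) • coordField X k (c t) +
      ∑ i, ∑ j, (deriv (fun t' => X (c t') i) t * deriv (fun t' => X (c t') j) t) •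
        cov (coordField X j) (c t) (coordField X i (c t)) = 0

variable [RiemannianBundle (fun q : M => TangentSpace (𝓡 n) q)]

set_option synthInstance.maxHeartbeats 200000 in
/-- `cov` is the Levi-Civita connection: it is metric and torsion free. -/
structure IsLeviCivita
    [IsContMDiffRiemannianBundle (𝓡 n) ∞ (E n) (fun q : M => TangentSpace (𝓡 n) q)]
    (cov : CovariantDerivative (𝓡 n) (E n) (TangentSpace (𝓡 n) : M → Type _)) : Prop where
  metric : cov.IsMetricCompatible
  torsion_free : cov.torsion = 0

/-- `X` is the chart of normal geodesic coordinates at `p` on the image `U_p = X.source` of the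
ball `B_r` under `exp_p`, built from the orthonormal basis `e_i(p) = ∂/∂x^i` of `T_pM`:
for `v` in `B_r`, the point with coordinates `v` is `c(1)`, where `c` is the
geodesic with `c(0) = p` and `c'(0) = ∑ v^i e_i(p)`. -/
structure IsNormalChart (cov : CovariantDerivative (𝓡 n) (E n) (TangentSpace (𝓡 n) : M → Type _))
    (p : M) (r : ℝ) (X : OpenPartialHomeomorph M (E n)) : Prop where
  radius_pos : 0 < r
  mem_atlas : X ∈ IsManifold.maximalAtlas (𝓡 n) ∞ M
  target_eq : X.target = Metric.ball 0 r
  center_mem : p ∈ X.source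
  center_eq : X p = 0
  orthonormal : Orthonormal ℝ fun i => coordField X i p
  geodesic : ∀ v ∈ Metric.ball (0 : E n) r,
    IsGeodesicInChart cov X (fun t => X.symm (t • v)) (Icc 0 1)

/-- The vector fields `e_1, …, e_n` on `U_p` are obtained from the basis `e_i(p) = ∂/∂x^i` of
`T_pM` by parallel transport along the geodesics through `p`. -/
structure IsParallelFrame
    (cov : CovariantDerivative (𝓡 n) (E n) (TangentSpace (𝓡 n) : M → Type _))
    (p : M) (X : OpenPartialHomeomorph M (E n)) (e : Fin n → Π q : M, TangentSpace (𝓡 n) q) :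
    Prop where
  smooth : ∀ i, ContMDiffOn (𝓡 n) (𝓡 n).tangent ∞
    (fun q => (⟨q, e i q⟩ : TangentBundle (𝓡 n) M)) X.source
  initial : ∀ i, e i p = coordField X i p
  parallel : ∀ i, ∀ q ∈ X.source, cov (e i) q (radialField X q) = 0

/-- The matrix `b_l^j` with `e_l = ∑_j b_l^j ∂/∂x^j`, as a function of the coordinates. -/
def vielbeinB (X : OpenPartialHomeomorph M (E n)) (e : Fin n → Π q : M, TangentSpace (𝓡 n) q)
    (x : E n) : Matrix (Fin n) (Fin n) ℝ :=
  Matrix.of fun l j =>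
    (show E n from mfderiv (𝓡 n) (𝓡 n) X (X.symm x) (e l (X.symm x))) j

/-- The matrix `a_i^l` with `∂/∂x^i = ∑_l a_i^l e_l`, the inverse of `b_l^j`. -/
def vielbeinA (X : OpenPartialHomeomorph M (E n)) (e : Fin n → Π q : M, TangentSpace (𝓡 n) q)
    (x : E n) : Matrix (Fin n) (Fin n) ℝ :=
  (vielbeinB X e x)⁻¹

/-! ### Spin structures and the Dirac operator -/

variable (n M) in
/-- A spin structure on a Riemannian manifold: local orthonormal frames on an open cover `U_a`,
and a lift of their transition functions to a smooth `Spin(n)`-valued cocycle. -/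
structure SpinStructure (ι : Type*) where
  U : ι → Set M
  isOpen : ∀ a, IsOpen (U a)
  cover : ∀ q, ∃ a, q ∈ U a
  frame : ι → Fin n → Π q : M, TangentSpace (𝓡 n) q
  frame_smooth : ∀ a i, ContMDiffOn (𝓡 n) (𝓡 n).tangent ∞
    (fun q => (⟨q, frame a i q⟩ : TangentBundle (𝓡 n) M)) (U a)
  frame_orthonormal : ∀ a, ∀ q ∈ U a, Orthonormal ℝ fun i => frame a i q
  lift : ι → ι → M → Cl n
  lift_mem : ∀ a b, ∀ q ∈ U a ∩ U b, lift a b q ∈ spinGroup (negSq n)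
  lift_smooth : ∀ a b (φ : Cl n →ₗ[ℝ] ℝ),
    ContMDiffOn (𝓡 n) 𝓘(ℝ, ℝ) ∞ (fun q => φ (lift a b q)) (U a ∩ U b)
  /-- `lift a b` covers the change of frames: if `v_a` denotes the coordinates of a tangent
  vector in the frame `a`, then `v_a = (lift a b) v_b (lift a b)⁻¹`. -/
  lift_frame : ∀ a b, ∀ q ∈ U a ∩ U b, ∀ v : TangentSpace (𝓡 n) q,
    lift a b q * clVec (fun i => inner ℝ (frame b i q) v) =
      clVec (fun i => inner ℝ (frame a i q) v) * lift a b q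
  cocycle : ∀ a b c, ∀ q ∈ U a ∩ U b ∩ U c, lift a b q * lift b c q = lift a c q

variable {ι : Type*}

/-- Clifford multiplication by the tangent vector `v` at `q`, in the frame `a`. -/
def cliffordAct {N : ℕ} (𝔖 : SpinStructure n M ι) (ρ : SpinorModule n N) (a : ι) (q : M)
    (v : TangentSpace (𝓡 n) q) : Matrix (Fin N) (Fin N) ℂ :=
  ρ.act (clVec fun i => inner ℝ (𝔖.frame a i q) v)

/-- A family `(ψ_a)` of functions `ψ_a : U_a → ℂᴺ` is a smooth section over the open set `W` of the
spinor bundle `ΣM`, the vector bundle with fibre `ℂᴺ` associated with the spin structure. -/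
structure IsSpinorField {N : ℕ} (𝔖 : SpinStructure n M ι) (ρ : SpinorModule n N) (W : Set M)
    (ψ : ι → M → Fin N → ℂ) : Prop where
  compat : ∀ a b, ∀ q ∈ W ∩ (𝔖.U a ∩ 𝔖.U b), ψ a q = ρ.act (𝔖.lift a b q) *ᵥ ψ b q
  smooth : ∀ a, ContMDiffOn (𝓡 n) 𝓘(ℝ, Fin N → ℂ) ∞ (ψ a) (W ∩ 𝔖.U a)

/-- The spinorial Levi-Civita covariant derivative
`∇_v ψ = v(ψ) + (1/4) ∑_{s,t} g(∇_v e_s, e_t) eˢ · eᵗ · ψ` in the frame `a`. -/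
def spinDeriv {N : ℕ} (cov : CovariantDerivative (𝓡 n) (E n) (TangentSpace (𝓡 n) : M → Type _))
    (𝔖 : SpinStructure n M ι) (ρ : SpinorModule n N) (ψ : ι → M → Fin N → ℂ) (a : ι) (q : M)
    (v : TangentSpace (𝓡 n) q) : Fin N → ℂ :=
  mvfderiv (𝓡 n) (ψ a) q v +
    (1 / 4 : ℂ) • ∑ s, ∑ t,
      ((inner ℝ (cov (𝔖.frame a s) q v) (𝔖.frame a t q) : ℝ) : ℂ) •
        (ρ.act (clGen s * clGen t) *ᵥ ψ a q)

/-- The Dirac operator `∑_i eⁱ · ∇_{e_i}`. -/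
def dirac {N : ℕ} (cov : CovariantDerivative (𝓡 n) (E n) (TangentSpace (𝓡 n) : M → Type _))
    (𝔖 : SpinStructure n M ι) (ρ : SpinorModule n N) (ψ : ι → M → Fin N → ℂ) :
    ι → M → Fin N → ℂ :=
  fun a q => ∑ i, ρ.act (clGen i) *ᵥ spinDeriv cov 𝔖 ρ ψ a q (𝔖.frame a i q)

/-- The columns of `τ` form a basis of sections of `ΣM` over `U_p`, obtained from a basis of
`Σ_pM` by parallel transport along the geodesics through `p`. -/
structure IsParallelSpinorFrame {N : ℕ}
    (cov : CovariantDerivative (𝓡 n) (E n) (TangentSpace (𝓡 n) : M → Type _))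
    (𝔖 : SpinStructure n M ι) (ρ : SpinorModule n N) (X : OpenPartialHomeomorph M (E n))
    (τ : ι → M → Matrix (Fin N) (Fin N) ℂ) : Prop where
  section_col : ∀ k, IsSpinorField 𝔖 ρ X.source fun a q j => τ a q j k
  isUnit : ∀ a, ∀ q ∈ X.source ∩ 𝔖.U a, IsUnit (τ a q)
  parallel : ∀ k a, ∀ q ∈ X.source ∩ 𝔖.U a,
    spinDeriv cov 𝔖 ρ (fun a q j => τ a q j k) a q (radialField X q) = 0

/-- `κ` is the identification `Cl(T_pM) ⊗ ℂ ≃ End(Σ_pM)` given by Clifford multiplication, read in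
the basis `∂/∂x^i` of `T_pM` and the basis `τ` of `Σ_pM`. -/
def IsCliffordIdent {N : ℕ} (𝔖 : SpinStructure n M ι) (ρ : SpinorModule n N) (p : M)
    (X : OpenPartialHomeomorph M (E n)) (τ : ι → M → Matrix (Fin N) (Fin N) ℂ)
    (κ : SpinorModule n N) : Prop :=
  ∀ a, p ∈ 𝔖.U a → ∀ i, cliffordAct 𝔖 ρ a p (coordField X i p) * τ a p = τ a p * κ.act (clGen i)

/-- The operator `T` on spinor fields is, over `U_p`, the differential operator
`∑_{|γ| ≤ m} P_γ D^γ` with smooth coefficients in the coordinates `X` and the trivialisation `τ`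
of the spinor bundle. -/
def IsDiffOpInFrame {N : ℕ} (𝔖 : SpinStructure n M ι)
    (X : OpenPartialHomeomorph M (E n)) (τ : ι → M → Matrix (Fin N) (Fin N) ℂ) (m : ℕ)
    (T : (ι → M → Fin N → ℂ) → (ι → M → Fin N → ℂ)) (P : Coeffs n (Fin N)) : Prop :=
  SmoothCoeffs X.target m P ∧
    ∀ u : E n → Fin N → ℂ, ContDiffOn ℝ ∞ u X.target → ∀ a, ∀ q ∈ X.source ∩ 𝔖.U a,
      T (fun b y => τ b y *ᵥ u (X y)) a q = τ a q *ᵥ evalOp m P u (X q)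

/-- The coefficients `P_γ` of an operator of order `m` are geometric: their entries are, on `U_p`,
polynomials in the jets of the vielbeins of Gilkey order `m - |γ|`. -/
def IsGeometric {N : ℕ} (X : OpenPartialHomeomorph M (E n))
    (e : Fin n → Π q : M, TangentSpace (𝓡 n) q) (m : ℕ) (P : Coeffs n (Fin N)) : Prop :=
  ∀ γ ∈ multiIdx n m, ∀ j k : Fin N,
    ∃ f ∈ geometricPoly (vielbeinA X e) (vielbeinB X e) (m - ∑ i, γ i),
      EqOn (fun x => P γ x j k) f X.target

end Manifold

end Getzler

end

noncomputable section

namespace Getzler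


/-! ### Partial derivatives -/

section PartialDerivatives

variable {n : ℕ} {F G : Type*} [NormedAddCommGroup F] [NormedSpace ℝ F]
  [NormedAddCommGroup G] [NormedSpace ℝ G] {V : Set (E n)}

/-! The square of the Dirac operator is written out explicitly in normal coordinates and in the
radially parallel trivialisation, and the power of λ produced by the rescaling is read off term by
term. A derivative contributes λ⁻¹, the operator as a whole contributes λ², and every Clifford
generator contributes λ⁻¹, because conjugation by `U_λ` turns c(eˢ) into λ⁻¹(eˢ∧ - λ² e_s⌟). A term
with |γ| derivatives and q generators is therefore multiplied by λ^(2-|γ|-q), its scalar coefficient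
being evaluated at λx. Negative powers occur, so convergence has to come from cancellations and from
the vanishing of coefficients at the origin.

The cancellation is the Lichnerowicz formula (`localDirac_localDirac`). Expanding D² directly would
leave curvature multiplied by four generators, of weight λ⁻²; the first Bianchi identity collapses
this contraction to a scalar (`curvature_clifford_contraction`), of weight λ². What remains with
four generators is quadratic in the connection coefficients θ, and what remains with two generators
and one derivative is linear in θ (`localDirac_localDirac_eq_coeffs`).

The vanishing is a property of the radial gauge. The frame is parallel along the rays, so the
connection form has no radial component; differentiating ∑ x^k ζ_k = 0 once and twice at the origin
gives θ(0) = 0 and the antisymmetry of its first derivatives, whence ∂_j θ_ist(0) = -½ R_ijst(p)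
(`IsRadialFrame.pd_coeff`). Thus λ⁻¹θ(λx) converges smoothly to a linear function of x
(`IsRadialFrame.smoothConverges_coeff`), each θ absorbs one factor λ⁻¹, and the limits are the
coefficients of the expanded model operator (`modelOp_eq_evalOp`). Geometricity comes from the
Koszul formula (`koszul`): θ is a polynomial in the vielbeins and in their first derivatives, so
each coefficient of D² has the order dictated by homogeneity.

To use these local formulas, D must be shown to have the expected form in the trivialisation τ
(`dirac_eq_localDirac`). Clifford multiplication by the parallel frame, read in τ, is radially
constant, hence constant (`IsParallelGauge.frameClifford_mul`). The connection form in τ then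
differs from the spin lift of θ by something commuting with all generators, that is by a scalar
(`SpinorModule.eq_scalar_of_commute`). Its trace is the logarithmic derivative of det τ, a closed
one-form without radial component; such a form is zero (`closed_radial_gauge_eq_zero`), so the
scalar vanishes (`IsParallelGauge.gaugeForm_eq`). -/

theorem differentiableAt_of_contDiffOn {f : E n → F} (hV : IsOpen V) (hf : ContDiffOn ℝ ∞ f V)
    {x : E n} (hx : x ∈ V) : DifferentiableAt ℝ f x :=
  (hf.contDiffAt (hV.mem_nhds hx)).differentiableAt (by simp)

theorem contDiffOn_pd {f : E n → F} (hV : IsOpen V) (hf : ContDiffOn ℝ ∞ f V) (i : Fin n) :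
    ContDiffOn ℝ ∞ (pd i f) V :=
  (hf.fderiv_of_isOpen hV (by simp)).clm_apply contDiffOn_const

theorem contDiffOn_pd_iterate {f : E n → F} (hV : IsOpen V) (hf : ContDiffOn ℝ ∞ f V) (i : Fin n)
    (k : ℕ) : ContDiffOn ℝ ∞ ((pd i)^[k] f) V := by
  induction k with
  | zero => simpa using hf
  | succ k ih => rw [Function.iterate_succ_apply']; exact contDiffOn_pd hV ih i

theorem pd_eqOn {f g : E n → F} (hV : IsOpen V) (h : EqOn f g V) (i : Fin n) :
    EqOn (pd i f) (pd i g) V := fun x hx => by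
  simp only [pd, (h.eventuallyEq_of_mem (hV.mem_nhds hx)).fderiv_eq]

theorem pd_iterate_eqOn {f g : E n → F} (hV : IsOpen V) (h : EqOn f g V) (i : Fin n) (k : ℕ) :
    EqOn ((pd i)^[k] f) ((pd i)^[k] g) V := by
  induction k with
  | zero => simpa using h
  | succ k ih => simp only [Function.iterate_succ_apply']; exact pd_eqOn hV ih i

theorem pd_comm {f : E n → F} (hV : IsOpen V) (hf : ContDiffOn ℝ ∞ f V) (i j : Fin n) :
    EqOn (pd i (pd j f)) (pd j (pd i f)) V := fun x hx => by
  have hf2 : DifferentiableAt ℝ (fderiv ℝ f) x :=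
    differentiableAt_of_contDiffOn hV (hf.fderiv_of_isOpen hV (by simp)) hx
  have hs : IsSymmSndFDerivAt ℝ f x :=
    (hf.contDiffAt (hV.mem_nhds hx)).isSymmSndFDerivAt
      (by rw [minSmoothness_of_isRCLikeNormedField]; exact WithTop.coe_le_coe.2 (le_top (a := (2 : ℕ∞))))
  have key : ∀ a b : E n, fderiv ℝ (fun y => fderiv ℝ f y a) x b = fderiv ℝ (fderiv ℝ f) x b a := by
    intro a b
    rw [fderiv_clm_apply hf2 (differentiableAt_const a)]
    simp
  exact (key _ _).trans ((hs.eq _ _).trans (key _ _).symm)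

theorem pd_pd_iterate_comm {f : E n → F} (hV : IsOpen V) (hf : ContDiffOn ℝ ∞ f V) (i j : Fin n)
    (k : ℕ) : EqOn (pd j ((pd i)^[k] f)) ((pd i)^[k] (pd j f)) V := by
  induction k with
  | zero => exact fun x _ => rfl
  | succ k ih =>
    simp only [Function.iterate_succ_apply']
    exact (pd_comm hV (contDiffOn_pd_iterate hV hf i k) j i).trans (pd_eqOn hV ih i)

@[simp] theorem pd_const (i : Fin n) (c : F) : pd i (fun _ : E n => c) = 0 := by
  ext x; simp [pd]

theorem pd_add {f g : E n → F} {x : E n} (hf : DifferentiableAt ℝ f x)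
    (hg : DifferentiableAt ℝ g x) (i : Fin n) :
    pd i (fun y => f y + g y) x = pd i f x + pd i g x := by
  simp [pd, fderiv_fun_add hf hg]

theorem pd_sub {f g : E n → F} {x : E n} (hf : DifferentiableAt ℝ f x)
    (hg : DifferentiableAt ℝ g x) (i : Fin n) :
    pd i (fun y => f y - g y) x = pd i f x - pd i g x := by
  simp [pd, fderiv_fun_sub hf hg]

theorem pd_sum {ι : Type*} {s : Finset ι} {f : ι → E n → F} {x : E n}
    (hf : ∀ k ∈ s, DifferentiableAt ℝ (f k) x) (i : Fin n) :
    pd i (fun y => ∑ k ∈ s, f k y) x = ∑ k ∈ s, pd i (f k) x := by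
  simp [pd, fderiv_fun_sum hf]

theorem pd_smul {g : E n → ℝ} {f : E n → F} {x : E n} (hg : DifferentiableAt ℝ g x)
    (hf : DifferentiableAt ℝ f x) (i : Fin n) :
    pd i (fun y => g y • f y) x = g x • pd i f x + pd i g x • f x := by
  simp [pd, fderiv_fun_smul hg hf]

theorem pd_mul {A : Type*} [NormedRing A] [NormedAlgebra ℝ A] {f g : E n → A} {x : E n}
    (hf : DifferentiableAt ℝ f x) (hg : DifferentiableAt ℝ g x) (i : Fin n) :
    pd i (fun y => f y * g y) x = f x * pd i g x + pd i f x * g x := by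
  simp [pd, fderiv_fun_mul' hf hg]

theorem pd_clm (L : F →L[ℝ] G) {f : E n → F} {x : E n} (hf : DifferentiableAt ℝ f x) (i : Fin n) :
    pd i (fun y => L (f y)) x = L (pd i f x) := by
  have := (L.hasFDerivAt.comp x hf.hasFDerivAt).fderiv
  simp only [Function.comp_def] at this
  simp [pd, this]

theorem pd_coord (i j : Fin n) (x : E n) :
    pd i (fun y : E n => y j) x = if i = j then 1 else 0 := by
  have := pd_clm (n := n) (EuclideanSpace.proj j : E n →L[ℝ] ℝ) (f := id) (x := x)
    differentiableAt_id i
  refine this.trans ?_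
  simp [pd, eq_comm]

theorem fderiv_eq_sum_pd (f : E n → F) (x v : E n) :
    fderiv ℝ f x v = ∑ i, v i • pd i f x := by
  conv_lhs => rw [← (EuclideanSpace.basisFun (Fin n) ℝ).sum_repr v]
  simp [pd]

/-! ### Iterated partial derivatives -/

theorem foldr_pd_contDiffOn (hV : IsOpen V) {f : E n → F} (hf : ContDiffOn ℝ ∞ f V)
    (γ : Fin n → ℕ) (l : List (Fin n)) :
    ContDiffOn ℝ ∞ (l.foldr (fun i h => (pd i)^[γ i] h) f) V := by
  induction l with
  | nil => simpa using hf
  | cons i l ih => exact contDiffOn_pd_iterate hV ih i _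

theorem foldr_pd_congr_index (f : E n → F) {γ γ' : Fin n → ℕ} (l : List (Fin n))
    (h : ∀ i ∈ l, γ i = γ' i) :
    l.foldr (fun i h => (pd i)^[γ i] h) f = l.foldr (fun i h => (pd i)^[γ' i] h) f := by
  induction l with
  | nil => rfl
  | cons i l ih =>
    simp only [List.foldr_cons]
    rw [ih fun j hj => h j (List.mem_cons_of_mem _ hj), h i List.mem_cons_self]

/-- The new derivative enters on the left and is commuted past the earlier coordinates until it
reaches its own slot. Since the list has no repetition that slot is unique, and raising the exponent
of j disturbs no other one. -/
theorem pd_foldr_pd (hV : IsOpen V) {f : E n → F} (hf : ContDiffOn ℝ ∞ f V) (γ : Fin n → ℕ)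
    (j : Fin n) (l : List (Fin n)) (hl : l.Nodup) (hj : j ∈ l) :
    EqOn (pd j (l.foldr (fun i h => (pd i)^[γ i] h) f))
      (l.foldr (fun i h => (pd i)^[(γ + Pi.single j 1 : Fin n → ℕ) i] h) f) V := by
  induction l with
  | nil => simp at hj
  | cons i l ih =>
    rw [List.nodup_cons] at hl
    simp only [List.foldr_cons]
    by_cases hij : i = j
    · subst hij
      rw [foldr_pd_congr_index f (γ := γ + Pi.single i 1) (γ' := γ) l]
      · simp [Function.iterate_succ_apply', EqOn]
      · intro k hk
        have : k ≠ i := fun h => hl.1 (h ▸ hk)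
        simp [this]
    · have hjl : j ∈ l := by
        rcases List.mem_cons.1 hj with h | h
        · exact absurd h.symm hij
        · exact h
      refine (pd_pd_iterate_comm hV (foldr_pd_contDiffOn hV hf γ l) i j _).trans ?_
      have h2 := pd_iterate_eqOn hV (ih hl.2 hjl) i (γ i)
      simpa [hij] using h2

theorem contDiffOn_pdPow (hV : IsOpen V) {f : E n → F} (hf : ContDiffOn ℝ ∞ f V)
    (γ : Fin n → ℕ) : ContDiffOn ℝ ∞ (pdPow γ f) V :=
  foldr_pd_contDiffOn hV hf γ _

theorem pd_pdPow (hV : IsOpen V) {f : E n → F} (hf : ContDiffOn ℝ ∞ f V) (γ : Fin n → ℕ)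
    (j : Fin n) : EqOn (pd j (pdPow γ f)) (pdPow (γ + Pi.single j 1) f) V :=
  pd_foldr_pd hV hf γ j _ (List.nodup_finRange n) (List.mem_finRange j)

@[simp] theorem pdPow_zero (f : E n → F) : pdPow 0 f = f := by
  have : ∀ l : List (Fin n),
      l.foldr (fun i h => (pd i)^[(0 : Fin n → ℕ) i] h) f = f := by
    intro l
    induction l with
    | nil => rfl
    | cons i l ih => simp only [List.foldr_cons, ih]; rfl
  exact this _

theorem pdPow_single (hV : IsOpen V) {f : E n → F} (hf : ContDiffOn ℝ ∞ f V) (j : Fin n) :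
    EqOn (pdPow (Pi.single j 1) f) (pd j f) V := by
  have := pd_pdPow hV hf 0 j
  rw [pdPow_zero, zero_add] at this
  exact this.symm

theorem pdPow_single_add_single (hV : IsOpen V) {f : E n → F} (hf : ContDiffOn ℝ ∞ f V)
    (j k : Fin n) : EqOn (pdPow (Pi.single j 1 + Pi.single k 1) f) (pd j (pd k f)) V := by
  have h1 := pd_pdPow hV hf (Pi.single k 1) j
  rw [add_comm] at h1
  exact h1.symm.trans (pd_eqOn hV (pdPow_single hV hf k) j)

theorem pd_comp_smul (f : E n → F) (c : ℝ) (i : Fin n) :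
    pd i (fun y => f (c • y)) = fun x => c • pd i f (c • x) := by
  ext x
  simp only [pd]
  rw [fderiv_comp_smul]
  simp

theorem pd_const_smul (f : E n → F) (c : ℝ) (i : Fin n) :
    pd i (fun y => c • f y) = fun x => c • pd i f x := by
  ext x
  have := congrFun (fderiv_const_smul_field (𝕜 := ℝ) (f := f) c) x
  simp only [pd]
  change fderiv ℝ (c • f) x _ = _
  rw [this]; simp

/-- The chain rule for a dilation needs no differentiability, so this holds for every f. It is the
source of the power of λ attached to a derivative. -/
theorem pdPow_comp_smul (f : E n → F) (c : ℝ) (γ : Fin n → ℕ) :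
    pdPow γ (fun y => f (c • y)) = fun x => c ^ (∑ i, γ i) • pdPow γ f (c • x) := by
  -- The exponent a records the factors already produced by the derivatives taken before the current
  -- coordinate.
  have iter : ∀ (i : Fin n) (k a : ℕ) (g : E n → F),
      (pd i)^[k] (fun x => c ^ a • g (c • x)) = fun x => c ^ (k + a) • (pd i)^[k] g (c • x) := by
    intro i k a g
    induction k with
    | zero => simp
    | succ k ih =>
      rw [Function.iterate_succ_apply', ih, pd_const_smul, pd_comp_smul]
      ext x
      simp only [smul_smul, Function.iterate_succ_apply']
      ring_nf
  have : ∀ l : List (Fin n), l.foldr (fun i h => (pd i)^[γ i] h) (fun y => f (c • y)) =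
      fun x => c ^ (l.map γ).sum • l.foldr (fun i h => (pd i)^[γ i] h) f (c • x) := by
    intro l
    induction l with
    | nil => simp
    | cons i l ih =>
      simp only [List.foldr_cons, ih, List.map_cons, List.sum_cons]
      exact iter _ _ _ _
  rw [← List.sum_ofFn, List.ofFn_eq_map]
  exact this _

end PartialDerivatives

/-! ### Second order operators given by a symbol -/

section SecondOrder

variable {n : ℕ} {κ : Type}

theorem mem_multiIdx {m : ℕ} {γ : Fin n → ℕ} : γ ∈ multiIdx n m ↔ ∑ i, γ i ≤ m := by
  simp [multiIdx]

/-- The coefficients of the operator `∑ M₂^{jk} ∂_j ∂_k + ∑ M₁^k ∂_k + M₀`. -/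
def secondOrderCoeffs (M₂ : Fin n → Fin n → E n → Matrix κ κ ℂ) (M₁ : Fin n → E n → Matrix κ κ ℂ)
    (M₀ : E n → Matrix κ κ ℂ) : Coeffs n κ := fun γ x =>
  (∑ j, ∑ k, if (Pi.single j 1 + Pi.single k 1 : Fin n → ℕ) = γ then M₂ j k x else 0) +
    (∑ k, if (Pi.single k 1 : Fin n → ℕ) = γ then M₁ k x else 0) + if 0 = γ then M₀ x else 0

/-- Several pairs (j,k) have the same multi-index and their contributions add up in one coefficient.
Summing over γ first returns to each pair its own term, so M₂ need not be symmetric. -/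
theorem evalOp_secondOrderCoeffs [Fintype κ] {V : Set (E n)} (hV : IsOpen V)
    (M₂ : Fin n → Fin n → E n → Matrix κ κ ℂ) (M₁ : Fin n → E n → Matrix κ κ ℂ)
    (M₀ : E n → Matrix κ κ ℂ) {u : E n → κ → ℂ} (hu : ContDiffOn ℝ ∞ u V) {x : E n} (hx : x ∈ V) :
    evalOp 2 (secondOrderCoeffs M₂ M₁ M₀) u x =
      (∑ j, ∑ k, M₂ j k x *ᵥ pd j (pd k u) x) + (∑ k, M₁ k x *ᵥ pd k u x) + M₀ x *ᵥ u x := by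
  have pick : ∀ (δ : Fin n → ℕ) (M : Matrix κ κ ℂ), ∑ i, δ i ≤ 2 →
      ∑ γ ∈ multiIdx n 2, (if δ = γ then M else 0) *ᵥ pdPow γ u x = M *ᵥ pdPow δ u x := by
    intro δ M hδ
    rw [Finset.sum_eq_single δ]
    · simp
    · intro γ _ hγ
      simp [hγ.symm]
    · intro h
      exact absurd (mem_multiIdx.2 hδ) h
  simp only [evalOp, secondOrderCoeffs, Matrix.add_mulVec, Finset.sum_add_distrib,
    Matrix.sum_mulVec]
  congr 1
  · congr 1
    · rw [Finset.sum_comm]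
      refine Finset.sum_congr rfl fun j _ => ?_
      rw [Finset.sum_comm]
      refine Finset.sum_congr rfl fun k _ => ?_
      rw [pick _ _ (by simp [Finset.sum_add_distrib]), pdPow_single_add_single hV hu j k hx]
    · rw [Finset.sum_comm]
      refine Finset.sum_congr rfl fun k _ => ?_
      rw [pick _ _ (by simp), pdPow_single hV hu k hx]
  · rw [pick _ _ (by simp), pdPow_zero]

theorem smoothCoeffs_secondOrderCoeffs {V : Set (E n)}
    {M₂ : Fin n → Fin n → E n → Matrix κ κ ℂ} {M₁ : Fin n → E n → Matrix κ κ ℂ}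
    {M₀ : E n → Matrix κ κ ℂ} (h₂ : ∀ j k I J, ContDiffOn ℝ ∞ (fun x => M₂ j k x I J) V)
    (h₁ : ∀ k I J, ContDiffOn ℝ ∞ (fun x => M₁ k x I J) V)
    (h₀ : ∀ I J, ContDiffOn ℝ ∞ (fun x => M₀ x I J) V) :
    SmoothCoeffs V 2 (secondOrderCoeffs M₂ M₁ M₀) := by
  intro γ _ I J
  simp only [secondOrderCoeffs, Matrix.add_apply, Matrix.sum_apply]
  refine ContDiffOn.add (ContDiffOn.add ?_ ?_) ?_
  · refine ContDiffOn.sum fun j _ => ContDiffOn.sum fun k _ => ?_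
    split_ifs
    exacts [h₂ j k I J, contDiffOn_const]
  · refine ContDiffOn.sum fun k _ => ?_
    split_ifs
    exacts [h₁ k I J, contDiffOn_const]
  · split_ifs
    exacts [h₀ I J, contDiffOn_const]

end SecondOrder


/-! ### Smooth convergence of families of functions -/

section SmoothConvergence

variable {n : ℕ} {V : Set (E n)}

/-- `f_λ` and its partial derivatives of order at most `k` converge to `f₀`, respectively to its
partial derivatives, locally uniformly on `V` as `λ → 0⁺`. -/
def ConvergesToOrder (V : Set (E n)) : ℕ → (ℝ → E n → ℂ) → (E n → ℂ) → Prop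
  | 0, f, f₀ => TendstoLocallyUniformlyOn f f₀ (𝓝[>] 0) V
  | k + 1, f, f₀ => TendstoLocallyUniformlyOn f f₀ (𝓝[>] 0) V ∧
      ∀ i, ConvergesToOrder V k (fun lam => pd i (f lam)) (pd i f₀)

theorem eventually_mem_Ioo : ∀ᶠ lam in 𝓝[>] (0 : ℝ), lam ∈ Ioo (0 : ℝ) 1 :=
  Ioo_mem_nhdsGT one_pos

theorem ConvergesToOrder.of_succ {k : ℕ} {f : ℝ → E n → ℂ} {f₀ : E n → ℂ}
    (h : ConvergesToOrder V (k + 1) f f₀) : ConvergesToOrder V k f f₀ := by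
  induction k generalizing f f₀ with
  | zero => exact h.1
  | succ k ih => exact ⟨h.1, fun i => ih (h.2 i)⟩

theorem ConvergesToOrder.congr (hV : IsOpen V) {k : ℕ} {f g : ℝ → E n → ℂ} {f₀ g₀ : E n → ℂ}
    (h : ConvergesToOrder V k f f₀) (hfg : ∀ lam ∈ Ioo (0 : ℝ) 1, EqOn (f lam) (g lam) V)
    (hfg₀ : EqOn f₀ g₀ V) : ConvergesToOrder V k g g₀ := by
  have base : ∀ {f g : ℝ → E n → ℂ} {f₀ g₀ : E n → ℂ},
      TendstoLocallyUniformlyOn f f₀ (𝓝[>] 0) V →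
      (∀ lam ∈ Ioo (0 : ℝ) 1, EqOn (f lam) (g lam) V) → EqOn f₀ g₀ V →
      TendstoLocallyUniformlyOn g g₀ (𝓝[>] 0) V := fun h1 h2 h3 =>
    (h1.congr_inseparable (eventually_mem_Ioo.mono fun lam hlam x hx =>
      Inseparable.of_eq (h2 lam hlam hx))).congr_right h3
  induction k generalizing f g f₀ g₀ with
  | zero => exact base h hfg hfg₀
  | succ k ih => exact ⟨base h.1 hfg hfg₀, fun i => ih (h.2 i)
      (fun lam hlam => pd_eqOn hV (hfg lam hlam) i) (pd_eqOn hV hfg₀ i)⟩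

theorem ConvergesToOrder.add (hV : IsOpen V) {k : ℕ} {f g : ℝ → E n → ℂ} {f₀ g₀ : E n → ℂ}
    (hf : ConvergesToOrder V k f f₀) (hg : ConvergesToOrder V k g g₀)
    (sf : ∀ lam ∈ Ioo (0 : ℝ) 1, ContDiffOn ℝ ∞ (f lam) V) (sf₀ : ContDiffOn ℝ ∞ f₀ V)
    (sg : ∀ lam ∈ Ioo (0 : ℝ) 1, ContDiffOn ℝ ∞ (g lam) V) (sg₀ : ContDiffOn ℝ ∞ g₀ V) :
    ConvergesToOrder V k (fun lam x => f lam x + g lam x) (fun x => f₀ x + g₀ x) := by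
  induction k generalizing f g f₀ g₀ with
  | zero => exact TendstoLocallyUniformlyOn.fun_add hf hg
  | succ k ih =>
    refine ⟨TendstoLocallyUniformlyOn.fun_add hf.1 hg.1, fun i => ?_⟩
    refine (ih (hf.2 i) (hg.2 i) (fun lam hlam => contDiffOn_pd hV (sf lam hlam) i)
      (contDiffOn_pd hV sf₀ i) (fun lam hlam => contDiffOn_pd hV (sg lam hlam) i)
      (contDiffOn_pd hV sg₀ i)).congr hV (fun lam hlam x hx => ?_) (fun x hx => ?_)
    · exact (pd_add (differentiableAt_of_contDiffOn hV (sf lam hlam) hx)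
        (differentiableAt_of_contDiffOn hV (sg lam hlam) hx) i).symm
    · exact (pd_add (differentiableAt_of_contDiffOn hV sf₀ hx)
        (differentiableAt_of_contDiffOn hV sg₀ hx) i).symm

/-- By the Leibniz rule order k+1 reduces to order k for two products, each with one
undifferentiated factor, which `of_succ` brings down to order k. Continuity of the limits is what
lets locally uniform convergence pass to products. -/
theorem ConvergesToOrder.mul (hV : IsOpen V) {k : ℕ} {f g : ℝ → E n → ℂ} {f₀ g₀ : E n → ℂ}
    (hf : ConvergesToOrder V k f f₀) (hg : ConvergesToOrder V k g g₀)
    (sf : ∀ lam ∈ Ioo (0 : ℝ) 1, ContDiffOn ℝ ∞ (f lam) V) (sf₀ : ContDiffOn ℝ ∞ f₀ V)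
    (sg : ∀ lam ∈ Ioo (0 : ℝ) 1, ContDiffOn ℝ ∞ (g lam) V) (sg₀ : ContDiffOn ℝ ∞ g₀ V) :
    ConvergesToOrder V k (fun lam x => f lam x * g lam x) (fun x => f₀ x * g₀ x) := by
  induction k generalizing f g f₀ g₀ with
  | zero => exact TendstoLocallyUniformlyOn.fun_mul₀ hf hg sf₀.continuousOn sg₀.continuousOn
  | succ k ih =>
    refine ⟨TendstoLocallyUniformlyOn.fun_mul₀ hf.1 hg.1 sf₀.continuousOn sg₀.continuousOn,
      fun i => ?_⟩
    have dsf := fun lam hlam => contDiffOn_pd hV (sf lam hlam) i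
    have dsg := fun lam hlam => contDiffOn_pd hV (sg lam hlam) i
    have dsf₀ := contDiffOn_pd hV sf₀ i
    have dsg₀ := contDiffOn_pd hV sg₀ i
    refine (ConvergesToOrder.add hV (ih hf.of_succ (hg.2 i) sf sf₀ dsg dsg₀)
      (ih (hf.2 i) hg.of_succ dsf dsf₀ sg sg₀)
      (fun lam hlam => (sf lam hlam).mul (dsg lam hlam)) (sf₀.mul dsg₀)
      (fun lam hlam => (dsf lam hlam).mul (sg lam hlam)) (dsf₀.mul sg₀)).congr hV
      (fun lam hlam x hx => ?_) (fun x hx => ?_)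
    · exact (pd_mul (differentiableAt_of_contDiffOn hV (sf lam hlam) hx)
        (differentiableAt_of_contDiffOn hV (sg lam hlam) hx) i).symm
    · exact (pd_mul (differentiableAt_of_contDiffOn hV sf₀ hx)
        (differentiableAt_of_contDiffOn hV sg₀ hx) i).symm

/-- The smooth functions `f_λ`, `0 < λ < 1`, converge as `λ → 0⁺` to the smooth function `f₀`, with
all their derivatives, locally uniformly on `V`. -/
structure SmoothConverges (V : Set (E n)) (f : ℝ → E n → ℂ) (f₀ : E n → ℂ) : Prop where
  smooth : ∀ lam ∈ Ioo (0 : ℝ) 1, ContDiffOn ℝ ∞ (f lam) V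
  smooth_limit : ContDiffOn ℝ ∞ f₀ V
  converges : ∀ k, ConvergesToOrder V k f f₀

/-! ### Stability of smooth convergence under algebra and differentiation -/

namespace SmoothConverges

variable {f g : ℝ → E n → ℂ} {f₀ g₀ : E n → ℂ}

theorem congr (hV : IsOpen V) (h : SmoothConverges V f f₀)
    (hfg : ∀ lam ∈ Ioo (0 : ℝ) 1, EqOn (f lam) (g lam) V) (hfg₀ : EqOn f₀ g₀ V) :
    SmoothConverges V g g₀ where
  smooth lam hlam := (h.smooth lam hlam).congr fun _ hx => (hfg lam hlam hx).symm
  smooth_limit := h.smooth_limit.congr fun _ hx => (hfg₀ hx).symm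
  converges k := (h.converges k).congr hV hfg hfg₀

theorem add (hV : IsOpen V) (hf : SmoothConverges V f f₀) (hg : SmoothConverges V g g₀) :
    SmoothConverges V (fun lam x => f lam x + g lam x) (fun x => f₀ x + g₀ x) where
  smooth lam hlam := (hf.smooth lam hlam).add (hg.smooth lam hlam)
  smooth_limit := hf.smooth_limit.add hg.smooth_limit
  converges k := (hf.converges k).add hV (hg.converges k) hf.smooth hf.smooth_limit hg.smooth
    hg.smooth_limit

theorem mul (hV : IsOpen V) (hf : SmoothConverges V f f₀) (hg : SmoothConverges V g g₀) :
    SmoothConverges V (fun lam x => f lam x * g lam x) (fun x => f₀ x * g₀ x) where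
  smooth lam hlam := (hf.smooth lam hlam).mul (hg.smooth lam hlam)
  smooth_limit := hf.smooth_limit.mul hg.smooth_limit
  converges k := (hf.converges k).mul hV (hg.converges k) hf.smooth hf.smooth_limit hg.smooth
    hg.smooth_limit

theorem of_tendsto {c : ℝ → ℂ} {c₀ : ℂ} (h : Tendsto c (𝓝[>] 0) (𝓝 c₀)) :
    SmoothConverges V (fun lam _ => c lam) (fun _ => c₀) where
  smooth _ _ := contDiffOn_const
  smooth_limit := contDiffOn_const
  converges k := by
    have hz : ∀ k, ConvergesToOrder V k (fun _ => (0 : E n → ℂ)) 0 := by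
      intro k
      have h0 : TendstoLocallyUniformlyOn (fun _ : ℝ => (0 : E n → ℂ)) 0 (𝓝[>] 0) V :=
        (tendsto_const_nhds.tendstoUniformlyOn_const V).tendstoLocallyUniformlyOn
      induction k with
      | zero => exact h0
      | succ k ih =>
        refine ⟨h0, fun i => ?_⟩
        have : pd i (0 : E n → ℂ) = 0 := pd_const i (0 : ℂ)
        simpa only [this] using ih
    have h0 : TendstoLocallyUniformlyOn (fun lam (_ : E n) => c lam) (fun _ => c₀) (𝓝[>] 0) V :=
      (h.tendstoUniformlyOn_const V).tendstoLocallyUniformlyOn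
    cases k with
    | zero => exact h0
    | succ k =>
      refine ⟨h0, fun i => ?_⟩
      simpa only [pd_const] using hz k

theorem const (c : ℂ) : SmoothConverges V (fun _ _ => c) (fun _ => c) :=
  of_tendsto tendsto_const_nhds

theorem sum (hV : IsOpen V) {ι : Type*} (s : Finset ι) {f : ι → ℝ → E n → ℂ} {f₀ : ι → E n → ℂ}
    (h : ∀ i ∈ s, SmoothConverges V (f i) (f₀ i)) :
    SmoothConverges V (fun lam x => ∑ i ∈ s, f i lam x) (fun x => ∑ i ∈ s, f₀ i x) := by
  classical
  induction s using Finset.induction_on with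
  | empty => simpa using const 0
  | insert i s his ih =>
    simp only [Finset.sum_insert his]
    exact (h i (Finset.mem_insert_self _ _)).add hV
      (ih fun j hj => h j (Finset.mem_insert_of_mem hj))

theorem pd (hV : IsOpen V) (h : SmoothConverges V f f₀) (i : Fin n) :
    SmoothConverges V (fun lam => pd i (f lam)) (pd i f₀) where
  smooth lam hlam := contDiffOn_pd hV (h.smooth lam hlam) i
  smooth_limit := contDiffOn_pd hV h.smooth_limit i
  converges k := (h.converges (k + 1)).2 i

theorem pdPow (hV : IsOpen V) (h : SmoothConverges V f f₀) (γ : Fin n → ℕ) :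
    SmoothConverges V (fun lam => pdPow γ (f lam)) (pdPow γ f₀) := by
  have iter : ∀ (i : Fin n) (k : ℕ) (f : ℝ → E n → ℂ) (f₀ : E n → ℂ), SmoothConverges V f f₀ →
      SmoothConverges V (fun lam => (Getzler.pd i)^[k] (f lam)) ((Getzler.pd i)^[k] f₀) := by
    intro i k f f₀ h
    induction k with
    | zero => simpa using h
    | succ k ih =>
      simp only [Function.iterate_succ_apply']
      exact ih.pd hV i
  have : ∀ l : List (Fin n),
      SmoothConverges V (fun lam => l.foldr (fun i h => (Getzler.pd i)^[γ i] h) (f lam))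
        (l.foldr (fun i h => (Getzler.pd i)^[γ i] h) f₀) := by
    intro l
    induction l with
    | nil => simpa using h
    | cons i l ih =>
      simp only [List.foldr_cons]
      exact iter i (γ i) _ _ ih
  exact this _

theorem tendsto (h : SmoothConverges V f f₀) : TendstoLocallyUniformlyOn f f₀ (𝓝[>] 0) V :=
  h.converges 0

end SmoothConverges

/-! ### Rescaled functions -/

theorem mapsTo_smul_ball {r : ℝ} {lam : ℝ} (hlam : lam ∈ Ioo (0 : ℝ) 1) :
    MapsTo (fun x : E n => lam • x) (Metric.ball 0 r) (Metric.ball 0 r) := by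
  intro x hx
  rw [mem_ball_zero_iff] at hx ⊢
  rw [norm_smul, Real.norm_of_nonneg hlam.1.le]
  exact (mul_le_of_le_one_left (norm_nonneg x) hlam.2.le).trans_lt hx

theorem contDiffOn_comp_smul {F : Type*} [NormedAddCommGroup F] [NormedSpace ℝ F] {r : ℝ}
    {f : E n → F} (hf : ContDiffOn ℝ ∞ f (Metric.ball 0 r)) {lam : ℝ}
    (hlam : lam ∈ Ioo (0 : ℝ) 1) :
    ContDiffOn ℝ ∞ (fun x => f (lam • x)) (Metric.ball 0 r) :=
  hf.comp (contDiff_const_smul lam).contDiffOn (mapsTo_smul_ball hlam)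

/-- The ball is bounded, so λx tends to 0 uniformly in x; this is why the convergences below are
uniform on the whole ball. -/
theorem tendsto_smul_prod_ball (r : ℝ) :
    Tendsto (fun q : ℝ × E n => q.1 • q.2) (𝓝[>] 0 ×ˢ 𝓟 (Metric.ball 0 r)) (𝓝 0) := by
  have h1 : Tendsto (fun q : ℝ × E n => q.1) (𝓝[>] 0 ×ˢ 𝓟 (Metric.ball 0 r)) (𝓝 0) :=
    (tendsto_fst.mono_right nhdsWithin_le_nhds)
  have h2 : IsBoundedUnder (· ≤ ·) (𝓝[>] (0 : ℝ) ×ˢ 𝓟 (Metric.ball (0 : E n) r))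
      (norm ∘ fun q : ℝ × E n => q.2) := by
    refine ⟨r, ?_⟩
    rw [eventually_map]
    filter_upwards [tendsto_snd.eventually (mem_principal_self (Metric.ball (0 : E n) r))]
      with q hq
    exact (mem_ball_zero_iff.1 hq).le
  exact h1.zero_smul_isBoundedUnder_le h2

theorem smoothConverges_comp_smul {r : ℝ} (hr : 0 < r) {f : E n → ℂ}
    (hf : ContDiffOn ℝ ∞ f (Metric.ball 0 r)) :
    SmoothConverges (Metric.ball 0 r) (fun lam x => f (lam • x)) (fun _ => f 0) where
  smooth lam hlam := contDiffOn_comp_smul hf hlam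
  smooth_limit := contDiffOn_const
  converges k := by
    have hb : (0 : E n) ∈ Metric.ball (0 : E n) r := Metric.mem_ball_self hr
    have hlim : ∀ (m : ℕ) (f : E n → ℂ), ContDiffOn ℝ ∞ f (Metric.ball 0 r) →
        TendstoLocallyUniformlyOn (fun (lam : ℝ) (x : E n) => lam ^ m • f (lam • x))
          (fun _ => (0 : ℝ) ^ m • f 0) (𝓝[>] 0) (Metric.ball 0 r) := by
      intro m f hf
      refine TendstoUniformlyOn.tendstoLocallyUniformlyOn ?_
      rw [tendstoUniformlyOn_iff_tendsto]
      have h1 : Tendsto (fun q : ℝ × E n => q.1 ^ m • f (q.1 • q.2))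
          (𝓝[>] 0 ×ˢ 𝓟 (Metric.ball 0 r)) (𝓝 ((0 : ℝ) ^ m • f 0)) := by
        refine Tendsto.smul ?_ ?_
        · exact ((tendsto_fst.mono_right nhdsWithin_le_nhds).pow m)
        · exact (differentiableAt_of_contDiffOn Metric.isOpen_ball hf hb).continuousAt.tendsto.comp
            (tendsto_smul_prod_ball r)
      have h2 := (tendsto_const_nhds (x := (0 : ℝ) ^ m • f 0)
        (f := 𝓝[>] (0 : ℝ) ×ˢ 𝓟 (Metric.ball (0 : E n) r))).prodMk_nhds h1
      exact h2.mono_right (nhds_le_uniformity _)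
    -- Each derivative of f(λx) brings out a factor λ, so the induction must treat all the families
    -- λ^m f(λx) together. The limit 0^m f(0) is f(0) for m = 0 and 0 otherwise.
    have key : ∀ (k m : ℕ) (f : E n → ℂ), ContDiffOn ℝ ∞ f (Metric.ball 0 r) →
        ConvergesToOrder (Metric.ball 0 r) k (fun lam x => lam ^ m • f (lam • x))
          (fun _ => (0 : ℝ) ^ m • f 0) := by
      intro k
      induction k with
      | zero => exact hlim
      | succ k ih =>
        intro m f hf
        refine ⟨hlim m f hf, fun i => ?_⟩
        refine (ih (m + 1) (pd i f) (contDiffOn_pd Metric.isOpen_ball hf i)).congr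
          Metric.isOpen_ball (fun lam _ x _ => ?_) (fun x _ => ?_)
        · simp only [pd_const_smul, pd_comp_smul, smul_smul, pow_succ]
        · simp
    simpa using key k 0 f hf

theorem contDiff_ofReal_coord (j : Fin n) : ContDiff ℝ ∞ (fun x : E n => ((x j : ℝ) : ℂ)) :=
  Complex.ofRealCLM.contDiff.comp (EuclideanSpace.proj j : E n →L[ℝ] ℝ).contDiff

theorem pd_ofReal_coord (i j : Fin n) (x : E n) :
    pd i (fun y : E n => ((y j : ℝ) : ℂ)) x = if i = j then 1 else 0 := by
  have h : DifferentiableAt ℝ (fun y : E n => y j) x :=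
    (EuclideanSpace.proj j : E n →L[ℝ] ℝ).differentiableAt
  have := pd_clm Complex.ofRealCLM h i
  refine this.trans ?_
  rw [pd_coord]
  split_ifs <;> simp

/-- Differentiability at the origin gives the convergence of the functions. A partial derivative of
λ⁻¹f(λx) is (∂_i f)(λx), which the preceding lemma already handles, so no Taylor expansion with
remainder is needed. -/
theorem smoothConverges_inv_smul_comp_smul {r : ℝ} (hr : 0 < r) {f : E n → ℂ}
    (hf : ContDiffOn ℝ ∞ f (Metric.ball 0 r)) (h0 : f 0 = 0) :
    SmoothConverges (Metric.ball 0 r) (fun lam x => (lam : ℂ)⁻¹ * f (lam • x))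
      (fun x => ∑ j, x j * pd j f 0) where
  smooth lam hlam := contDiffOn_const.mul (contDiffOn_comp_smul hf hlam)
  smooth_limit := (ContDiff.sum fun j _ =>
    (contDiff_ofReal_coord j).mul contDiff_const).contDiffOn
  converges k := by
    have hb : (0 : E n) ∈ Metric.ball (0 : E n) r := Metric.mem_ball_self hr
    have hlim : TendstoLocallyUniformlyOn (fun (lam : ℝ) (x : E n) => (lam : ℂ)⁻¹ * f (lam • x))
        (fun x => ∑ j, x j * pd j f 0) (𝓝[>] 0) (Metric.ball 0 r) := by
      refine TendstoUniformlyOn.tendstoLocallyUniformlyOn ?_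
      rw [Metric.tendstoUniformlyOn_iff]
      intro ε hε
      have hd := (differentiableAt_of_contDiffOn Metric.isOpen_ball hf hb).hasFDerivAt
      -- The remainder at λx will be at most ε/(2r) · λ‖x‖ with ‖x‖ < r; after division by λ this is
      -- at most ε/2.
      have ho := hd.isLittleO.def (show 0 < ε / (2 * r) by positivity)
      have he := (tendsto_smul_prod_ball (n := n) r).eventually ho
      rw [eventually_prod_principal_iff] at he
      filter_upwards [he, self_mem_nhdsWithin] with lam hlam hpos x hx
      have hpos : 0 < lam := hpos
      have h1 := hlam x hx
      have h3 : ‖x‖ < r := mem_ball_zero_iff.1 hx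
      simp only [h0, sub_zero, map_smul, norm_smul, Real.norm_of_nonneg hpos.le] at h1
      have h2 : (lam : ℂ)⁻¹ * f (lam • x) - ∑ j, x j * pd j f 0 =
          lam⁻¹ • (f (lam • x) - lam • fderiv ℝ f 0 x) := by
        rw [smul_sub, smul_smul, inv_mul_cancel₀ hpos.ne', one_smul, fderiv_eq_sum_pd]
        simp
      rw [dist_comm, dist_eq_norm, h2, norm_smul, norm_inv, Real.norm_of_nonneg hpos.le]
      calc lam⁻¹ * ‖f (lam • x) - lam • fderiv ℝ f 0 x‖
          ≤ lam⁻¹ * (ε / (2 * r) * (lam * ‖x‖)) := by gcongr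
        _ = ε / (2 * r) * ‖x‖ := by field_simp
        _ ≤ ε / (2 * r) * r := by gcongr
        _ = ε / 2 := by field_simp
        _ < ε := by linarith
    cases k with
    | zero => exact hlim
    | succ k =>
      refine ⟨hlim, fun i => ?_⟩
      refine ((smoothConverges_comp_smul hr (contDiffOn_pd Metric.isOpen_ball hf i)).converges
        k).congr Metric.isOpen_ball (fun lam hlam x hx => ?_) (fun x _ => ?_)
      · have hc : (lam : ℂ) ≠ 0 := by exact_mod_cast hlam.1.ne'
        have h1 : DifferentiableAt ℝ (fun y => f (lam • y)) x :=
          differentiableAt_of_contDiffOn Metric.isOpen_ball (contDiffOn_comp_smul hf hlam) hx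
        rw [pd_mul (differentiableAt_const _) h1, pd_comp_smul]
        simp [hc]
      · have hd : ∀ j ∈ Finset.univ,
            DifferentiableAt ℝ (fun x : E n => ((x j : ℝ) : ℂ) * pd j f 0) x := fun j _ =>
          ((contDiff_ofReal_coord j).differentiable (by simp) x).mul (differentiableAt_const _)
        rw [pd_sum hd]
        simp only [pd_mul ((contDiff_ofReal_coord _).differentiable (by simp) x)
          (differentiableAt_const _), pd_ofReal_coord]
        simp

end SmoothConvergence


/-! ### Rescaling of the Clifford action on the exterior algebra -/

section Rescaling

variable {n : ℕ}

/-- The algebra endomorphism of the exterior algebra which multiplies vectors by `c`. -/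
def extScale (n : ℕ) (c : ℝ) : Ext n →ₐ[ℝ] Ext n :=
  ExteriorAlgebra.map (c • LinearMap.id)

theorem extScale_ι (c : ℝ) (v : Fin n → ℝ) :
    extScale n c (ExteriorAlgebra.ι ℝ v) = c • ExteriorAlgebra.ι ℝ v := by
  simp [extScale]

theorem extScale_basis (c : ℝ) (I : Finset (Fin n)) :
    extScale n c ((Pi.basisFun ℝ (Fin n)).ExteriorAlgebra I) =
      c ^ I.card • (Pi.basisFun ℝ (Fin n)).ExteriorAlgebra I := by
  have key : ∀ (k : ℕ) (w : Fin k → Fin n → ℝ), extScale n c (ExteriorAlgebra.ιMulti ℝ k w) =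
      c ^ k • ExteriorAlgebra.ιMulti ℝ k w := by
    intro k w
    have : (⇑(c • LinearMap.id : (Fin n → ℝ) →ₗ[ℝ] (Fin n → ℝ)) ∘ w) = fun i => c • w i := rfl
    rw [extScale, ExteriorAlgebra.map_apply_ιMulti, this, AlternatingMap.map_smul_univ]
    simp
  rw [ExteriorAlgebra.basis_apply]
  exact key _ _

/-- Contraction lowers the degree by one, so scaling before it costs one more factor c than scaling
after it. The proof follows the recursive formula for contraction under left multiplication by a
vector. -/
theorem contractLeft_extScale (c : ℝ) (d : Module.Dual ℝ (Fin n → ℝ)) (x : Ext n) :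
    CliffordAlgebra.contractLeft (Q := (0 : QuadraticForm ℝ (Fin n → ℝ))) d (extScale n c x) =
      c • extScale n c
        (CliffordAlgebra.contractLeft (Q := (0 : QuadraticForm ℝ (Fin n → ℝ))) d x) := by
  induction x using CliffordAlgebra.left_induction with
  | algebraMap r =>
    have h0 : CliffordAlgebra.contractLeft (Q := (0 : QuadraticForm ℝ (Fin n → ℝ))) d
        (algebraMap ℝ _ r) = 0 := CliffordAlgebra.contractLeft_algebraMap _ _ _
    have h1 : extScale n c (algebraMap ℝ (CliffordAlgebra (0 : QuadraticForm ℝ (Fin n → ℝ))) r) =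
        algebraMap ℝ _ r := AlgHom.commutes _ _
    rw [h0, map_zero, smul_zero, h1, h0]

  | add x y hx hy => simp only [map_add, hx, hy, smul_add]
  | ι_mul x m hx =>
    rw [CliffordAlgebra.contractLeft_ι_mul]
    have h2 : ∀ y : Ext n, extScale n c (CliffordAlgebra.ι (0 : QuadraticForm ℝ (Fin n → ℝ)) m * y) =
        c • (CliffordAlgebra.ι (0 : QuadraticForm ℝ (Fin n → ℝ)) m * extScale n c y) := by
      intro y
      rw [map_mul]
      have := extScale_ι c m
      rw [ExteriorAlgebra.ι] at this
      rw [this, smul_mul_assoc]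
    rw [h2, map_smul, CliffordAlgebra.contractLeft_ι_mul, hx, map_sub, h2, map_smul]
    simp only [mul_smul_comm]

theorem extToMat_apply (T : Module.End ℝ (Ext n)) (I J : Finset (Fin n)) :
    extToMat n T I J = (((Pi.basisFun ℝ (Fin n)).ExteriorAlgebra.repr
      (T ((Pi.basisFun ℝ (Fin n)).ExteriorAlgebra J)) I : ℝ) : ℂ) := by
  simp [extToMat, LinearMap.toMatrixAlgEquiv_apply, Algebra.ofId_apply]

/-- Seeing `U_λ` as the matrix of an algebra morphism of the exterior algebra lets its conjugation
action be computed on wedge and contraction without bases. -/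
theorem extToMat_extScale (lam : ℝ) :
    extToMat n (extScale n lam⁻¹).toLinearMap = getzlerU n lam := by
  ext I J
  rw [extToMat_apply, getzlerU, Matrix.diagonal_apply, AlgHom.toLinearMap_apply, extScale_basis]
  by_cases h : I = J
  · subst h
    simp
  · simp [h]

theorem getzlerU_mul_inv {lam : ℝ} (h : lam ≠ 0) : getzlerU n lam * getzlerU n lam⁻¹ = 1 := by
  have h' : (lam : ℂ) ≠ 0 := by exact_mod_cast h
  simp [getzlerU, Matrix.diagonal_mul_diagonal, h']

theorem getzlerConj_eq_of_mul {lam : ℝ} (h : lam ≠ 0) {Q Q' : ExtMat n}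
    (hQ : getzlerU n lam * Q = Q' * getzlerU n lam) : getzlerConj lam Q = Q' := by
  rw [getzlerConj, hQ, mul_assoc, getzlerU_mul_inv h, mul_one]

/-- Exterior multiplication raises the degree by one and so picks up λ⁻¹ under conjugation by `U_λ`;
interior multiplication lowers the degree and picks up λ. -/
theorem getzlerConj_extMul {lam : ℝ} (h : lam ≠ 0) (v : Fin n → ℝ) :
    getzlerConj lam (extToMat n (extMul v)) = lam⁻¹ • extToMat n (extMul v) := by
  apply getzlerConj_eq_of_mul h
  rw [← extToMat_extScale, ← map_smul, ← map_mul, ← map_mul]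
  congr 1
  refine LinearMap.ext fun x => ?_
  simp [extMul, extScale_ι]

theorem getzlerConj_extContr {lam : ℝ} (h : lam ≠ 0) (v : Fin n → ℝ) :
    getzlerConj lam (extToMat n (extContr v)) = lam • extToMat n (extContr v) := by
  apply getzlerConj_eq_of_mul h
  rw [← extToMat_extScale, ← map_smul, ← map_mul, ← map_mul]
  congr 1
  refine LinearMap.ext fun x => ?_
  simp only [extContr, Module.End.mul_apply, AlgHom.toLinearMap_apply, LinearMap.smul_apply]
  rw [contractLeft_extScale, smul_smul, mul_inv_cancel₀ h, one_smul]

theorem getzlerConj_mul {lam : ℝ} (h : lam ≠ 0) (Q Q' : ExtMat n) :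
    getzlerConj lam (Q * Q') = getzlerConj lam Q * getzlerConj lam Q' := by
  have h2 : getzlerU n lam⁻¹ * getzlerU n lam = 1 := by
    simpa using getzlerU_mul_inv (n := n) (inv_ne_zero h)
  simp only [getzlerConj]
  calc _ = getzlerU n lam * Q * 1 * Q' * getzlerU n lam⁻¹ := by simp [mul_assoc]
    _ = _ := by rw [← h2]; simp only [mul_assoc]

theorem getzlerConj_one {lam : ℝ} (h : lam ≠ 0) : getzlerConj lam (1 : ExtMat n) = 1 := by
  rw [getzlerConj, mul_one, getzlerU_mul_inv h]

theorem getzlerConj_add (lam : ℝ) (Q Q' : ExtMat n) :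
    getzlerConj lam (Q + Q') = getzlerConj lam Q + getzlerConj lam Q' := by
  simp only [getzlerConj, mul_add, add_mul]

theorem getzlerConj_smul (lam : ℝ) (c : ℂ) (Q : ExtMat n) :
    getzlerConj lam (c • Q) = c • getzlerConj lam Q := by
  simp only [getzlerConj, Matrix.mul_smul, Matrix.smul_mul]

/-- The conjugation `Q ↦ U_λ Q U_λ⁻¹` as a linear map. -/
def getzlerConjLin (n : ℕ) (lam : ℝ) : ExtMat n →ₗ[ℂ] ExtMat n where
  toFun := getzlerConj lam
  map_add' := getzlerConj_add lam
  map_smul' := getzlerConj_smul lam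

/-- The matrix `eˢ ∧ • - λ² e_s ⌟ •`, which is `λ` times the rescaled Clifford multiplication by
`eˢ`. -/
def rescaledClifford (s : Fin n) (lam : ℝ) : ExtMat n :=
  wedge s - ((lam : ℂ) ^ 2) • extToMat n (extContr (Pi.single s 1))

@[simp] theorem rescaledClifford_zero (s : Fin n) : rescaledClifford s 0 = wedge s := by
  simp [rescaledClifford]

theorem cliffordMapC_clGen (s : Fin n) :
    cliffordMapC n ((1 : ℂ) ⊗ₜ[ℝ] clGen s) =
      wedge s - extToMat n (extContr (Pi.single s 1)) := by
  simp [cliffordMapC, clGen, clVec, cliffordMap, cliffordEnd, wedge]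

/-- The whole singularity of the rescaled generator is the factor λ⁻¹. The remaining matrix is
polynomial in λ, hence continuous up to λ = 0, where only the wedge survives. -/
theorem getzlerConj_cliffordMapC_clGen {lam : ℝ} (h : lam ≠ 0) (s : Fin n) :
    getzlerConj lam (cliffordMapC n ((1 : ℂ) ⊗ₜ[ℝ] clGen s)) =
      (lam : ℂ)⁻¹ • rescaledClifford s lam := by
  have h' : (lam : ℂ) ≠ 0 := by exact_mod_cast h
  have hsub : ∀ Q Q' : ExtMat n, getzlerConj lam (Q - Q') = getzlerConj lam Q - getzlerConj lam Q' :=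
    map_sub (getzlerConjLin n lam)
  rw [cliffordMapC_clGen, hsub, wedge, getzlerConj_extMul h, getzlerConj_extContr h,
    rescaledClifford, smul_sub, smul_smul, wedge]
  have e : (lam : ℂ)⁻¹ * (lam : ℂ) ^ 2 = lam := by field_simp
  rw [e]
  ext I J
  simp

/-- The Clifford generators of the spinor module, transported to the exterior algebra and
rescaled. -/
theorem getzlerConj_act_mul {N : ℕ} (κ : SpinorModule n N) {lam : ℝ} (h : lam ≠ 0) (s t : Fin n) :
    getzlerConj lam (cliffordMapC n (κ.symm (κ.act (clGen s) * κ.act (clGen t)))) =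
      ((lam : ℂ) ^ 2)⁻¹ • (rescaledClifford s lam * rescaledClifford t lam) := by
  simp only [SpinorModule.act, map_mul, AlgEquiv.symm_apply_apply]
  rw [getzlerConj_mul h, getzlerConj_cliffordMapC_clGen h, getzlerConj_cliffordMapC_clGen h,
    Matrix.smul_mul, Matrix.mul_smul, smul_smul]
  congr 1
  field_simp

end Rescaling


/-! ### Algebraic identities for Clifford generators -/

section CliffordAlgebraic

variable {n : ℕ} {𝒜 : Type*} [Ring 𝒜]

theorem sum_sum_sum_swap {A : Type*} [AddCommMonoid A] (f : Fin n → Fin n → Fin n → A) :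
    ∑ i, ∑ j, ∑ k, f i j k = ∑ i, ∑ j, ∑ k, f k j i := by
  rw [Finset.sum_comm]
  conv_rhs => rw [Finset.sum_comm]
  exact Finset.sum_congr rfl fun j _ => Finset.sum_comm

theorem sum_sum_sum_cycle {A : Type*} [AddCommMonoid A] (f : Fin n → Fin n → Fin n → A) :
    ∑ i, ∑ j, ∑ k, f i j k = ∑ i, ∑ j, ∑ k, f j k i := by
  symm
  rw [Finset.sum_comm]
  exact Finset.sum_congr rfl fun j _ => Finset.sum_comm

/-- The elements `κ_1, …, κ_n` satisfy the Clifford relations `κ_i κ_j + κ_j κ_i = -2 δ_ij`. -/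
def IsCliffordFamily (κ : Fin n → 𝒜) : Prop :=
  ∀ i j, κ i * κ j + κ j * κ i = if i = j then -2 else 0

variable [Algebra ℝ 𝒜]

/-- The element `(1/4) ∑ w_st κ_s κ_t`. -/
def spinLift (κ : Fin n → 𝒜) (w : Fin n → Fin n → ℝ) : 𝒜 :=
  (1 / 4 : ℝ) • ∑ s, ∑ t, w s t • (κ s * κ t)

theorem IsCliffordFamily.mul_mul_sub {κ : Fin n → 𝒜} (h : IsCliffordFamily κ) (s t j : Fin n) :
    κ s * κ t * κ j - κ j * (κ s * κ t) =
      (if s = j then (2 : ℝ) else 0) • κ t - (if t = j then (2 : ℝ) else 0) • κ s := by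
  have h1 : κ s * κ t * κ j - κ j * (κ s * κ t) =
      κ s * (κ t * κ j + κ j * κ t) - (κ s * κ j + κ j * κ s) * κ t := by noncomm_ring
  rw [h1, h, h]
  split_ifs <;> simp [two_smul] <;> noncomm_ring

/-- The infinitesimal form of the covering Spin → SO: the commutator with the spin lift of w acts on
vectors as w. The commutator of κ_s κ_t with κ_j consists of two contractions with factors ±2, which
antisymmetry of w makes equal in the sum; hence the normalisation 1/4. -/
theorem spinLift_commutator {κ : Fin n → 𝒜} (h : IsCliffordFamily κ) {w : Fin n → Fin n → ℝ}
    (hw : ∀ s t, w s t = -w t s) (j : Fin n) :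
    spinLift κ w * κ j - κ j * spinLift κ w = ∑ t, w j t • κ t := by
  have h1 : spinLift κ w * κ j - κ j * spinLift κ w =
      (1 / 4 : ℝ) • ∑ s, ∑ t, w s t • (κ s * κ t * κ j - κ j * (κ s * κ t)) := by
    simp only [spinLift, smul_mul_assoc, mul_smul_comm, Finset.sum_mul, Finset.mul_sum, ← smul_sub,
      ← Finset.sum_sub_distrib]
  have h2 : ∑ s, ∑ t, w s t • (κ s * κ t * κ j - κ j * (κ s * κ t)) =
      (∑ t, (2 * w j t) • κ t) - ∑ s, (2 * w s j) • κ s := by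
    simp only [h.mul_mul_sub, smul_sub, Finset.sum_sub_distrib, ite_smul, zero_smul]
    congr 1
    · rw [Finset.sum_comm]
      simp [smul_smul, mul_comm]
    · simp [smul_smul, mul_comm]
  have h3 : ∑ s, (2 * w s j) • κ s = -∑ s, (2 * w j s) • κ s := by
    rw [← Finset.sum_neg_distrib]
    refine Finset.sum_congr rfl fun s _ => ?_
    rw [hw s j, ← neg_smul]; congr 1; ring
  rw [h1, h2, h3, sub_neg_eq_add, ← Finset.sum_add_distrib, Finset.smul_sum]
  refine Finset.sum_congr rfl fun t _ => ?_
  module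

theorem spinLift_commutator_mul {κ : Fin n → 𝒜} (h : IsCliffordFamily κ) {w : Fin n → Fin n → ℝ}
    (hw : ∀ s t, w s t = -w t s) (s t : Fin n) :
    spinLift κ w * (κ s * κ t) - (κ s * κ t) * spinLift κ w =
      (∑ u, w s u • (κ u * κ t)) + ∑ u, w t u • (κ s * κ u) := by
  have h1 : spinLift κ w * (κ s * κ t) - (κ s * κ t) * spinLift κ w =
      (spinLift κ w * κ s - κ s * spinLift κ w) * κ t +
        κ s * (spinLift κ w * κ t - κ t * spinLift κ w) := by noncomm_ring
  rw [h1, spinLift_commutator h hw, spinLift_commutator h hw]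
  simp only [Finset.sum_mul, Finset.mul_sum, smul_mul_assoc, mul_smul_comm]

/-- The commutator with the spin lift of w is a derivation, so it acts on each factor of κ_s κ_t
through w. The sign is opposite to that of the matrix bracket of w and w' because w acts on the
generators through its rows. Only w has to be antisymmetric. -/
theorem spinLift_commutator_spinLift {κ : Fin n → 𝒜} (h : IsCliffordFamily κ)
    {w w' : Fin n → Fin n → ℝ} (hw : ∀ s t, w s t = -w t s) :
    spinLift κ w * spinLift κ w' - spinLift κ w' * spinLift κ w =
      spinLift κ fun s t => ∑ u, (w' s u * w u t - w s u * w' u t) := by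
  have h1 : spinLift κ w * spinLift κ w' - spinLift κ w' * spinLift κ w =
      (1 / 4 : ℝ) • ∑ s, ∑ t, w' s t •
        (spinLift κ w * (κ s * κ t) - (κ s * κ t) * spinLift κ w) := by
    rw [show spinLift κ w' = (1 / 4 : ℝ) • ∑ s, ∑ t, w' s t • (κ s * κ t) from rfl]
    simp only [smul_mul_assoc, mul_smul_comm, Finset.sum_mul, Finset.mul_sum, ← smul_sub,
      ← Finset.sum_sub_distrib]
  have h2 : ∑ s, ∑ t, ∑ u, w' s t • w s u • (κ u * κ t) =
      ∑ s, ∑ t, ∑ u, (-(w s u * w' u t)) • (κ s * κ t) := by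
    rw [sum_sum_sum_swap]
    refine Finset.sum_congr rfl fun s _ => Finset.sum_congr rfl fun t _ =>
      Finset.sum_congr rfl fun u _ => ?_
    rw [hw u s, smul_smul]; congr 1; ring
  have h3 : ∑ s, ∑ t, ∑ u, w' s t • w t u • (κ s * κ u) =
      ∑ s, ∑ t, ∑ u, (w' s u * w u t) • (κ s * κ t) := by
    refine Finset.sum_congr rfl fun s _ => ?_
    rw [Finset.sum_comm]
    simp only [smul_smul]
  rw [h1]
  change _ = (1 / 4 : ℝ) • ∑ s, ∑ t, (∑ u, (w' s u * w u t - w s u * w' u t)) • (κ s * κ t)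
  congr 1
  simp only [spinLift_commutator_mul h hw, smul_add, Finset.sum_add_distrib, Finset.smul_sum]
  rw [h2, h3]
  simp only [Finset.sum_smul, ← Finset.sum_add_distrib]
  refine Finset.sum_congr rfl fun s _ => Finset.sum_congr rfl fun t _ =>
    Finset.sum_congr rfl fun u _ => ?_
  module

theorem sum_symm_clifford {κ : Fin n → 𝒜} (h : IsCliffordFamily κ) {q : Fin n → Fin n → ℝ}
    (hq : ∀ i j, q i j = q j i) : ∑ i, ∑ j, q i j • (κ i * κ j) = -algebraMap ℝ 𝒜 (∑ i, q i i) := by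
  have h1 : (2 : ℝ) • ∑ i, ∑ j, q i j • (κ i * κ j) =
      ∑ i, ∑ j, q i j • (κ i * κ j + κ j * κ i) := by
    rw [two_smul]
    nth_rewrite 2 [Finset.sum_comm]
    simp only [smul_add, Finset.sum_add_distrib]
    congr 1
    exact Finset.sum_congr rfl fun i _ => Finset.sum_congr rfl fun j _ => by rw [hq]
  have h2 : ∑ i, ∑ j, q i j • (κ i * κ j + κ j * κ i) =
      (2 : ℝ) • -algebraMap ℝ 𝒜 (∑ i, q i i) := by
    simp only [h _ _, smul_ite, smul_zero, Finset.sum_ite_eq, Finset.mem_univ, if_true]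
    rw [map_sum, ← Finset.sum_neg_distrib, Finset.smul_sum]
    refine Finset.sum_congr rfl fun i _ => ?_
    rw [Algebra.algebraMap_eq_smul_one, ← smul_neg, smul_comm]
    congr 1
    rw [two_smul]; norm_num
  exact smul_right_injective 𝒜 (two_ne_zero (α := ℝ)) (h1.trans h2)

/-- The contraction of an algebraic curvature tensor with Clifford generators is scalar. -/
theorem curvature_clifford_contraction {κ : Fin n → 𝒜} (h : IsCliffordFamily κ)
    {R : Fin n → Fin n → Fin n → Fin n → ℝ} (h₁ : ∀ i j s t, R i j s t = -R j i s t)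
    (h₂ : ∀ i j s t, R i j s t = -R i j t s)
    (hB : ∀ i j s t, R i j s t + R j s i t + R s i j t = 0) :
    ∑ i, ∑ j, ∑ s, ∑ t, R i j s t • (κ i * κ j * (κ s * κ t)) =
      algebraMap ℝ 𝒜 (-2 * ∑ i, ∑ j, R i j i j) := by
  -- The classical argument for pair symmetry: four instances of the Bianchi identity are combined
  -- by means of the two antisymmetries.
  have hpair : ∀ i j s t, R i j s t = R s t i j := fun i j s t => by
    linarith [hB i j s t, hB j s t i, hB s t i j, hB t i j s, h₁ i j s t, h₁ i j t s, h₁ j s i t,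
      h₁ j s t i, h₁ s i j t, h₁ s i t j, h₁ s t i j, h₁ s t j i, h₁ t i j s, h₁ t i s j,
      h₁ t j i s, h₁ i t j s, h₁ i t s j, h₁ j t i s, h₁ j t s i, h₂ i j s t, h₂ j s i t, h₂ s i j t,
      h₂ s t i j, h₂ t i j s, h₂ j t i s, h₂ j i s t, h₂ s j i t, h₂ i s j t, h₂ t s i j, h₂ i t j s,
      h₂ t j i s]
  -- Contracting three indices leaves twice the Ricci contraction. The cubic sum is averaged over
  -- its three cyclic rotations; reordering each product to κ_i κ_j κ_s costs contractions, the
  -- Bianchi identity kills the cubic part, and the contractions add up to 2 + 2 + 0 + 2 = 3 · 2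
  -- Ricci terms.
  have hcyc : ∀ t, ∑ i, ∑ j, ∑ s, R i j s t • (κ i * κ j * κ s) =
      (2 : ℝ) • ∑ k, (∑ i, R i k i t) • κ k := by
    intro t
    have e1 := sum_sum_sum_cycle fun i j s => R i j s t • (κ i * κ j * κ s)
    have e2 := e1.trans (sum_sum_sum_cycle _)
    have m1 : ∀ i j s, κ j * κ s * κ i = κ i * κ j * κ s + (if j = i then (2 : ℝ) else 0) • κ s -
        (if s = i then (2 : ℝ) else 0) • κ j := fun i j s => by
      have := h.mul_mul_sub j s i
      rw [sub_eq_iff_eq_add] at this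
      rw [this]; noncomm_ring
    have m2 : ∀ i j s, κ s * κ i * κ j = κ i * κ j * κ s - (if i = s then (2 : ℝ) else 0) • κ j +
        (if j = s then (2 : ℝ) else 0) • κ i := fun i j s => by
      have := h.mul_mul_sub i j s
      rw [sub_eq_iff_eq_add] at this
      rw [this]; noncomm_ring
    have key : (3 : ℝ) • ∑ i, ∑ j, ∑ s, R i j s t • (κ i * κ j * κ s) =
        (3 : ℝ) • ((2 : ℝ) • ∑ k, (∑ i, R i k i t) • κ k) := by
      calc _ = (∑ i, ∑ j, ∑ s, R i j s t • (κ i * κ j * κ s)) +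
            (∑ i, ∑ j, ∑ s, R j s i t • (κ j * κ s * κ i)) +
            ∑ i, ∑ j, ∑ s, R s i j t • (κ s * κ i * κ j) := by
            rw [← e1, ← e2]; module
        _ = (∑ i, ∑ j, ∑ s, (R i j s t + R j s i t + R s i j t) • (κ i * κ j * κ s)) +
            (∑ i, ∑ j, ∑ s, (R j s i t * (if j = i then 2 else 0)) • κ s) -
            (∑ i, ∑ j, ∑ s, (R j s i t * (if s = i then 2 else 0)) • κ j) -
            (∑ i, ∑ j, ∑ s, (R s i j t * (if i = s then 2 else 0)) • κ j) +
            (∑ i, ∑ j, ∑ s, (R s i j t * (if j = s then 2 else 0)) • κ i) := by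
            simp only [← Finset.sum_add_distrib, ← Finset.sum_sub_distrib]
            refine Finset.sum_congr rfl fun i _ => Finset.sum_congr rfl fun j _ =>
              Finset.sum_congr rfl fun s _ => ?_
            rw [m1 i j s, m2 i j s]
            module
        _ = _ := by
            have f1 : ∑ i, ∑ j, ∑ s, (R j s i t * (if j = i then 2 else 0)) • κ s =
                (2 : ℝ) • ∑ k, (∑ i, R i k i t) • κ k := by
              conv_lhs => enter [2, i]; rw [Finset.sum_comm]
              rw [Finset.sum_comm]
              simp only [mul_ite, mul_zero, ite_smul, zero_smul, Finset.sum_ite_eq',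
                Finset.mem_univ, if_true, Finset.sum_smul, Finset.smul_sum, smul_smul, mul_comm]
            have f2 : ∑ i, ∑ j, ∑ s, (R j s i t * (if s = i then 2 else 0)) • κ j =
                -((2 : ℝ) • ∑ k, (∑ i, R i k i t) • κ k) := by
              simp only [mul_ite, mul_zero, ite_smul, zero_smul, Finset.sum_ite_eq',
                Finset.mem_univ, if_true, Finset.sum_smul, Finset.smul_sum, smul_smul,
                ← Finset.sum_neg_distrib]
              rw [Finset.sum_comm]
              refine Finset.sum_congr rfl fun j _ => Finset.sum_congr rfl fun i _ => ?_
              rw [h₁ j i]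
              module
            have f3 : ∑ i, ∑ j, ∑ s, (R s i j t * (if i = s then 2 else 0)) • κ j = 0 := by
              refine Finset.sum_eq_zero fun i _ => Finset.sum_eq_zero fun j _ =>
                Finset.sum_eq_zero fun s _ => ?_
              split_ifs with his
              · subst his
                have : R i i j t = 0 := by linarith [h₁ i i j t]
                simp [this]
              · simp
            have f4 : ∑ i, ∑ j, ∑ s, (R s i j t * (if j = s then 2 else 0)) • κ i =
                (2 : ℝ) • ∑ k, (∑ i, R i k i t) • κ k := by
              simp only [mul_ite, mul_zero, ite_smul, zero_smul, Finset.sum_ite_eq,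
                Finset.mem_univ, if_true, Finset.sum_smul, Finset.smul_sum, smul_smul, mul_comm]
            simp only [hB, zero_smul, Finset.sum_const_zero, zero_add, f1, f2, f3, f4]
            module
    exact smul_right_injective 𝒜 (three_ne_zero (α := ℝ)) key
  -- The Ricci contraction is symmetric, so against κ_k κ_t only its trace survives, with a minus
  -- sign from κ_k² = -1.
  have hq : ∀ k t, ∑ i, R i k i t = ∑ i, R i t i k := fun k t =>
    Finset.sum_congr rfl fun i _ => hpair _ _ _ _
  calc ∑ i, ∑ j, ∑ s, ∑ t, R i j s t • (κ i * κ j * (κ s * κ t))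
      = ∑ t, (∑ i, ∑ j, ∑ s, R i j s t • (κ i * κ j * κ s)) * κ t := by
        simp only [Finset.sum_mul, smul_mul_assoc, mul_assoc]
        conv_rhs => rw [Finset.sum_comm]; enter [2, i]; rw [Finset.sum_comm]; enter [2, j]
                    rw [Finset.sum_comm]
    _ = (2 : ℝ) • ∑ k, ∑ t, (∑ i, R i k i t) • (κ k * κ t) := by
        simp only [hcyc, smul_mul_assoc, ← Finset.smul_sum, Finset.sum_mul]
        rw [Finset.sum_comm]
    _ = _ := by
        rw [sum_symm_clifford h hq, Algebra.algebraMap_eq_smul_one, Algebra.algebraMap_eq_smul_one,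
          Finset.sum_comm]
        module

end CliffordAlgebraic


/-! ### Frames and connection coefficients on an open subset of `ℝⁿ` -/

section LocalFrame

variable {n : ℕ} {F G : Type*} [NormedAddCommGroup F] [NormedSpace ℝ F]
  [NormedAddCommGroup G] [NormedSpace ℝ G] {V : Set (E n)}

/-- The derivative `∑_j b_i^j ∂_j` along the `i`-th vector field of a frame. -/
def frameDeriv (b : Fin n → Fin n → E n → ℝ) (i : Fin n) (f : E n → F) : E n → F :=
  fun x => ∑ j, b i j x • pd j f x

/-- A frame `b_i = ∑_j b_i^j ∂_j` on `V`, and functions `θ_ist` which are the coefficients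
`g(∇_{b_i} b_s, b_t)` of the Levi-Civita connection for the metric making the frame orthonormal. -/
structure IsLeviCivitaFrame (V : Set (E n)) (b : Fin n → Fin n → E n → ℝ)
    (θ : Fin n → Fin n → Fin n → E n → ℝ) : Prop where
  isOpen : IsOpen V
  smooth_frame : ∀ i j, ContDiffOn ℝ ∞ (b i j) V
  smooth_coeff : ∀ i s t, ContDiffOn ℝ ∞ (θ i s t) V
  isUnit : ∀ x ∈ V, IsUnit (Matrix.of fun i j => b i j x)
  antisymm : ∀ i s t, ∀ x ∈ V, θ i s t x = -θ i t s x
  torsion_free : ∀ i s k, ∀ x ∈ V,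
    frameDeriv b i (b s k) x - frameDeriv b s (b i k) x =
      ∑ t, (θ i s t x - θ s i t x) * b t k x

/-- The curvature coefficients `g(R(b_i, b_j) b_s, b_t)`. -/
def frameCurvature (b : Fin n → Fin n → E n → ℝ) (θ : Fin n → Fin n → Fin n → E n → ℝ)
    (i j s t : Fin n) (x : E n) : ℝ :=
  frameDeriv b i (θ j s t) x - frameDeriv b j (θ i s t) x +
    (∑ u, (θ j s u x * θ i u t x - θ i s u x * θ j u t x)) -
    ∑ u, (θ i j u x - θ j i u x) * θ u s t x

/-! ### Leibniz calculus of the derivatives along a frame -/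

section FrameDeriv

variable {b : Fin n → Fin n → E n → ℝ}

theorem contDiffOn_frameDeriv (hV : IsOpen V) (hb : ∀ i j, ContDiffOn ℝ ∞ (b i j) V) {f : E n → F}
    (hf : ContDiffOn ℝ ∞ f V) (i : Fin n) : ContDiffOn ℝ ∞ (frameDeriv b i f) V :=
  ContDiffOn.sum fun j _ => (hb i j).smul (contDiffOn_pd hV hf j)

theorem frameDeriv_eqOn (hV : IsOpen V) {f g : E n → F} (h : EqOn f g V) (i : Fin n) :
    EqOn (frameDeriv b i f) (frameDeriv b i g) V := fun x hx => by
  simp only [frameDeriv, pd_eqOn hV h _ hx]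

theorem frameDeriv_add {f g : E n → F} {x : E n} (hf : DifferentiableAt ℝ f x)
    (hg : DifferentiableAt ℝ g x) (i : Fin n) :
    frameDeriv b i (fun y => f y + g y) x = frameDeriv b i f x + frameDeriv b i g x := by
  simp only [frameDeriv, pd_add hf hg, smul_add, Finset.sum_add_distrib]

theorem frameDeriv_sub {f g : E n → F} {x : E n} (hf : DifferentiableAt ℝ f x)
    (hg : DifferentiableAt ℝ g x) (i : Fin n) :
    frameDeriv b i (fun y => f y - g y) x = frameDeriv b i f x - frameDeriv b i g x := by
  simp only [frameDeriv, pd_sub hf hg, smul_sub, Finset.sum_sub_distrib]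

theorem frameDeriv_sum {ι : Type*} {s : Finset ι} {f : ι → E n → F} {x : E n}
    (hf : ∀ k ∈ s, DifferentiableAt ℝ (f k) x) (i : Fin n) :
    frameDeriv b i (fun y => ∑ k ∈ s, f k y) x = ∑ k ∈ s, frameDeriv b i (f k) x := by
  simp only [frameDeriv, pd_sum hf, Finset.smul_sum]
  exact Finset.sum_comm

theorem frameDeriv_smul {g : E n → ℝ} {f : E n → F} {x : E n} (hg : DifferentiableAt ℝ g x)
    (hf : DifferentiableAt ℝ f x) (i : Fin n) :
    frameDeriv b i (fun y => g y • f y) x =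
      g x • frameDeriv b i f x + frameDeriv b i g x • f x := by
  simp only [frameDeriv, pd_smul hg hf, smul_add, Finset.sum_add_distrib, Finset.smul_sum,
    Finset.sum_smul, smul_smul, smul_eq_mul, mul_comm]

theorem frameDeriv_const_smul (c : ℝ) (f : E n → F) (i : Fin n) (x : E n) :
    frameDeriv b i (fun y => c • f y) x = c • frameDeriv b i f x := by
  simp only [frameDeriv, pd_const_smul, Finset.smul_sum, smul_comm c]

theorem frameDeriv_clm (L : F →L[ℝ] G) {f : E n → F} {x : E n} (hf : DifferentiableAt ℝ f x)
    (i : Fin n) : frameDeriv b i (fun y => L (f y)) x = L (frameDeriv b i f x) := by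
  simp only [frameDeriv, pd_clm L hf, map_sum, map_smul]

theorem frameDeriv_coord (i k : Fin n) (x : E n) : frameDeriv b i (fun y => y k) x = b i k x := by
  simp [frameDeriv, pd_coord]

end FrameDeriv

/-! ### Structure functions of a Levi-Civita frame and symmetries of its curvature -/

namespace IsLeviCivitaFrame

variable {b : Fin n → Fin n → E n → ℝ} {θ : Fin n → Fin n → Fin n → E n → ℝ}

theorem contDiffOn_frameDeriv (h : IsLeviCivitaFrame V b θ) {f : E n → F}
    (hf : ContDiffOn ℝ ∞ f V) (i : Fin n) : ContDiffOn ℝ ∞ (frameDeriv b i f) V :=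
  Getzler.contDiffOn_frameDeriv h.isOpen h.smooth_frame hf i

theorem contDiffOn_frameCurvature (h : IsLeviCivitaFrame V b θ) (i j s t : Fin n) :
    ContDiffOn ℝ ∞ (frameCurvature b θ i j s t) V := by
  have hθ := h.smooth_coeff
  refine (((h.contDiffOn_frameDeriv (hθ j s t) i).sub (h.contDiffOn_frameDeriv (hθ i s t) j)).add
    (ContDiffOn.sum fun u _ => ((hθ j s u).mul (hθ i u t)).sub ((hθ i s u).mul (hθ j u t)))).sub
    (ContDiffOn.sum fun u _ => ((hθ i j u).sub (hθ j i u)).mul (hθ u s t))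

theorem frameDeriv_frameDeriv (h : IsLeviCivitaFrame V b θ) {f : E n → F}
    (hf : ContDiffOn ℝ ∞ f V) (i j : Fin n) {x : E n} (hx : x ∈ V) :
    frameDeriv b i (frameDeriv b j f) x =
      (∑ k, ∑ l, (b i k x * b j l x) • pd k (pd l f) x) +
        ∑ l, frameDeriv b i (b j l) x • pd l f x := by
  have hd : ∀ l ∈ Finset.univ, DifferentiableAt ℝ (fun y => b j l y • pd l f y) x := fun l _ =>
    differentiableAt_of_contDiffOn h.isOpen
      ((h.smooth_frame j l).smul (contDiffOn_pd h.isOpen hf l)) hx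
  change frameDeriv b i (fun y => ∑ l, b j l y • pd l f y) x = _
  rw [frameDeriv_sum hd]
  have hs : ∀ l, frameDeriv b i (fun y => b j l y • pd l f y) x =
      b j l x • frameDeriv b i (pd l f) x + frameDeriv b i (b j l) x • pd l f x := fun l =>
    frameDeriv_smul (differentiableAt_of_contDiffOn h.isOpen (h.smooth_frame j l) hx)
      (differentiableAt_of_contDiffOn h.isOpen (contDiffOn_pd h.isOpen hf l) hx) i
  simp only [hs, Finset.sum_add_distrib]
  congr 1
  rw [Finset.sum_comm]
  refine Finset.sum_congr rfl fun l _ => ?_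
  simp only [frameDeriv, Finset.smul_sum, smul_smul, mul_comm]

/-- `[b_i, b_j] = ∑_k (θ_ijk - θ_jik) b_k`. -/
theorem frameDeriv_commutator (h : IsLeviCivitaFrame V b θ) {f : E n → F}
    (hf : ContDiffOn ℝ ∞ f V) (i j : Fin n) {x : E n} (hx : x ∈ V) :
    frameDeriv b i (frameDeriv b j f) x - frameDeriv b j (frameDeriv b i f) x =
      ∑ k, (θ i j k x - θ j i k x) • frameDeriv b k f x := by
  rw [h.frameDeriv_frameDeriv hf i j hx, h.frameDeriv_frameDeriv hf j i hx]
  have e1 : ∑ k, ∑ l, (b j k x * b i l x) • pd k (pd l f) x =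
      ∑ k, ∑ l, (b i k x * b j l x) • pd k (pd l f) x := by
    rw [Finset.sum_comm]
    refine Finset.sum_congr rfl fun k _ => Finset.sum_congr rfl fun l _ => ?_
    rw [pd_comm h.isOpen hf l k hx, mul_comm]
  have e2 : ∀ l, frameDeriv b i (b j l) x • pd l f x - frameDeriv b j (b i l) x • pd l f x =
      ∑ k, (θ i j k x - θ j i k x) • b k l x • pd l f x := fun l => by
    rw [← sub_smul, h.torsion_free i j l x hx, Finset.sum_smul]
    simp only [smul_smul]
  rw [e1, add_sub_add_left_eq_sub, ← Finset.sum_sub_distrib]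
  simp only [e2]
  rw [Finset.sum_comm]
  simp only [frameDeriv, Finset.smul_sum]

theorem frame_sum_eq_zero (h : IsLeviCivitaFrame V b θ) {x : E n} (hx : x ∈ V) {c : Fin n → ℝ}
    (hc : ∀ k, ∑ l, c l * b l k x = 0) (l : Fin n) : c l = 0 := by
  have h1 : c ᵥ* (Matrix.of fun i j => b i j x) = 0 := by
    ext k
    simpa [Matrix.vecMul, dotProduct] using hc k
  have h2 : c ᵥ* (Matrix.of fun i j => b i j x) = 0 ᵥ* (Matrix.of fun i j => b i j x) := by
    rw [h1, Matrix.zero_vecMul]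
  exact congrFun (Matrix.vecMul_injective_of_isUnit (h.isUnit x hx) h2) l

/-- The Jacobi identity for the structure functions `c_ijk = θ_ijk - θ_jik` of the frame. -/
theorem jacobi (h : IsLeviCivitaFrame V b θ) (i j k l : Fin n) {x : E n} (hx : x ∈ V) :
    let c := fun i j k y => θ i j k y - θ j i k y
    (frameDeriv b i (c j k l) x + ∑ m, c j k m x * c i m l x) +
      (frameDeriv b j (c k i l) x + ∑ m, c k i m x * c j m l x) +
      (frameDeriv b k (c i j l) x + ∑ m, c i j m x * c k m l x) = 0 := by
  intro c
  have hc : ∀ i j k, ContDiffOn ℝ ∞ (c i j k) V := fun i j k =>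
    (h.smooth_coeff i j k).sub (h.smooth_coeff j i k)
  have dA : ∀ {f : E n → ℝ}, ContDiffOn ℝ ∞ f V → DifferentiableAt ℝ f x := fun hf =>
    differentiableAt_of_contDiffOn h.isOpen hf hx
  -- The double bracket [b_i, [b_j, b_k]] applied to f is of first order; its components are the
  -- structure functions differentiated once or multiplied in pairs.
  have hT : ∀ (i j k : Fin n) (f : E n → ℝ), ContDiffOn ℝ ∞ f V →
      frameDeriv b i (fun y => frameDeriv b j (frameDeriv b k f) y -
          frameDeriv b k (frameDeriv b j f) y) x -
        (frameDeriv b j (frameDeriv b k (frameDeriv b i f)) x -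
          frameDeriv b k (frameDeriv b j (frameDeriv b i f)) x) =
        ∑ l, (frameDeriv b i (c j k l) x + ∑ m, c j k m x * c i m l x) * frameDeriv b l f x := by
    intro i j k f hf
    have e1 : EqOn (fun y => frameDeriv b j (frameDeriv b k f) y -
        frameDeriv b k (frameDeriv b j f) y) (fun y => ∑ m, c j k m y • frameDeriv b m f y) V :=
      fun y hy => h.frameDeriv_commutator hf j k hy
    have dS : ∀ m ∈ Finset.univ,
        DifferentiableAt ℝ (fun y => c j k m y • frameDeriv b m f y) x := fun m _ =>
      dA ((hc j k m).smul (h.contDiffOn_frameDeriv hf m))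
    have e5 : frameDeriv b j (frameDeriv b k (frameDeriv b i f)) x -
        frameDeriv b k (frameDeriv b j (frameDeriv b i f)) x =
          ∑ m, c j k m x • frameDeriv b m (frameDeriv b i f) x :=
      h.frameDeriv_commutator (h.contDiffOn_frameDeriv hf i) j k hx
    rw [frameDeriv_eqOn h.isOpen e1 i hx, frameDeriv_sum dS, e5]
    have e2 : ∀ m, frameDeriv b i (fun y => c j k m y • frameDeriv b m f y) x =
        c j k m x • frameDeriv b i (frameDeriv b m f) x +
          frameDeriv b i (c j k m) x • frameDeriv b m f x := fun m =>
      frameDeriv_smul (dA (hc j k m)) (dA (h.contDiffOn_frameDeriv hf m)) i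
    have e3 : ∀ m, frameDeriv b i (frameDeriv b m f) x = frameDeriv b m (frameDeriv b i f) x +
        ∑ l, c i m l x * frameDeriv b l f x := fun m => by
      have := h.frameDeriv_commutator hf i m hx
      simp only [smul_eq_mul] at this
      linarith
    rw [Finset.sum_congr rfl fun m _ => e2 m]
    simp only [e3, smul_eq_mul, mul_add, Finset.sum_add_distrib, add_mul, Finset.mul_sum,
      Finset.sum_mul]
    rw [Finset.sum_comm (f := fun m l => c j k m x * (c i m l x * frameDeriv b l f x))]
    simp only [mul_assoc]
    ring
  -- The cyclic sum of the double brackets cancels identically. Testing it on the coordinate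
  -- functions gives the components in ∂_q, from which invertibility of the frame recovers the
  -- components in b_l.
  have key : ∀ q, ∑ l, ((frameDeriv b i (c j k l) x + ∑ m, c j k m x * c i m l x) +
      (frameDeriv b j (c k i l) x + ∑ m, c k i m x * c j m l x) +
      (frameDeriv b k (c i j l) x + ∑ m, c i j m x * c k m l x)) * b l q x = 0 := by
    intro q
    have hq : ContDiffOn ℝ ∞ (fun y : E n => y q) V :=
      (EuclideanSpace.proj q : E n →L[ℝ] ℝ).contDiff.contDiffOn
    have d2 : ∀ j k, DifferentiableAt ℝ (frameDeriv b j (frameDeriv b k fun y => y q)) x :=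
      fun j k => dA (h.contDiffOn_frameDeriv (h.contDiffOn_frameDeriv hq k) j)
    have t1 := hT i j k _ hq
    have t2 := hT j k i _ hq
    have t3 := hT k i j _ hq
    rw [frameDeriv_sub (d2 _ _) (d2 _ _)] at t1 t2 t3
    simp only [add_mul _ _ (b _ q x), Finset.sum_add_distrib]
    simp only [frameDeriv_coord, add_mul _ _ (b _ q x), Finset.sum_add_distrib] at t1 t2 t3
    rw [← t1, ← t2, ← t3]
    ring
  exact h.frame_sum_eq_zero hx key l

theorem frameCurvature_antisymm_left (i j s t : Fin n) (x : E n) :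
    frameCurvature b θ i j s t x = -frameCurvature b θ j i s t x := by
  simp only [frameCurvature, Finset.sum_sub_distrib, sub_mul]
  ring

/-- Metric compatibility is the antisymmetry of θ in its last two indices throughout V, so the
derivatives of θ inherit it. -/
theorem frameCurvature_antisymm_right (h : IsLeviCivitaFrame V b θ) (i j s t : Fin n) {x : E n}
    (hx : x ∈ V) : frameCurvature b θ i j s t x = -frameCurvature b θ i j t s x := by
  have hd : ∀ i j s t, frameDeriv b i (θ j s t) x = -frameDeriv b i (θ j t s) x := by
    intro i j s t
    have hz : EqOn (fun y => θ j s t y + θ j t s y) (fun _ => 0) V := fun y hy => by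
      simp [h.antisymm j s t y hy]
    have h1 := frameDeriv_eqOn (b := b) h.isOpen hz i hx
    rw [frameDeriv_add (differentiableAt_of_contDiffOn h.isOpen (h.smooth_coeff _ _ _) hx)
      (differentiableAt_of_contDiffOn h.isOpen (h.smooth_coeff _ _ _) hx)] at h1
    simp only [frameDeriv, pd_const, Pi.zero_apply, smul_zero, Finset.sum_const_zero] at h1 ⊢
    linarith
  have hs : ∑ u, (θ j s u x * θ i u t x - θ i s u x * θ j u t x) =
      -∑ u, (θ j t u x * θ i u s x - θ i t u x * θ j u s x) := by
    rw [← Finset.sum_neg_distrib]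
    refine Finset.sum_congr rfl fun u _ => ?_
    rw [h.antisymm j s u x hx, h.antisymm i u t x hx, h.antisymm i s u x hx, h.antisymm j u t x hx]
    ring
  have hs2 : ∑ u, (θ i j u x - θ j i u x) * θ u s t x =
      -∑ u, (θ i j u x - θ j i u x) * θ u t s x := by
    rw [← Finset.sum_neg_distrib]
    refine Finset.sum_congr rfl fun u _ => ?_
    rw [h.antisymm u s t x hx]
    ring
  simp only [frameCurvature]
  rw [hd i j s t, hd j i s t, hs, hs2]
  ring

/-- The first Bianchi identity. -/
theorem bianchi (h : IsLeviCivitaFrame V b θ) (i j s t : Fin n) {x : E n} (hx : x ∈ V) :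
    frameCurvature b θ i j s t x + frameCurvature b θ j s i t x + frameCurvature b θ s i j t x =
      0 := by
  -- Because the torsion vanishes, the structure functions are θ_ijk - θ_jik, and the Jacobi
  -- identity for them is the Bianchi identity once the terms quadratic in θ are regrouped.
  have hJ := h.jacobi i j s t hx
  have hd : ∀ j k l, DifferentiableAt ℝ (θ j k l) x := fun j k l =>
    differentiableAt_of_contDiffOn h.isOpen (h.smooth_coeff _ _ _) hx
  simp only [frameDeriv_sub (hd _ _ _) (hd _ _ _)] at hJ
  have hs : (∑ u, (θ j s u x * θ i u t x - θ i s u x * θ j u t x) -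
        ∑ u, (θ i j u x - θ j i u x) * θ u s t x) +
      (∑ u, (θ s i u x * θ j u t x - θ j i u x * θ s u t x) -
        ∑ u, (θ j s u x - θ s j u x) * θ u i t x) +
      (∑ u, (θ i j u x * θ s u t x - θ s j u x * θ i u t x) -
        ∑ u, (θ s i u x - θ i s u x) * θ u j t x) =
      (∑ m, (θ j s m x - θ s j m x) * (θ i m t x - θ m i t x)) +
      (∑ m, (θ s i m x - θ i s m x) * (θ j m t x - θ m j t x)) +
      ∑ m, (θ i j m x - θ j i m x) * (θ s m t x - θ m s t x) := by
    simp only [← Finset.sum_add_distrib, ← Finset.sum_sub_distrib]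
    refine Finset.sum_congr rfl fun u _ => ?_
    ring
  simp only [frameCurvature]
  linarith

end IsLeviCivitaFrame

end LocalFrame


/-! ### The Lichnerowicz formula -/

section Lichnerowicz

variable {n : ℕ} {F : Type*} [NormedAddCommGroup F] [NormedSpace ℝ F] {V : Set (E n)}
  {b : Fin n → Fin n → E n → ℝ} {θ : Fin n → Fin n → Fin n → E n → ℝ} {κ : Fin n → F →L[ℝ] F}

theorem spinLift_apply (κ : Fin n → F →L[ℝ] F) (w : Fin n → Fin n → ℝ) (v : F) :
    spinLift κ w v = (1 / 4 : ℝ) • ∑ s, ∑ t, w s t • κ s (κ t v) := by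
  simp [spinLift]

/-- The spinorial covariant derivative along the `i`-th frame vector, in a trivialisation of the
spinor bundle in which Clifford multiplication by the frame vectors is constant. -/
def spinConn (b : Fin n → Fin n → E n → ℝ) (θ : Fin n → Fin n → Fin n → E n → ℝ)
    (κ : Fin n → F →L[ℝ] F) (i : Fin n) (u : E n → F) : E n → F :=
  fun x => frameDeriv b i u x + spinLift κ (fun s t => θ i s t x) (u x)

/-- The Dirac operator in such a trivialisation. -/
def localDirac (b : Fin n → Fin n → E n → ℝ) (θ : Fin n → Fin n → Fin n → E n → ℝ)
    (κ : Fin n → F →L[ℝ] F) (u : E n → F) : E n → F :=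
  fun x => ∑ i, κ i (spinConn b θ κ i u x)

theorem contDiffOn_spinLift_apply {w : Fin n → Fin n → E n → ℝ} {u : E n → F}
    (hw : ∀ s t, ContDiffOn ℝ ∞ (w s t) V) (hu : ContDiffOn ℝ ∞ u V) :
    ContDiffOn ℝ ∞ (fun x => spinLift κ (fun s t => w s t x) (u x)) V := by
  simp only [spinLift_apply]
  exact contDiffOn_const.smul (ContDiffOn.sum fun s _ => ContDiffOn.sum fun t _ =>
    (hw s t).smul ((κ s).contDiff.comp_contDiffOn ((κ t).contDiff.comp_contDiffOn hu)))

theorem frameDeriv_spinLift_apply {w : Fin n → Fin n → E n → ℝ} {u : E n → F} {x : E n}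
    (hw : ∀ s t, DifferentiableAt ℝ (w s t) x) (hu : DifferentiableAt ℝ u x) (i : Fin n) :
    frameDeriv b i (fun y => spinLift κ (fun s t => w s t y) (u y)) x =
      spinLift κ (fun s t => frameDeriv b i (w s t) x) (u x) +
        spinLift κ (fun s t => w s t x) (frameDeriv b i u x) := by
  have h1 : ∀ s t, DifferentiableAt ℝ (fun y => κ s (κ t (u y))) x := fun s t =>
    (κ s).differentiableAt.comp x ((κ t).differentiableAt.comp x hu)
  have h2 : ∀ s t, DifferentiableAt ℝ (fun y => w s t y • κ s (κ t (u y))) x := fun s t =>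
    (hw s t).smul (h1 s t)
  have h3 : ∀ s, DifferentiableAt ℝ (fun y => ∑ t, w s t y • κ s (κ t (u y))) x := fun s =>
    DifferentiableAt.fun_sum fun t _ => h2 s t
  have h5 : ∀ s t, frameDeriv b i (fun y => κ s (κ t (u y))) x =
      κ s (κ t (frameDeriv b i u x)) := fun s t =>
    frameDeriv_clm ((κ s).comp (κ t)) hu i
  simp only [spinLift_apply]
  rw [frameDeriv_const_smul, frameDeriv_sum fun s _ => h3 s]
  simp only [frameDeriv_sum fun t _ => h2 _ t, frameDeriv_smul (hw _ _) (h1 _ _), h5,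
    Finset.sum_add_distrib]
  rw [← smul_add, add_comm]

theorem IsLeviCivitaFrame.contDiffOn_spinConn (h : IsLeviCivitaFrame V b θ) {u : E n → F}
    (hu : ContDiffOn ℝ ∞ u V) (i : Fin n) : ContDiffOn ℝ ∞ (spinConn b θ κ i u) V :=
  (h.contDiffOn_frameDeriv hu i).add (contDiffOn_spinLift_apply (h.smooth_coeff i) hu)

/-- Clifford multiplication is parallel: the extra term is Clifford multiplication by ∇_{b_i} b_j,
and it arises as the commutator of the spin lift with κ_j. -/
theorem spinConn_clifford (h : IsLeviCivitaFrame V b θ) (hκ : IsCliffordFamily κ) {u : E n → F}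
    {x : E n} (hx : x ∈ V) (hu : DifferentiableAt ℝ u x) (i j : Fin n) :
    spinConn b θ κ i (fun y => κ j (u y)) x =
      κ j (spinConn b θ κ i u x) + ∑ t, θ i j t x • κ t (u x) := by
  have h1 := congrArg (fun L : F →L[ℝ] F => L (u x))
    (spinLift_commutator hκ (w := fun s t => θ i s t x) (fun s t => h.antisymm i s t x hx) j)
  simp only [sub_apply, mul_apply_eq_comp,
    sum_apply, smul_apply] at h1
  rw [← h1, spinConn, frameDeriv_clm (κ j) hu]
  simp only [spinConn, map_add]
  abel

theorem spinConn_spinConn (h : IsLeviCivitaFrame V b θ) {u : E n → F}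
    (hu : ContDiffOn ℝ ∞ u V) {x : E n} (hx : x ∈ V) (i j : Fin n) :
    spinConn b θ κ i (spinConn b θ κ j u) x =
      frameDeriv b i (frameDeriv b j u) x +
        spinLift κ (fun s t => frameDeriv b i (θ j s t) x) (u x) +
        spinLift κ (fun s t => θ j s t x) (frameDeriv b i u x) +
        spinLift κ (fun s t => θ i s t x) (frameDeriv b j u x) +
        (spinLift κ (fun s t => θ i s t x) * spinLift κ (fun s t => θ j s t x)) (u x) := by
  have hd := differentiableAt_of_contDiffOn h.isOpen hu hx
  have hθ : ∀ i s t, DifferentiableAt ℝ (θ i s t) x := fun i s t =>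
    differentiableAt_of_contDiffOn h.isOpen (h.smooth_coeff i s t) hx
  rw [spinConn]
  change frameDeriv b i (fun y => frameDeriv b j u y + spinLift κ (fun s t => θ j s t y) (u y)) x
    + _ = _
  rw [frameDeriv_add
    (differentiableAt_of_contDiffOn h.isOpen (h.contDiffOn_frameDeriv hu j) hx)
    (differentiableAt_of_contDiffOn h.isOpen
      (contDiffOn_spinLift_apply (h.smooth_coeff j) hu) hx),
    frameDeriv_spinLift_apply (hθ j) hd, spinConn, map_add, mul_apply_eq_comp]
  abel

/-- The curvature of the spin connection is the spin lift of the Riemann curvature. The mixed terms,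
with one derivative of u, are symmetric in i and j and cancel; the bracket of two spin lifts
supplies the quadratic part, and the bracket of frame vectors supplies the remaining sum over k. -/
theorem spinConn_commutator (h : IsLeviCivitaFrame V b θ) (hκ : IsCliffordFamily κ) {u : E n → F}
    (hu : ContDiffOn ℝ ∞ u V) {x : E n} (hx : x ∈ V) (i j : Fin n) :
    spinConn b θ κ i (spinConn b θ κ j u) x - spinConn b θ κ j (spinConn b θ κ i u) x =
      (∑ k, (θ i j k x - θ j i k x) • spinConn b θ κ k u x) +
        spinLift κ (fun s t => frameCurvature b θ i j s t x) (u x) := by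
  have h1 := congrArg (fun L : F →L[ℝ] F => L (u x))
    (spinLift_commutator_spinLift hκ (w := fun s t => θ i s t x) (w' := fun s t => θ j s t x)
      (fun s t => h.antisymm i s t x hx))
  have h2 := h.frameDeriv_commutator hu i j hx
  simp only [sub_apply] at h1
  have h3 : spinLift κ (fun s t => frameCurvature b θ i j s t x) (u x) =
      spinLift κ (fun s t => frameDeriv b i (θ j s t) x) (u x) -
        spinLift κ (fun s t => frameDeriv b j (θ i s t) x) (u x) +
        spinLift κ (fun s t => ∑ v, (θ j s v x * θ i v t x - θ i s v x * θ j v t x)) (u x) -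
        ∑ k, (θ i j k x - θ j i k x) • spinLift κ (fun s t => θ k s t x) (u x) := by
    have h4 : ∑ k, (θ i j k x - θ j i k x) • spinLift κ (fun s t => θ k s t x) (u x) =
        spinLift κ (fun s t => ∑ k, (θ i j k x - θ j i k x) * θ k s t x) (u x) := by
      simp only [spinLift_apply, Finset.smul_sum, Finset.sum_smul]
      rw [Finset.sum_comm]
      refine Finset.sum_congr rfl fun s _ => ?_
      rw [Finset.sum_comm]
      refine Finset.sum_congr rfl fun t _ => Finset.sum_congr rfl fun k _ => ?_
      module
    rw [h4]
    simp only [spinLift_apply, frameCurvature, ← smul_sub, ← smul_add, ← Finset.sum_sub_distrib,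
      ← Finset.sum_add_distrib, ← sub_smul, ← add_smul]
  rw [spinConn_spinConn h hu hx, spinConn_spinConn h hu hx, h3, ← h1]
  simp only [spinConn, smul_add, Finset.sum_add_distrib]
  rw [← h2]
  abel

/-- Split T into symmetric and antisymmetric parts: by the Clifford relations the symmetric part
contributes only minus its trace. -/
theorem sum_clifford_clifford (hκ : IsCliffordFamily κ) (T : Fin n → Fin n → F) :
    ∑ i, ∑ j, κ i (κ j (T i j)) =
      -∑ i, T i i + (1 / 2 : ℝ) • ∑ i, ∑ j, κ i (κ j (T i j - T j i)) := by
  have h1 : ∑ i, ∑ j, κ i (κ j (T j i)) = -∑ i, ∑ j, κ i (κ j (T i j)) - (2 : ℝ) • ∑ i, T i i := by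
    have h2 : ∀ i j, κ j (κ i (T i j)) =
        -κ i (κ j (T i j)) - if i = j then (2 : ℝ) • T i i else 0 := by
      intro i j
      have h3 := congrArg (fun L : F →L[ℝ] F => L (T i j)) (hκ i j)
      simp only [add_apply, mul_apply_eq_comp] at h3
      rw [eq_sub_iff_add_eq, eq_neg_iff_add_eq_zero, add_right_comm, add_comm (κ j _), h3]
      split_ifs with hij
      · subst hij
        have h4 : (-2 : F →L[ℝ] F) = (-2 : ℝ) • 1 := by
          rw [neg_smul, two_smul, one_add_one_eq_two]
        rw [h4]
        simp
      · simp
    rw [Finset.sum_comm]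
    simp only [h2, Finset.sum_sub_distrib, Finset.sum_neg_distrib, Finset.sum_ite_eq,
      Finset.mem_univ, if_true, ← Finset.smul_sum]
  simp only [map_sub, Finset.sum_sub_distrib]
  rw [h1]
  module

/-- The Lichnerowicz formula `D² = ∇*∇ + Scal/4`. -/
theorem localDirac_localDirac (h : IsLeviCivitaFrame V b θ) (hκ : IsCliffordFamily κ) {u : E n → F}
    (hu : ContDiffOn ℝ ∞ u V) {x : E n} (hx : x ∈ V) :
    localDirac b θ κ (localDirac b θ κ u) x =
      -(∑ i, (spinConn b θ κ i (spinConn b θ κ i u) x - ∑ k, θ i i k x • spinConn b θ κ k u x)) -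
        ((1 / 4 : ℝ) * ∑ i, ∑ j, frameCurvature b θ i j i j x) • u x := by
  have hs : ∀ j, DifferentiableAt ℝ (spinConn b θ κ j u) x := fun j =>
    differentiableAt_of_contDiffOn h.isOpen (h.contDiffOn_spinConn hu j) hx
  have hsum : ∀ i, spinConn b θ κ i (localDirac b θ κ u) x =
      ∑ j, spinConn b θ κ i (fun y => κ j (spinConn b θ κ j u y)) x := by
    intro i
    simp only [spinConn, Finset.sum_add_distrib]
    congr 1
    · exact frameDeriv_sum (fun j _ => (κ j).differentiableAt.comp x (hs j)) i
    · rw [localDirac, map_sum]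
      rfl
  -- Moving ∇_i past κ_j produces Clifford multiplication by ∇_{b_i} b_j. Reindexing with the
  -- antisymmetry of θ turns it into the correction which makes ∇_i ∇_j the tensorial second
  -- derivative.
  have h1 : localDirac b θ κ (localDirac b θ κ u) x = ∑ i, ∑ j, κ i (κ j
      (spinConn b θ κ i (spinConn b θ κ j u) x - ∑ k, θ i j k x • spinConn b θ κ k u x)) := by
    rw [localDirac]
    refine Finset.sum_congr rfl fun i _ => ?_
    rw [hsum, map_sum]
    simp only [spinConn_clifford h hκ hx (hs _), map_add, map_sub, map_sum, map_smul,
      Finset.sum_add_distrib, Finset.sum_sub_distrib]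
    rw [sub_eq_add_neg]
    congr 1
    rw [Finset.sum_comm, ← Finset.sum_neg_distrib]
    refine Finset.sum_congr rfl fun j _ => ?_
    rw [← Finset.sum_neg_distrib]
    refine Finset.sum_congr rfl fun k _ => ?_
    rw [h.antisymm i k j x hx, neg_smul]
  rw [h1, sum_clifford_clifford hκ, sub_eq_add_neg]
  congr 1
  -- Antisymmetrising the tensorial second derivative leaves no first order term, by vanishing of
  -- the torsion; only the curvature endomorphism remains.
  have h2 : ∀ i j, spinConn b θ κ i (spinConn b θ κ j u) x - ∑ k, θ i j k x • spinConn b θ κ k u x -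
      (spinConn b θ κ j (spinConn b θ κ i u) x - ∑ k, θ j i k x • spinConn b θ κ k u x) =
      spinLift κ (fun s t => frameCurvature b θ i j s t x) (u x) := by
    intro i j
    have h3 := spinConn_commutator h hκ hu hx i j
    simp only [sub_smul, Finset.sum_sub_distrib] at h3
    rw [← sub_eq_iff_eq_add'] at h3
    rw [← h3]
    abel
  -- The constants combine as ½ · ¼ · (-2) = -¼. With the present sign convention the scalar
  -- curvature is -∑ R_ijij, so this is Scal/4.
  have h4 := congrArg (fun L : F →L[ℝ] F => L (u x))
    (curvature_clifford_contraction hκ (R := fun i j s t => frameCurvature b θ i j s t x)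
      (fun i j s t => IsLeviCivitaFrame.frameCurvature_antisymm_left i j s t x)
      (fun i j s t => h.frameCurvature_antisymm_right i j s t hx)
      (fun i j s t => h.bianchi i j s t hx))
  simp only [sum_apply, smul_apply,
    mul_apply_eq_comp, Algebra.algebraMap_eq_smul_one,
    one_apply_eq_self] at h4
  simp only [h2, spinLift_apply, map_smul, map_sum, ← Finset.smul_sum]
  rw [h4]
  module

end Lichnerowicz


/-! ### The coefficients of the square of the Dirac operator -/

section SquareCoefficients

variable {n : ℕ}

theorem sum_rotate_three {A : Type*} [AddCommMonoid A] (f : Fin n → Fin n → Fin n → A) :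
    ∑ i, ∑ s, ∑ t, f i s t = ∑ s, ∑ t, ∑ i, f i s t :=
  (sum_sum_sum_cycle fun s t i => f i s t).symm

theorem sum_exchange_four {A : Type*} [AddCommMonoid A] (f : Fin n → Fin n → Fin n → Fin n → A) :
    ∑ i, ∑ s, ∑ t, ∑ k, f i s t k = ∑ k, ∑ s, ∑ t, ∑ i, f i s t k :=
  calc _ = ∑ i, ∑ k, ∑ s, ∑ t, f i s t k :=
        Finset.sum_congr rfl fun i _ => (sum_rotate_three fun k s t => f i s t k).symm
    _ = ∑ k, ∑ i, ∑ s, ∑ t, f i s t k := Finset.sum_comm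
    _ = _ := Finset.sum_congr rfl fun k _ => sum_rotate_three fun i s t => f i s t k

theorem sum_rotate_five {A : Type*} [AddCommMonoid A]
    (f : Fin n → Fin n → Fin n → Fin n → Fin n → A) :
    ∑ i, ∑ s, ∑ t, ∑ p, ∑ q, f i s t p q = ∑ s, ∑ t, ∑ p, ∑ q, ∑ i, f i s t p q :=
  calc _ = ∑ s, ∑ t, ∑ i, ∑ p, ∑ q, f i s t p q :=
        sum_rotate_three fun i s t => ∑ p, ∑ q, f i s t p q
    _ = _ := Finset.sum_congr rfl fun s _ => Finset.sum_congr rfl fun t _ =>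
        sum_rotate_three fun i p q => f i s t p q

/-- The coefficient of `∂_j ∂_k` in the square of the Dirac operator. -/
def coeffTwo (b : Fin n → Fin n → E n → ℝ) (j k : Fin n) (x : E n) : ℝ :=
  -∑ i, b i j x * b i k x

/-- The scalar part of the coefficient of `∂_k`. -/
def coeffOne (b : Fin n → Fin n → E n → ℝ) (θ : Fin n → Fin n → Fin n → E n → ℝ) (k : Fin n)
    (x : E n) : ℝ :=
  -(∑ i, frameDeriv b i (b i k) x) + ∑ i, ∑ l, θ i i l x * b l k x

/-- The coefficient of `κ_s κ_t ∂_k`. -/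
def coeffOneClifford (b : Fin n → Fin n → E n → ℝ) (θ : Fin n → Fin n → Fin n → E n → ℝ)
    (k s t : Fin n) (x : E n) : ℝ :=
  -(1 / 2) * ∑ i, b i k x * θ i s t x

/-- The scalar part of the term of order zero. -/
def coeffZero (b : Fin n → Fin n → E n → ℝ) (θ : Fin n → Fin n → Fin n → E n → ℝ)
    (x : E n) : ℝ :=
  -(1 / 4) * ∑ i, ∑ j, frameCurvature b θ i j i j x

/-- The coefficient of `κ_s κ_t` in the term of order zero. -/
def coeffZeroClifford (b : Fin n → Fin n → E n → ℝ) (θ : Fin n → Fin n → Fin n → E n → ℝ)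
    (s t : Fin n) (x : E n) : ℝ :=
  -(1 / 4) * ∑ i, (frameDeriv b i (θ i s t) x - ∑ l, θ i i l x * θ l s t x)

/-- The coefficient of `κ_s κ_t κ_u κ_v` in the term of order zero. -/
def coeffZeroCliffordTwo (θ : Fin n → Fin n → Fin n → E n → ℝ) (s t u v : Fin n) (x : E n) : ℝ :=
  -(1 / 16) * ∑ i, θ i s t x * θ i u v x

variable {F : Type*} [NormedAddCommGroup F] [NormedSpace ℝ F] {V : Set (E n)}
  {b : Fin n → Fin n → E n → ℝ} {θ : Fin n → Fin n → Fin n → E n → ℝ} {κ : Fin n → F →L[ℝ] F}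

/-- The Lichnerowicz formula sorted by order of differentiation and by number of generators, the two
quantities which the rescaling sees. The decisive point is that four generators occur only with a
product of two θ, never with a derivative of θ. -/
theorem localDirac_localDirac_eq_coeffs (h : IsLeviCivitaFrame V b θ) (hκ : IsCliffordFamily κ)
    {u : E n → F} (hu : ContDiffOn ℝ ∞ u V) {x : E n} (hx : x ∈ V) :
    localDirac b θ κ (localDirac b θ κ u) x =
      (∑ j, ∑ k, coeffTwo b j k x • pd j (pd k u) x) +
      (∑ k, (coeffOne b θ k x • pd k u x +
        ∑ s, ∑ t, coeffOneClifford b θ k s t x • κ s (κ t (pd k u x)))) +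
      (coeffZero b θ x • u x + (∑ s, ∑ t, coeffZeroClifford b θ s t x • κ s (κ t (u x))) +
        ∑ s, ∑ t, ∑ p, ∑ q, coeffZeroCliffordTwo θ s t p q x • κ s (κ t (κ p (κ q (u x))))) := by
  rw [localDirac_localDirac h hκ hu hx]
  have e2 : ∑ j, ∑ k, coeffTwo b j k x • pd j (pd k u) x =
      -∑ i, ∑ j, ∑ k, (b i j x * b i k x) • pd j (pd k u) x := by
    simp only [coeffTwo, neg_smul, Finset.sum_smul, Finset.sum_neg_distrib]
    congr 1
    conv_rhs => rw [Finset.sum_comm]; enter [2, j]; rw [Finset.sum_comm]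
  have e1 : ∑ k, coeffOne b θ k x • pd k u x =
      -(∑ i, ∑ k, frameDeriv b i (b i k) x • pd k u x) +
        ∑ i, ∑ l, θ i i l x • frameDeriv b l u x := by
    simp only [coeffOne, add_smul, neg_smul, Finset.sum_smul, Finset.sum_neg_distrib,
      Finset.sum_add_distrib, frameDeriv, Finset.smul_sum, smul_smul]
    congr 1
    · rw [Finset.sum_comm]
    · conv_rhs => enter [2, i]; rw [Finset.sum_comm]
      rw [Finset.sum_comm]
  have e1' : ∑ k, ∑ s, ∑ t, coeffOneClifford b θ k s t x • κ s (κ t (pd k u x)) =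
      -∑ i, (2 : ℝ) • spinLift κ (fun s t => θ i s t x) (frameDeriv b i u x) := by
    have e : ∀ i, (2 : ℝ) • spinLift κ (fun s t => θ i s t x) (frameDeriv b i u x) =
        ∑ s, ∑ t, ∑ k, (1 / 2 * (b i k x * θ i s t x)) • κ s (κ t (pd k u x)) := fun i => by
      rw [spinLift_apply]
      simp only [frameDeriv, map_sum, map_smul, Finset.smul_sum]
      refine Finset.sum_congr rfl fun s _ => Finset.sum_congr rfl fun t _ =>
        Finset.sum_congr rfl fun k _ => ?_
      module
    rw [Finset.sum_congr rfl fun i _ => e i, ← Finset.sum_neg_distrib]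
    simp only [coeffOneClifford, Finset.mul_sum, Finset.sum_smul, ← Finset.sum_neg_distrib]
    refine Eq.trans ?_ (sum_exchange_four fun i s t k =>
      -((1 / 2 * (b i k x * θ i s t x)) • κ s (κ t (pd k u x)))).symm
    refine Finset.sum_congr rfl fun k _ => Finset.sum_congr rfl fun s _ =>
      Finset.sum_congr rfl fun t _ => Finset.sum_congr rfl fun i _ => ?_
    module
  have e0' : ∑ s, ∑ t, coeffZeroClifford b θ s t x • κ s (κ t (u x)) =
      -∑ i, spinLift κ (fun s t => frameDeriv b i (θ i s t) x) (u x) +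
        ∑ i, ∑ l, θ i i l x • spinLift κ (fun s t => θ l s t x) (u x) := by
    have e : ∀ (i : Fin n) (w : Fin n → Fin n → ℝ), spinLift κ w (u x) =
        ∑ s, ∑ t, (1 / 4 * w s t) • κ s (κ t (u x)) := fun i w => by
      simp only [spinLift_apply, Finset.smul_sum, smul_smul]
    have e' : ∀ i, ∑ l, θ i i l x • spinLift κ (fun s t => θ l s t x) (u x) =
        ∑ s, ∑ t, (1 / 4 * ∑ l, θ i i l x * θ l s t x) • κ s (κ t (u x)) := fun i => by
      simp only [spinLift_apply, Finset.smul_sum, Finset.mul_sum, Finset.sum_smul]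
      refine (sum_rotate_three _).trans (Finset.sum_congr rfl fun s _ =>
        Finset.sum_congr rfl fun t _ => Finset.sum_congr rfl fun l _ => ?_)
      module
    rw [Finset.sum_congr rfl fun i _ => e' i, Finset.sum_congr rfl fun i _ => e i _,
      ← Finset.sum_neg_distrib, ← Finset.sum_add_distrib]
    simp only [coeffZeroClifford]
    simp only [← Finset.sum_neg_distrib, ← Finset.sum_add_distrib]
    refine Eq.trans ?_ (sum_rotate_three fun i s t =>
      -((1 / 4 * frameDeriv b i (θ i s t) x) • κ s (κ t (u x))) +
        (1 / 4 * ∑ l, θ i i l x * θ l s t x) • κ s (κ t (u x))).symm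
    refine Finset.sum_congr rfl fun s _ => Finset.sum_congr rfl fun t _ => ?_
    rw [Finset.mul_sum, Finset.sum_smul]
    refine Finset.sum_congr rfl fun k _ => ?_
    module
  have e0'' : ∑ s, ∑ t, ∑ p, ∑ q, coeffZeroCliffordTwo θ s t p q x • κ s (κ t (κ p (κ q (u x)))) =
      -∑ i, spinLift κ (fun s t => θ i s t x) (spinLift κ (fun s t => θ i s t x) (u x)) := by
    have e : ∀ i, spinLift κ (fun s t => θ i s t x) (spinLift κ (fun s t => θ i s t x) (u x)) =
        ∑ s, ∑ t, ∑ p, ∑ q, (1 / 16 * (θ i s t x * θ i p q x)) •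
          κ s (κ t (κ p (κ q (u x)))) := fun i => by
      rw [spinLift_apply, spinLift_apply]
      simp only [map_sum, map_smul, Finset.smul_sum]
      refine Finset.sum_congr rfl fun s _ => Finset.sum_congr rfl fun t _ =>
        Finset.sum_congr rfl fun p _ => Finset.sum_congr rfl fun q _ => ?_
      module
    rw [Finset.sum_congr rfl fun i _ => e i, ← Finset.sum_neg_distrib]
    simp only [coeffZeroCliffordTwo, Finset.mul_sum, Finset.sum_smul, ← Finset.sum_neg_distrib]
    refine Eq.trans ?_ (sum_rotate_five fun i s t p q =>
      -((1 / 16 * (θ i s t x * θ i p q x)) • κ s (κ t (κ p (κ q (u x)))))).symm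
    refine Finset.sum_congr rfl fun s _ => Finset.sum_congr rfl fun t _ =>
      Finset.sum_congr rfl fun p _ => Finset.sum_congr rfl fun q _ =>
        Finset.sum_congr rfl fun i _ => ?_
    module
  simp only [Finset.sum_add_distrib]
  rw [e2, e1, e1', e0', e0'']
  simp only [spinConn_spinConn h hu hx, h.frameDeriv_frameDeriv hu _ _ hx]
  simp only [spinConn, coeffZero, smul_add, Finset.sum_add_distrib, Finset.sum_sub_distrib, two_smul, mul_apply_eq_comp,
    neg_mul, neg_smul]
  abel

end SquareCoefficients


/-! ### Second order operators with Clifford coefficients -/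

section CliffordCoefficients

variable {n N : ℕ}

/-- The continuous linear map given by a complex matrix. -/
def matCLM (A : Matrix (Fin N) (Fin N) ℂ) : (Fin N → ℂ) →L[ℝ] (Fin N → ℂ) :=
  LinearMap.toContinuousLinearMap ((Matrix.mulVecLin A).restrictScalars ℝ)

@[simp] theorem matCLM_apply (A : Matrix (Fin N) (Fin N) ℂ) (v : Fin N → ℂ) :
    matCLM A v = A *ᵥ v := rfl

theorem clGen_mul_clGen (i j : Fin n) :
    clGen i * clGen j + clGen j * clGen i = if i = j then (-2 : Cl n) else 0 := by
  simp only [clGen, clVec]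
  rw [CliffordAlgebra.ι_mul_ι_add_swap]
  by_cases h : i = j
  · subst h
    simp only [QuadraticMap.polar_self, if_true]
    simp only [QuadraticMap.weightedSumSquares_apply, Pi.single_apply]
    simp [map_ofNat]
  · have : QuadraticMap.polar (negSq n) (Pi.single i 1) (Pi.single j 1) = 0 := by
      simp [QuadraticMap.polar, QuadraticMap.weightedSumSquares_apply, Pi.single_apply, h,
        mul_add, Finset.sum_add_distrib, Ne.symm h]
    simp [h, this]

theorem SpinorModule.isCliffordFamily (κ : SpinorModule n N) :
    IsCliffordFamily fun i => κ.act (clGen i) := by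
  intro i j
  simp only [SpinorModule.act, ← map_mul, ← map_add, Algebra.TensorProduct.tmul_mul_tmul, mul_one,
    ← TensorProduct.tmul_add, clGen_mul_clGen]
  split_ifs with h
  · have : ((1 : ℂ) ⊗ₜ[ℝ] (-2 : Cl n)) = -2 := by
      rw [TensorProduct.tmul_neg]
      exact congrArg Neg.neg
        (map_ofNat (Algebra.TensorProduct.includeRight : Cl n →ₐ[ℝ] ℂ ⊗[ℝ] Cl n) 2)
    rw [this, map_neg, map_ofNat]
  · simp

/-- The Lichnerowicz formula is stated for real continuous endomorphisms of a normed space; this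
makes it available for the spinor module. -/
theorem SpinorModule.isCliffordFamily_matCLM (κ : SpinorModule n N) :
    IsCliffordFamily fun i => matCLM (κ.act (clGen i)) := by
  intro i j
  have h := κ.isCliffordFamily i j
  ext1 v
  have h1 := congrArg (fun A => A *ᵥ v) h
  simp only [Matrix.add_mulVec, ← Matrix.mulVec_mulVec] at h1
  simp only [add_apply, mul_apply_eq_comp, matCLM_apply, h1]
  split_ifs
  · have : (-2 : Matrix (Fin N) (Fin N) ℂ) *ᵥ v = (-2 : ℂ) • v := by
      rw [show (-2 : Matrix (Fin N) (Fin N) ℂ) = (-2 : ℂ) • 1 by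
        rw [neg_smul]; congr 1; rw [two_smul]; norm_num, Matrix.smul_mulVec, Matrix.one_mulVec]
    rw [this]
    ext i
    simp
  · simp

variable {ι : Type} [Fintype ι] [DecidableEq ι]

/-- The coefficients of a second order operator whose coefficients are polynomials in matrices
`W_1, …, W_n` with even degrees. -/
def cliffordCoeffs (W : Fin n → Matrix ι ι ℂ) (c₂ : Fin n → Fin n → E n → ℂ) (c₁ : Fin n → E n → ℂ)
    (d₁ : Fin n → Fin n → Fin n → E n → ℂ) (c₀ : E n → ℂ) (d₀ : Fin n → Fin n → E n → ℂ)
    (f₀ : Fin n → Fin n → Fin n → Fin n → E n → ℂ) : Coeffs n ι :=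
  secondOrderCoeffs (fun j k x => c₂ j k x • 1)
    (fun k x => c₁ k x • 1 + ∑ s, ∑ t, d₁ k s t x • (W s * W t))
    (fun x => c₀ x • 1 + (∑ s, ∑ t, d₀ s t x • (W s * W t)) +
      ∑ s, ∑ t, ∑ p, ∑ q, f₀ s t p q x • ((W s * W t) * (W p * W q)))

theorem evalOp_cliffordCoeffs {V : Set (E n)} (hV : IsOpen V) (W : Fin n → Matrix ι ι ℂ)
    (c₂ : Fin n → Fin n → E n → ℂ) (c₁ : Fin n → E n → ℂ)
    (d₁ : Fin n → Fin n → Fin n → E n → ℂ) (c₀ : E n → ℂ) (d₀ : Fin n → Fin n → E n → ℂ)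
    (f₀ : Fin n → Fin n → Fin n → Fin n → E n → ℂ) {u : E n → ι → ℂ} (hu : ContDiffOn ℝ ∞ u V)
    {x : E n} (hx : x ∈ V) :
    evalOp 2 (cliffordCoeffs W c₂ c₁ d₁ c₀ d₀ f₀) u x =
      (∑ j, ∑ k, c₂ j k x • pd j (pd k u) x) +
      (∑ k, (c₁ k x • pd k u x + ∑ s, ∑ t, d₁ k s t x • (W s *ᵥ (W t *ᵥ pd k u x)))) +
      (c₀ x • u x + (∑ s, ∑ t, d₀ s t x • (W s *ᵥ (W t *ᵥ u x))) +
        ∑ s, ∑ t, ∑ p, ∑ q, f₀ s t p q x • (W s *ᵥ (W t *ᵥ (W p *ᵥ (W q *ᵥ u x))))) := by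
  rw [cliffordCoeffs, evalOp_secondOrderCoeffs hV _ _ _ hu hx]
  simp only [Matrix.add_mulVec, Matrix.sum_mulVec, Matrix.smul_mulVec, Matrix.one_mulVec,
    ← Matrix.mulVec_mulVec]

theorem smoothCoeffs_cliffordCoeffs {V : Set (E n)} {W : Fin n → Matrix ι ι ℂ}
    {c₂ : Fin n → Fin n → E n → ℂ} {c₁ : Fin n → E n → ℂ}
    {d₁ : Fin n → Fin n → Fin n → E n → ℂ} {c₀ : E n → ℂ} {d₀ : Fin n → Fin n → E n → ℂ}
    {f₀ : Fin n → Fin n → Fin n → Fin n → E n → ℂ}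
    (h₂ : ∀ j k, ContDiffOn ℝ ∞ (c₂ j k) V) (h₁ : ∀ k, ContDiffOn ℝ ∞ (c₁ k) V)
    (h₁' : ∀ k s t, ContDiffOn ℝ ∞ (d₁ k s t) V) (h₀ : ContDiffOn ℝ ∞ c₀ V)
    (h₀' : ∀ s t, ContDiffOn ℝ ∞ (d₀ s t) V) (h₀'' : ∀ s t p q, ContDiffOn ℝ ∞ (f₀ s t p q) V) :
    SmoothCoeffs V 2 (cliffordCoeffs W c₂ c₁ d₁ c₀ d₀ f₀) := by
  apply smoothCoeffs_secondOrderCoeffs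
  · intro j k I J
    simp only [Matrix.smul_apply, smul_eq_mul]
    exact (h₂ j k).mul contDiffOn_const
  · intro k I J
    simp only [Matrix.add_apply, Matrix.sum_apply, Matrix.smul_apply, smul_eq_mul]
    exact ((h₁ k).mul contDiffOn_const).add (ContDiffOn.sum fun s _ => ContDiffOn.sum fun t _ =>
      (h₁' k s t).mul contDiffOn_const)
  · intro I J
    simp only [Matrix.add_apply, Matrix.sum_apply, Matrix.smul_apply, smul_eq_mul]
    exact ((h₀.mul contDiffOn_const).add (ContDiffOn.sum fun s _ => ContDiffOn.sum fun t _ =>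
      (h₀' s t).mul contDiffOn_const)).add (ContDiffOn.sum fun s _ => ContDiffOn.sum fun t _ =>
      ContDiffOn.sum fun p _ => ContDiffOn.sum fun q _ => (h₀'' s t p q).mul contDiffOn_const)

/-- The coefficients of the square of the Dirac operator. -/
def diracSquare (b : Fin n → Fin n → E n → ℝ) (θ : Fin n → Fin n → Fin n → E n → ℝ)
    (κ : SpinorModule n N) : Coeffs n (Fin N) :=
  cliffordCoeffs (fun s => κ.act (clGen s)) (fun j k x => coeffTwo b j k x)
    (fun k x => coeffOne b θ k x) (fun k s t x => coeffOneClifford b θ k s t x)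
    (fun x => coeffZero b θ x) (fun s t x => coeffZeroClifford b θ s t x)
    (fun s t p q x => coeffZeroCliffordTwo θ s t p q x)

variable {V : Set (E n)} {b : Fin n → Fin n → E n → ℝ} {θ : Fin n → Fin n → Fin n → E n → ℝ}

theorem IsLeviCivitaFrame.contDiffOn_coeffTwo (h : IsLeviCivitaFrame V b θ) (j k : Fin n) :
    ContDiffOn ℝ ∞ (coeffTwo b j k) V :=
  (ContDiffOn.sum fun i _ => (h.smooth_frame i j).mul (h.smooth_frame i k)).neg

theorem IsLeviCivitaFrame.contDiffOn_coeffOne (h : IsLeviCivitaFrame V b θ) (k : Fin n) :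
    ContDiffOn ℝ ∞ (coeffOne b θ k) V :=
  (ContDiffOn.sum fun i _ => h.contDiffOn_frameDeriv (h.smooth_frame i k) i).neg.add
    (ContDiffOn.sum fun i _ => ContDiffOn.sum fun l _ =>
      (h.smooth_coeff i i l).mul (h.smooth_frame l k))

theorem IsLeviCivitaFrame.contDiffOn_coeffOneClifford (h : IsLeviCivitaFrame V b θ)
    (k s t : Fin n) : ContDiffOn ℝ ∞ (coeffOneClifford b θ k s t) V :=
  contDiffOn_const.mul (ContDiffOn.sum fun i _ => (h.smooth_frame i k).mul (h.smooth_coeff i s t))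

theorem IsLeviCivitaFrame.contDiffOn_coeffZero (h : IsLeviCivitaFrame V b θ) :
    ContDiffOn ℝ ∞ (coeffZero b θ) V :=
  contDiffOn_const.mul (ContDiffOn.sum fun i _ => ContDiffOn.sum fun j _ =>
    h.contDiffOn_frameCurvature i j i j)

theorem IsLeviCivitaFrame.contDiffOn_coeffZeroClifford (h : IsLeviCivitaFrame V b θ)
    (s t : Fin n) : ContDiffOn ℝ ∞ (coeffZeroClifford b θ s t) V :=
  contDiffOn_const.mul (ContDiffOn.sum fun i _ =>
    (h.contDiffOn_frameDeriv (h.smooth_coeff i s t) i).sub (ContDiffOn.sum fun l _ =>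
      (h.smooth_coeff i i l).mul (h.smooth_coeff l s t)))

theorem IsLeviCivitaFrame.contDiffOn_coeffZeroCliffordTwo (h : IsLeviCivitaFrame V b θ)
    (s t p q : Fin n) : ContDiffOn ℝ ∞ (coeffZeroCliffordTwo θ s t p q) V :=
  contDiffOn_const.mul (ContDiffOn.sum fun i _ => (h.smooth_coeff i s t).mul (h.smooth_coeff i p q))

theorem contDiffOn_ofReal {f : E n → ℝ} (hf : ContDiffOn ℝ ∞ f V) :
    ContDiffOn ℝ ∞ (fun x => (f x : ℂ)) V :=
  Complex.ofRealCLM.contDiff.comp_contDiffOn hf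

theorem IsLeviCivitaFrame.smoothCoeffs_diracSquare (h : IsLeviCivitaFrame V b θ)
    (κ : SpinorModule n N) : SmoothCoeffs V 2 (diracSquare b θ κ) :=
  smoothCoeffs_cliffordCoeffs (fun j k => contDiffOn_ofReal (h.contDiffOn_coeffTwo j k))
    (fun k => contDiffOn_ofReal (h.contDiffOn_coeffOne k))
    (fun k s t => contDiffOn_ofReal (h.contDiffOn_coeffOneClifford k s t))
    (contDiffOn_ofReal h.contDiffOn_coeffZero)
    (fun s t => contDiffOn_ofReal (h.contDiffOn_coeffZeroClifford s t))
    (fun s t p q => contDiffOn_ofReal (h.contDiffOn_coeffZeroCliffordTwo s t p q))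

theorem localDirac_localDirac_eq_evalOp (h : IsLeviCivitaFrame V b θ) (κ : SpinorModule n N)
    {u : E n → Fin N → ℂ} (hu : ContDiffOn ℝ ∞ u V) {x : E n} (hx : x ∈ V) :
    localDirac b θ (fun i => matCLM (κ.act (clGen i)))
      (localDirac b θ (fun i => matCLM (κ.act (clGen i))) u) x =
      evalOp 2 (diracSquare b θ κ) u x := by
  rw [localDirac_localDirac_eq_coeffs h κ.isCliffordFamily_matCLM hu hx, diracSquare,
    evalOp_cliffordCoeffs h.isOpen _ _ _ _ _ _ _ hu hx]
  simp only [matCLM_apply, Complex.coe_smul]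

end CliffordCoefficients


/-! ### Geometric functions -/

section Geometric

variable {n : ℕ} {V : Set (E n)} {A B : E n → Matrix (Fin n) (Fin n) ℝ}

/-- On `V`, the function `f` is a polynomial in the jets of the vielbeins, of order `k`. -/
def IsGeometricOn (V : Set (E n)) (A B : E n → Matrix (Fin n) (Fin n) ℝ) (k : ℕ) (f : E n → ℂ) :
    Prop :=
  ∃ g ∈ geometricPoly A B k, EqOn f g V

/-! ### Closure properties of the polynomials in the jets of the vielbeins -/

namespace IsGeometricOn

theorem congr {k : ℕ} {f g : E n → ℂ} (hg : IsGeometricOn V A B k g) (h : EqOn f g V) :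
    IsGeometricOn V A B k f := by
  obtain ⟨g', hg', e⟩ := hg
  exact ⟨g', hg', h.trans e⟩

theorem zero (k : ℕ) : IsGeometricOn V A B k fun _ => 0 :=
  ⟨0, zero_mem _, fun _ _ => rfl⟩

theorem add {k : ℕ} {f g : E n → ℂ} (hf : IsGeometricOn V A B k f)
    (hg : IsGeometricOn V A B k g) : IsGeometricOn V A B k fun x => f x + g x := by
  obtain ⟨f', hf', ef⟩ := hf
  obtain ⟨g', hg', eg⟩ := hg
  exact ⟨f' + g', add_mem hf' hg', fun x hx => by simp [ef hx, eg hx]⟩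

theorem const_mul {k : ℕ} {f : E n → ℂ} (c : ℂ) (hf : IsGeometricOn V A B k f) :
    IsGeometricOn V A B k fun x => c * f x := by
  obtain ⟨f', hf', ef⟩ := hf
  exact ⟨c • f', Submodule.smul_mem _ _ hf', fun x hx => by simp [ef hx]⟩

theorem mul_const {k : ℕ} {f : E n → ℂ} (c : ℂ) (hf : IsGeometricOn V A B k f) :
    IsGeometricOn V A B k fun x => f x * c := by
  simpa only [mul_comm _ c] using hf.const_mul c

theorem neg {k : ℕ} {f : E n → ℂ} (hf : IsGeometricOn V A B k f) :
    IsGeometricOn V A B k fun x => -f x := by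
  simpa using hf.const_mul (-1)

theorem sub {k : ℕ} {f g : E n → ℂ} (hf : IsGeometricOn V A B k f)
    (hg : IsGeometricOn V A B k g) : IsGeometricOn V A B k fun x => f x - g x := by
  simpa only [sub_eq_add_neg] using hf.add hg.neg

theorem sum {ι : Type*} {s : Finset ι} {k : ℕ} {f : ι → E n → ℂ}
    (hf : ∀ i ∈ s, IsGeometricOn V A B k (f i)) :
    IsGeometricOn V A B k fun x => ∑ i ∈ s, f i x := by
  classical
  induction s using Finset.induction_on with
  | empty => simpa using zero k
  | insert i s hi ih =>
    simp only [Finset.sum_insert hi]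
    exact (hf i (Finset.mem_insert_self _ _)).add
      (ih fun j hj => hf j (Finset.mem_insert_of_mem hj))

/-- Monomials multiply by concatenating their lists of jets, and the orders add. Keeping `k + l = m`
as an argument with default `rfl` avoids rewriting numerical orders at each use. -/
theorem mul {k l m : ℕ} {f g : E n → ℂ} (hf : IsGeometricOn V A B k f)
    (hg : IsGeometricOn V A B l g) (hm : k + l = m := by rfl) :
    IsGeometricOn V A B m fun x => f x * g x := by
  subst hm
  obtain ⟨f', hf', ef⟩ := hf
  obtain ⟨g', hg', eg⟩ := hg
  refine ⟨f' * g', ?_, fun x hx => by simp [ef hx, eg hx]⟩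
  have hle : geometricPoly A B k * geometricPoly A B l ≤ geometricPoly A B (k + l) := by
    rw [geometricPoly, geometricPoly, Submodule.span_mul_span]
    apply Submodule.span_mono
    rintro _ ⟨_, ⟨L, hL, rfl⟩, _, ⟨L', hL', rfl⟩, rfl⟩
    refine ⟨L ++ L', by simp [hL, hL'], ?_⟩
    ext x
    simp
  exact hle (Submodule.mul_mem_mul hf' hg')

theorem ite {k : ℕ} {p : Prop} [Decidable p] {f : E n → ℂ} (hf : p → IsGeometricOn V A B k f) :
    IsGeometricOn V A B k fun x => if p then f x else 0 := by
  by_cases h : p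
  · simpa [h] using hf h
  · simpa [h] using zero k

end IsGeometricOn

theorem isGeometricOn_entry (i j : Fin n) : IsGeometricOn V A B 0 fun x => (B x i j : ℂ) := by
  refine ⟨_, Submodule.subset_span ⟨[⟨true, i, j, 0⟩], ?_, rfl⟩, fun x _ => ?_⟩
  · simp [VielbeinJet.order]
  · simp [VielbeinJet.eval]

theorem isGeometricOn_inv_entry (i j : Fin n) : IsGeometricOn V A B 0 fun x => (A x i j : ℂ) := by
  refine ⟨_, Submodule.subset_span ⟨[⟨false, i, j, 0⟩], ?_, rfl⟩, fun x _ => ?_⟩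
  · simp [VielbeinJet.order]
  · simp [VielbeinJet.eval]

theorem pd_ofReal {f : E n → ℝ} {x : E n} (hf : DifferentiableAt ℝ f x) (j : Fin n) :
    pd j (fun y => (f y : ℂ)) x = ((pd j f x : ℝ) : ℂ) :=
  pd_clm Complex.ofRealCLM hf j

theorem contDiffOn_jet_eval (hV : IsOpen V) (hA : ∀ i j, ContDiffOn ℝ ∞ (fun x => A x i j) V)
    (hB : ∀ i j, ContDiffOn ℝ ∞ (fun x => B x i j) V) (J : VielbeinJet n) :
    ContDiffOn ℝ ∞ (J.eval A B) V := by
  refine contDiffOn_pdPow hV ?_ _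
  cases J.inv
  exacts [hA _ _, hB _ _]

theorem pd_jet_eval (hV : IsOpen V) (hA : ∀ i j, ContDiffOn ℝ ∞ (fun x => A x i j) V)
    (hB : ∀ i j, ContDiffOn ℝ ∞ (fun x => B x i j) V) (J : VielbeinJet n) (j : Fin n) :
    EqOn (pd j (J.eval A B)) (VielbeinJet.eval A B ⟨J.inv, J.i, J.l, J.β + Pi.single j 1⟩) V := by
  refine pd_pdPow hV ?_ _ _
  cases J.inv
  exacts [hA _ _, hB _ _]

/-- In the Leibniz rule each term differentiates exactly one jet and raises its order by one.
Smoothness of the monomial is proved in the same induction because the rule needs it for the tail of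
the list. -/
theorem isGeometricOn_pd_monomial (hV : IsOpen V) (hA : ∀ i j, ContDiffOn ℝ ∞ (fun x => A x i j) V)
    (hB : ∀ i j, ContDiffOn ℝ ∞ (fun x => B x i j) V) (j : Fin n) (L : List (VielbeinJet n)) :
    ContDiffOn ℝ ∞ (fun x => (((L.map fun J => J.eval A B x).prod : ℝ) : ℂ)) V ∧
    IsGeometricOn V A B ((L.map VielbeinJet.order).sum + 1)
      (pd j fun x => (((L.map fun J => J.eval A B x).prod : ℝ) : ℂ)) := by
  induction L with
  | nil =>
    refine ⟨by simpa using contDiffOn_const, ?_⟩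
    refine (IsGeometricOn.zero _).congr fun x _ => ?_
    simp
  | cons J L ih =>
    obtain ⟨ih1, ih2⟩ := ih
    have hJ : ContDiffOn ℝ ∞ (fun x => (J.eval A B x : ℂ)) V :=
      contDiffOn_ofReal (contDiffOn_jet_eval hV hA hB J)
    have e : (fun x => ((((J :: L).map fun J => J.eval A B x).prod : ℝ) : ℂ)) =
        fun x => (J.eval A B x : ℂ) * (((L.map fun J => J.eval A B x).prod : ℝ) : ℂ) := by
      ext x
      simp
    have hmono : ∀ J : VielbeinJet n, IsGeometricOn V A B J.order
        fun x => (J.eval A B x : ℂ) := fun J =>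
      ⟨_, Submodule.subset_span ⟨[J], by simp, rfl⟩, fun x _ => by simp⟩
    rw [e]
    refine ⟨hJ.mul ih1, ?_⟩
    have h1 := (hmono J).mul ih2 rfl
    have h2 := (hmono ⟨J.inv, J.i, J.l, J.β + Pi.single j 1⟩).mul
      (⟨_, Submodule.subset_span ⟨L, rfl, rfl⟩, fun _ _ => rfl⟩ :
        IsGeometricOn V A B (L.map VielbeinJet.order).sum
          fun x => (((L.map fun J => J.eval A B x).prod : ℝ) : ℂ)) rfl
    have o1 : J.order + ((L.map VielbeinJet.order).sum + 1) =
        ((J :: L).map VielbeinJet.order).sum + 1 := by simp; ring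
    have o2 : VielbeinJet.order ⟨J.inv, J.i, J.l, J.β + Pi.single j 1⟩ +
        (L.map VielbeinJet.order).sum = ((J :: L).map VielbeinJet.order).sum + 1 := by
      simp [VielbeinJet.order, Finset.sum_add_distrib]; ring
    rw [o1] at h1
    rw [o2] at h2
    refine (h1.add h2).congr fun x hx => ?_
    rw [pd_mul (differentiableAt_of_contDiffOn hV hJ hx)
      (differentiableAt_of_contDiffOn hV ih1 hx),
      pd_ofReal (differentiableAt_of_contDiffOn hV (contDiffOn_jet_eval hV hA hB J) hx),
      pd_jet_eval hV hA hB J j hx]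

theorem IsGeometricOn.pd (hV : IsOpen V) (hA : ∀ i j, ContDiffOn ℝ ∞ (fun x => A x i j) V)
    (hB : ∀ i j, ContDiffOn ℝ ∞ (fun x => B x i j) V) {k : ℕ} {f : E n → ℂ}
    (hf : IsGeometricOn V A B k f) (j : Fin n) : IsGeometricOn V A B (k + 1) (pd j f) := by
  obtain ⟨g, hg, e⟩ := hf
  -- Smoothness is added to the claim so that sums and multiples can be differentiated during the
  -- induction on the span.
  suffices h : ContDiffOn ℝ ∞ g V ∧ IsGeometricOn V A B (k + 1) (Getzler.pd j g) from
    h.2.congr (pd_eqOn hV e j)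
  clear e
  induction hg using Submodule.span_induction with
  | mem x hx =>
    obtain ⟨L, rfl, rfl⟩ := hx
    exact isGeometricOn_pd_monomial hV hA hB j L
  | zero =>
    refine ⟨contDiffOn_const, (IsGeometricOn.zero _).congr fun x _ => ?_⟩
    exact congrFun (pd_const j (0 : ℂ)) x
  | add f g _ _ hf hg =>
    refine ⟨hf.1.add hg.1, (hf.2.add hg.2).congr fun x hx => ?_⟩
    exact pd_add (differentiableAt_of_contDiffOn hV hf.1 hx)
      (differentiableAt_of_contDiffOn hV hg.1 hx) j
  | smul c f _ hf =>
    refine ⟨contDiffOn_const.smul hf.1, (hf.2.const_mul c).congr fun x hx => ?_⟩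
    have h1 := pd_mul (f := fun _ => c) (differentiableAt_const c)
      (differentiableAt_of_contDiffOn hV hf.1 hx) j
    change Getzler.pd j (fun y => c * f y) x = _
    simpa using h1

theorem IsGeometricOn.pd_real (hV : IsOpen V) (hA : ∀ i j, ContDiffOn ℝ ∞ (fun x => A x i j) V)
    (hB : ∀ i j, ContDiffOn ℝ ∞ (fun x => B x i j) V) {k : ℕ} {f : E n → ℝ}
    (hf : IsGeometricOn V A B k fun x => (f x : ℂ)) (hf' : ContDiffOn ℝ ∞ f V) (j : Fin n) :
    IsGeometricOn V A B (k + 1) fun x => ((Getzler.pd j f x : ℝ) : ℂ) :=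
  (hf.pd hV hA hB j).congr fun _ hx =>
    (pd_ofReal (differentiableAt_of_contDiffOn hV hf' hx) j).symm

theorem IsGeometricOn.frameDeriv (hV : IsOpen V) (hA : ∀ i j, ContDiffOn ℝ ∞ (fun x => A x i j) V)
    (hB : ∀ i j, ContDiffOn ℝ ∞ (fun x => B x i j) V) {k : ℕ} {f : E n → ℝ}
    (hf : IsGeometricOn V A B k fun x => (f x : ℂ)) (hf' : ContDiffOn ℝ ∞ f V) (i : Fin n) :
    IsGeometricOn V A B (k + 1) fun x => ((Getzler.frameDeriv (fun i j x => B x i j) i f x : ℝ) : ℂ) := by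
  simp only [Getzler.frameDeriv, smul_eq_mul, Complex.ofReal_sum, Complex.ofReal_mul]
  refine IsGeometricOn.sum fun j _ => ?_
  exact (isGeometricOn_entry i j).mul (hf.pd_real hV hA hB hf' j) (zero_add _)

end Geometric

/-! ### The Koszul formula -/

section Koszul

variable {n : ℕ} {V : Set (E n)} {b : Fin n → Fin n → E n → ℝ}
  {θ : Fin n → Fin n → Fin n → E n → ℝ}

/-- The coefficients of `[b_i, b_s]` in the frame `b_t`. -/
def structureCoeff (b : Fin n → Fin n → E n → ℝ) (i s t : Fin n) (x : E n) : ℝ :=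
  ∑ k, (frameDeriv b i (b s k) x - frameDeriv b s (b i k) x) *
    (Matrix.of fun i j => b i j x)⁻¹ k t

theorem structureCoeff_eq {x : E n} (hb : IsUnit (Matrix.of fun i j => b i j x))
    (htor : ∀ i s k, frameDeriv b i (b s k) x - frameDeriv b s (b i k) x =
      ∑ t, (θ i s t x - θ s i t x) * b t k x) (i s t : Fin n) :
    structureCoeff b i s t x = θ i s t x - θ s i t x := by
  have h : (Matrix.of fun i j => b i j x) * (Matrix.of fun i j => b i j x)⁻¹ = 1 :=
    Matrix.mul_nonsing_inv _ ((Matrix.isUnit_iff_isUnit_det _).1 hb)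
  have h' : ∀ u, ∑ k, b u k x * (Matrix.of fun i j => b i j x)⁻¹ k t = if u = t then 1 else 0 :=
    fun u => by
      have := congrFun (congrFun h u) t
      simpa [Matrix.mul_apply, Matrix.one_apply] using this
  simp only [structureCoeff, htor, Finset.sum_mul, mul_assoc]
  rw [Finset.sum_comm]
  simp only [← Finset.mul_sum, h']
  simp

/-- Antisymmetry and vanishing torsion determine θ: in this combination of the structure functions
all values of θ but θ_ist cancel in pairs. -/
theorem koszul {x : E n} (hb : IsUnit (Matrix.of fun i j => b i j x))
    (hanti : ∀ i s t, θ i s t x = -θ i t s x)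
    (htor : ∀ i s k, frameDeriv b i (b s k) x - frameDeriv b s (b i k) x =
      ∑ t, (θ i s t x - θ s i t x) * b t k x) (i s t : Fin n) :
    θ i s t x = 1 / 2 * (structureCoeff b i s t x - structureCoeff b s t i x +
      structureCoeff b t i s x) := by
  rw [structureCoeff_eq hb htor, structureCoeff_eq hb htor, structureCoeff_eq hb htor]
  linarith [hanti s t i, hanti t s i, hanti i t s]

theorem contDiffOn_det {K : Type*} [NormedField K] [NormedAlgebra ℝ K] {m : ℕ}
    {M : E n → Matrix (Fin m) (Fin m) K}
    (hM : ∀ i j, ContDiffOn ℝ ∞ (fun x => M x i j) V) : ContDiffOn ℝ ∞ (fun x => (M x).det) V := by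
  simp only [Matrix.det_apply]
  refine ContDiffOn.sum fun σ _ => ?_
  rcases Int.units_eq_one_or (Equiv.Perm.sign σ) with h | h
  · simpa [h] using contDiffOn_prod fun i _ => hM _ _
  · simpa [h] using (contDiffOn_prod fun i _ => hM _ _).neg

theorem contDiffOn_matrix_inv {K : Type*} [NormedField K] [NormedAlgebra ℝ K] {m : ℕ}
    {M : E n → Matrix (Fin m) (Fin m) K}
    (hM : ∀ i j, ContDiffOn ℝ ∞ (fun x => M x i j) V) (hu : ∀ x ∈ V, IsUnit (M x)) (i j : Fin m) :
    ContDiffOn ℝ ∞ (fun x => (M x)⁻¹ i j) V := by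
  simp only [Matrix.inv_def, Matrix.smul_apply, Matrix.adjugate_apply, Ring.inverse_eq_inv,
    smul_eq_mul]
  refine ((contDiffOn_det hM).inv fun x hx =>
    ((Matrix.isUnit_iff_isUnit_det _).1 (hu x hx)).ne_zero).mul (contDiffOn_det fun k l => ?_)
  by_cases h : k = j
  · subst h
    simpa using contDiffOn_const
  · simpa [Matrix.updateRow_ne h] using hM k l

/-- The connection coefficients are determined by the frame; in particular they are smooth. -/
theorem isLeviCivitaFrame_of_torsion_free (hV : IsOpen V)
    (hb : ∀ i j, ContDiffOn ℝ ∞ (b i j) V)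
    (hu : ∀ x ∈ V, IsUnit (Matrix.of fun i j => b i j x))
    (hanti : ∀ i s t, ∀ x ∈ V, θ i s t x = -θ i t s x)
    (htor : ∀ i s k, ∀ x ∈ V, frameDeriv b i (b s k) x - frameDeriv b s (b i k) x =
      ∑ t, (θ i s t x - θ s i t x) * b t k x) : IsLeviCivitaFrame V b θ := by
  have hs : ∀ i s t, ContDiffOn ℝ ∞ (structureCoeff b i s t) V := fun i s t =>
    ContDiffOn.sum fun k _ => ((contDiffOn_frameDeriv hV hb (hb s k) i).sub
      (contDiffOn_frameDeriv hV hb (hb i k) s)).mul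
        (contDiffOn_matrix_inv (M := fun x => Matrix.of fun i j => b i j x) hb hu k t)
  refine ⟨hV, hb, fun i s t => ?_, hu, hanti, htor⟩
  refine (contDiffOn_const (c := (1 / 2 : ℝ)).mul
    (((hs i s t).sub (hs s t i)).add (hs t i s))).congr fun x hx => ?_
  exact koszul (hu x hx) (fun i s t => hanti i s t x hx) (fun i s k => htor i s k x hx) i s t

end Koszul

/-! ### The square of the Dirac operator is geometric -/

section DiracGeometric

variable {n N : ℕ} {V : Set (E n)} {B : E n → Matrix (Fin n) (Fin n) ℝ}
  {θ : Fin n → Fin n → Fin n → E n → ℝ}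

/-- The Koszul formula expresses θ through structure functions, each of whose terms contains one
derivative of some b and otherwise only undifferentiated b's and entries of the inverse matrix. This
is order one. -/
theorem IsLeviCivitaFrame.isGeometricOn_coeff
    (h : IsLeviCivitaFrame V (fun i j x => B x i j) θ) (i s t : Fin n) :
    IsGeometricOn V (fun x => (B x)⁻¹) B 1 fun x => (θ i s t x : ℂ) := by
  have hA : ∀ i j, ContDiffOn ℝ ∞ (fun x => (B x)⁻¹ i j) V :=
    contDiffOn_matrix_inv h.smooth_frame h.isUnit
  have hEb : ∀ i s k, IsGeometricOn V (fun x => (B x)⁻¹) B 1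
      fun x => ((frameDeriv (fun i j x => B x i j) i (fun x => B x s k) x : ℝ) : ℂ) :=
    fun i s k =>
      (isGeometricOn_entry (V := V) (A := fun x => (B x)⁻¹) (B := B) s k).frameDeriv (f := fun x => B x s k)
        h.isOpen hA h.smooth_frame (h.smooth_frame s k) i
  have hs : ∀ i s t, IsGeometricOn V (fun x => (B x)⁻¹) B 1
      fun x => (structureCoeff (fun i j x => B x i j) i s t x : ℂ) := by
    intro i s t
    have e : ∀ x, (Matrix.of fun i j => B x i j) = B x := fun x => rfl
    simp only [structureCoeff, e, Complex.ofReal_sum, Complex.ofReal_mul, Complex.ofReal_sub]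
    exact IsGeometricOn.sum fun k _ => ((hEb i s k).sub (hEb s i k)).mul
      (isGeometricOn_inv_entry (A := fun x => (B x)⁻¹) k t)
  refine ((((hs i s t).sub (hs s t i)).add (hs t i s)).const_mul (1 / 2)).congr fun x hx => ?_
  beta_reduce
  rw [koszul (b := fun i j x => B x i j) (h.isUnit x hx) (fun i s t => h.antisymm i s t x hx)
    (fun i s k => h.torsion_free i s k x hx) i s t]
  push_cast
  ring

/-- The entries of the products of the W are constants, so they only enter as the constant
coefficients of the combinations; the orders are those of the scalar functions. -/
theorem isGeometricOn_cliffordCoeffs {ι : Type} [Fintype ι] [DecidableEq ι]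
    {A : E n → Matrix (Fin n) (Fin n) ℝ} {W : Fin n → Matrix ι ι ℂ}
    {c₂ : Fin n → Fin n → E n → ℂ} {c₁ : Fin n → E n → ℂ}
    {d₁ : Fin n → Fin n → Fin n → E n → ℂ} {c₀ : E n → ℂ} {d₀ : Fin n → Fin n → E n → ℂ}
    {f₀ : Fin n → Fin n → Fin n → Fin n → E n → ℂ}
    (h₂ : ∀ j k, IsGeometricOn V A B 0 (c₂ j k)) (h₁ : ∀ k, IsGeometricOn V A B 1 (c₁ k))
    (h₁' : ∀ k s t, IsGeometricOn V A B 1 (d₁ k s t)) (h₀ : IsGeometricOn V A B 2 c₀)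
    (h₀' : ∀ s t, IsGeometricOn V A B 2 (d₀ s t))
    (h₀'' : ∀ s t p q, IsGeometricOn V A B 2 (f₀ s t p q)) (γ : Fin n → ℕ) (I J : ι) :
    IsGeometricOn V A B (2 - ∑ i, γ i)
      fun x => cliffordCoeffs W c₂ c₁ d₁ c₀ d₀ f₀ γ x I J := by
  have ite_app : ∀ (p : Prop) [Decidable p] (M : Matrix ι ι ℂ),
      (if p then M else 0) I J = if p then M I J else 0 := by
    intro p _ M
    split_ifs <;> rfl
  simp only [cliffordCoeffs, secondOrderCoeffs, Matrix.add_apply, Matrix.sum_apply, ite_app,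
    Matrix.smul_apply, smul_eq_mul]
  refine ((IsGeometricOn.sum fun j _ => IsGeometricOn.sum fun k _ => IsGeometricOn.ite fun e => ?_).add
    (IsGeometricOn.sum fun k _ => IsGeometricOn.ite fun e => ?_)).add (IsGeometricOn.ite fun e => ?_)
  · have : 2 - ∑ i, γ i = 0 := by simp [← e, Finset.sum_add_distrib]
    rw [this]
    exact (h₂ j k).mul_const _
  · have : 2 - ∑ i, γ i = 1 := by simp [← e]
    rw [this]
    exact ((h₁ k).mul_const _).add (IsGeometricOn.sum fun s _ => IsGeometricOn.sum fun t _ =>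
      (h₁' k s t).mul_const _)
  · have : 2 - ∑ i, γ i = 2 := by simp [← e]
    rw [this]
    exact ((h₀.mul_const _).add (IsGeometricOn.sum fun s _ => IsGeometricOn.sum fun t _ =>
      (h₀' s t).mul_const _)).add (IsGeometricOn.sum fun s _ => IsGeometricOn.sum fun t _ =>
      IsGeometricOn.sum fun p _ => IsGeometricOn.sum fun q _ => (h₀'' s t p q).mul_const _)

/-- Count orders: b has order 0, θ has order 1, a derivative along the frame adds 1. The curvature
is thus of order 2, as are the products θθ in the term without derivatives. -/
theorem IsLeviCivitaFrame.isGeometricOn_diracSquare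
    (h : IsLeviCivitaFrame V (fun i j x => B x i j) θ) (κ : SpinorModule n N) (γ : Fin n → ℕ)
    (I J : Fin N) :
    IsGeometricOn V (fun x => (B x)⁻¹) B (2 - ∑ i, γ i)
      fun x => diracSquare (fun i j x => B x i j) θ κ γ x I J := by
  have hA : ∀ i j, ContDiffOn ℝ ∞ (fun x => (B x)⁻¹ i j) V :=
    contDiffOn_matrix_inv h.smooth_frame h.isUnit
  have hB := h.smooth_frame
  have hθ := h.isGeometricOn_coeff
  have hb : ∀ i j, IsGeometricOn V (fun x => (B x)⁻¹) B 0 fun x => (B x i j : ℂ) :=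
    isGeometricOn_entry
  have hEb : ∀ i s k, IsGeometricOn V (fun x => (B x)⁻¹) B 1
      fun x => ((frameDeriv (fun i j x => B x i j) i (fun x => B x s k) x : ℝ) : ℂ) :=
    fun i s k =>
      (isGeometricOn_entry (V := V) (A := fun x => (B x)⁻¹) (B := B) s k).frameDeriv (f := fun x => B x s k)
        h.isOpen hA h.smooth_frame (h.smooth_frame s k) i
  have hEθ : ∀ i j s t, IsGeometricOn V (fun x => (B x)⁻¹) B 2
      fun x => ((frameDeriv (fun i j x => B x i j) i (θ j s t) x : ℝ) : ℂ) := fun i j s t =>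
    (hθ j s t).frameDeriv h.isOpen hA hB (h.smooth_coeff j s t) i
  refine isGeometricOn_cliffordCoeffs ?_ ?_ ?_ ?_ ?_ ?_ γ I J
  · intro j k
    simp only [coeffTwo, Complex.ofReal_neg, Complex.ofReal_sum, Complex.ofReal_mul]
    exact (IsGeometricOn.sum fun i _ => (hb i j).mul (hb i k)).neg
  · intro k
    simp only [coeffOne, Complex.ofReal_neg, Complex.ofReal_add, Complex.ofReal_sum,
      Complex.ofReal_mul]
    exact (IsGeometricOn.sum fun i _ => hEb i i k).neg.add
      (IsGeometricOn.sum fun i _ => IsGeometricOn.sum fun l _ => (hθ i i l).mul (hb l k))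
  · intro k s t
    simp only [coeffOneClifford, Complex.ofReal_sum, Complex.ofReal_mul]
    exact (IsGeometricOn.sum fun i _ => (hb i k).mul (hθ i s t)).const_mul _
  · simp only [coeffZero, frameCurvature, Complex.ofReal_sum, Complex.ofReal_mul,
      Complex.ofReal_add, Complex.ofReal_sub]
    exact (IsGeometricOn.sum fun i _ => IsGeometricOn.sum fun j _ =>
      (((hEθ _ _ _ _).sub (hEθ _ _ _ _)).add (IsGeometricOn.sum fun u _ =>
        ((hθ _ _ _).mul (hθ _ _ _)).sub ((hθ _ _ _).mul (hθ _ _ _)))).sub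
      (IsGeometricOn.sum fun u _ => ((hθ _ _ _).sub (hθ _ _ _)).mul (hθ _ _ _))).const_mul _
  · intro s t
    simp only [coeffZeroClifford, Complex.ofReal_sum, Complex.ofReal_mul, Complex.ofReal_sub]
    exact (IsGeometricOn.sum fun i _ => (hEθ _ _ _ _).sub (IsGeometricOn.sum fun l _ =>
      (hθ _ _ _).mul (hθ _ _ _))).const_mul _
  · intro s t p q
    simp only [coeffZeroCliffordTwo, Complex.ofReal_sum, Complex.ofReal_mul]
    exact (IsGeometricOn.sum fun i _ => (hθ _ _ _).mul (hθ _ _ _)).const_mul _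

end DiracGeometric


/-! ### Radial gauge -/

section Radial

variable {n : ℕ} {F : Type*} [NormedAddCommGroup F] [NormedSpace ℝ F] {r : ℝ}

theorem differentiableAt_coord (j : Fin n) (x : E n) : DifferentiableAt ℝ (fun y : E n => y j) x :=
  (EuclideanSpace.proj j : E n →L[ℝ] ℝ).differentiableAt

theorem smul_mem_ball_of_mem_Icc {x : E n} (hx : x ∈ Metric.ball 0 r) {t : ℝ}
    (ht : t ∈ Icc (0 : ℝ) 1) : t • x ∈ Metric.ball (0 : E n) r := by
  rw [mem_ball_zero_iff] at hx ⊢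
  rw [norm_smul, Real.norm_of_nonneg ht.1]
  exact (mul_le_of_le_one_left (norm_nonneg x) ht.2).trans_lt hx

theorem hasDerivAt_comp_smul {f : E n → F} {x : E n} {t : ℝ} (hf : DifferentiableAt ℝ f (t • x)) :
    HasDerivAt (fun s : ℝ => f (s • x)) (∑ i, x i • pd i f (t • x)) t := by
  rw [← fderiv_eq_sum_pd]
  have h1 : HasDerivAt (fun s : ℝ => s • x) x t := by
    simpa using (hasDerivAt_id t).smul_const x
  exact hf.hasFDerivAt.comp_hasDerivAt t h1

/-- A function whose radial derivative vanishes on a ball is constant. -/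
theorem eq_at_zero_of_radial_deriv {f : E n → F} (hf : ContDiffOn ℝ ∞ f (Metric.ball 0 r))
    (h : ∀ x ∈ Metric.ball (0 : E n) r, ∑ i, x i • pd i f x = 0) {x : E n}
    (hx : x ∈ Metric.ball 0 r) : f x = f 0 := by
  -- The hypothesis at tx gives t times the derivative along the ray, so t = 0 has to be excluded;
  -- the origin is reached by a limit at the end.
  have hd : ∀ t ∈ Ioc (0 : ℝ) 1, HasDerivAt (fun s : ℝ => f (s • x)) 0 t := by
    intro t ht
    have hm := smul_mem_ball_of_mem_Icc hx ⟨ht.1.le, ht.2⟩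
    convert hasDerivAt_comp_smul (differentiableAt_of_contDiffOn Metric.isOpen_ball hf hm) using 1
    have h2 := h _ hm
    simp only [PiLp.smul_apply, smul_eq_mul, mul_smul, ← Finset.smul_sum] at h2
    exact ((smul_eq_zero.1 h2).resolve_left ht.1.ne').symm
  have hconst : ∀ ε ∈ Ioo (0 : ℝ) 1, f (ε • x) = f x := by
    intro ε hε
    have hmem : ∀ t ∈ Icc ε 1, t ∈ Ioc (0 : ℝ) 1 := fun t ht => ⟨hε.1.trans_le ht.1, ht.2⟩
    have := constant_of_has_deriv_right_zero (f := fun s : ℝ => f (s • x)) (a := ε) (b := 1)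
      (fun t ht => (hd t (hmem t ht)).continuousAt.continuousWithinAt)
      (fun t ht => (hd t (hmem t ⟨ht.1, ht.2.le⟩)).hasDerivWithinAt) 1 ⟨hε.2.le, le_rfl⟩
    simpa using this.symm
  have hr : 0 < r := (norm_nonneg x).trans_lt (mem_ball_zero_iff.1 hx)
  have hlim : Tendsto (fun ε : ℝ => f (ε • x)) (𝓝[>] 0) (𝓝 (f 0)) := by
    have h1 : ContinuousAt f ((0 : ℝ) • x) := by
      rw [zero_smul]
      exact hf.continuousOn.continuousAt (Metric.ball_mem_nhds _ hr)
    have h2 : ContinuousAt (fun ε : ℝ => f (ε • x)) 0 :=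
      ContinuousAt.comp (g := f) (f := fun ε : ℝ => ε • x) h1 (by fun_prop)
    have := h2.tendsto
    rw [zero_smul] at this
    exact this.mono_left nhdsWithin_le_nhds
  refine tendsto_nhds_unique (tendsto_const_nhds.congr' ?_) hlim
  filter_upwards [Ioo_mem_nhdsGT (one_pos (α := ℝ))] with ε hε using (hconst ε hε).symm

theorem pd_sum_coord_smul {ζ : Fin n → E n → F} {x : E n} (hζ : ∀ k, DifferentiableAt ℝ (ζ k) x)
    (j : Fin n) : pd j (fun y => ∑ k, y k • ζ k y) x = ζ j x + ∑ k, x k • pd j (ζ k) x := by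
  rw [pd_sum fun k _ => (differentiableAt_coord k x).fun_smul (hζ k)]
  simp only [pd_smul (differentiableAt_coord _ x) (hζ _), pd_coord, Finset.sum_add_distrib]
  rw [add_comm]
  simp

/-- The consequences at the first order of the vanishing of the radial component of a one-form. -/
theorem radial_gauge_add {ζ : Fin n → E n → F}
    (hζ : ∀ k, ContDiffOn ℝ ∞ (ζ k) (Metric.ball 0 r))
    (h : ∀ x ∈ Metric.ball (0 : E n) r, ∑ k, x k • ζ k x = 0) (j : Fin n) {x : E n}
    (hx : x ∈ Metric.ball (0 : E n) r) : ζ j x + ∑ k, x k • pd j (ζ k) x = 0 := by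
  rw [← pd_sum_coord_smul fun k => differentiableAt_of_contDiffOn Metric.isOpen_ball (hζ k) hx]
  rw [pd_eqOn (g := fun _ => 0) Metric.isOpen_ball h j hx, pd_const]; rfl

/-- Differentiate ∑ x^k ζ_k = 0 and set x = 0: only the derivative that falls on the coordinate
survives. -/
theorem radial_gauge_zero (hr : 0 < r) {ζ : Fin n → E n → F}
    (hζ : ∀ k, ContDiffOn ℝ ∞ (ζ k) (Metric.ball 0 r))
    (h : ∀ x ∈ Metric.ball (0 : E n) r, ∑ k, x k • ζ k x = 0) (j : Fin n) : ζ j 0 = 0 := by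
  simpa using radial_gauge_add hζ h j (Metric.mem_ball_self hr)

/-- The second derivative of ∑ x^k ζ_k = 0 at the origin: one of the two derivatives must fall on
the coordinate, which leaves the two terms shown. -/
theorem radial_gauge_pd_zero (hr : 0 < r) {ζ : Fin n → E n → F}
    (hζ : ∀ k, ContDiffOn ℝ ∞ (ζ k) (Metric.ball 0 r))
    (h : ∀ x ∈ Metric.ball (0 : E n) r, ∑ k, x k • ζ k x = 0) (i j : Fin n) :
    pd i (ζ j) 0 + pd j (ζ i) 0 = 0 := by
  have h0 : (0 : E n) ∈ Metric.ball (0 : E n) r := Metric.mem_ball_self hr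
  have hp := fun k => contDiffOn_pd Metric.isOpen_ball (hζ k) j
  have hd : ∀ k, DifferentiableAt ℝ (pd j (ζ k)) (0 : E n) := fun k =>
    differentiableAt_of_contDiffOn Metric.isOpen_ball (hp k) h0
  have h1 : pd i (fun x => ζ j x + ∑ k, x k • pd j (ζ k) x) 0 = 0 := by
    rw [pd_eqOn (g := fun _ => 0) Metric.isOpen_ball (fun x hx => radial_gauge_add hζ h j hx) i h0,
      pd_const]
    rfl
  rw [pd_add (differentiableAt_of_contDiffOn Metric.isOpen_ball (hζ j) h0)
    (DifferentiableAt.fun_sum fun k _ => (differentiableAt_coord k 0).fun_smul (hd k)),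
    pd_sum_coord_smul hd] at h1
  simpa using h1

/-- A closed one-form whose radial component vanishes is zero. -/
theorem closed_radial_gauge_eq_zero {ζ : Fin n → E n → F}
    (hζ : ∀ k, ContDiffOn ℝ ∞ (ζ k) (Metric.ball 0 r))
    (h : ∀ x ∈ Metric.ball (0 : E n) r, ∑ k, x k • ζ k x = 0)
    (hc : ∀ x ∈ Metric.ball (0 : E n) r, ∀ i j, pd i (ζ j) x = pd j (ζ i) x) (j : Fin n) {x : E n}
    (hx : x ∈ Metric.ball (0 : E n) r) : ζ j x = 0 := by
  -- As in the Poincaré lemma: the derivative of t ζ_j(tx) is ζ_j + ∑ (tx)^k ∂_k ζ_j. Closedness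
  -- turns ∂_k ζ_j into ∂_j ζ_k, and the differentiated gauge condition makes the sum zero; the
  -- function vanishes at t = 0.
  have hd : ∀ t ∈ Icc (0 : ℝ) 1, HasDerivAt (fun s : ℝ => s • ζ j (s • x)) 0 t := by
    intro t ht
    have hm := smul_mem_ball_of_mem_Icc hx ht
    have h1 := (hasDerivAt_id' t).fun_smul
      (hasDerivAt_comp_smul (differentiableAt_of_contDiffOn Metric.isOpen_ball (hζ j) hm))
    convert h1 using 1
    have h2 := radial_gauge_add hζ h j hm
    simp only [PiLp.smul_apply, smul_eq_mul, mul_smul, ← Finset.smul_sum, hc _ hm j] at h2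
    simpa [add_comm] using h2.symm
  have := constant_of_has_deriv_right_zero (f := fun s : ℝ => s • ζ j (s • x)) (a := 0) (b := 1)
    (fun t ht => (hd t ht).continuousAt.continuousWithinAt)
    (fun t ht => (hd t ⟨ht.1, ht.2.le⟩).hasDerivWithinAt) 1 (by simp)
  simpa using this

end Radial

/-! ### The connection coefficients of a radially parallel frame -/

section RadialFrame

variable {n : ℕ} {r : ℝ}

/-- A frame on a ball which is parallel along the rays from the origin, and equal there to the
standard basis. -/
structure IsRadialFrame (r : ℝ) (b : Fin n → Fin n → E n → ℝ)
    (θ : Fin n → Fin n → Fin n → E n → ℝ) : Prop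
    extends IsLeviCivitaFrame (Metric.ball 0 r) b θ where
  radius_pos : 0 < r
  frame_zero : ∀ i j, b i j 0 = if i = j then 1 else 0
  radial : ∀ x ∈ Metric.ball (0 : E n) r, ∀ s t,
    ∑ k, x k * ∑ l, (Matrix.of fun i j => b i j x)⁻¹ k l * θ l s t x = 0

variable {b : Fin n → Fin n → E n → ℝ} {θ : Fin n → Fin n → Fin n → E n → ℝ}

namespace IsRadialFrame

theorem zero_mem (h : IsRadialFrame r b θ) : (0 : E n) ∈ Metric.ball (0 : E n) r :=
  Metric.mem_ball_self h.radius_pos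

/-- The coefficients of the connection along the coordinate vector fields. -/
def coordCoeff (b : Fin n → Fin n → E n → ℝ) (θ : Fin n → Fin n → Fin n → E n → ℝ)
    (s t k : Fin n) (x : E n) : ℝ :=
  ∑ l, (Matrix.of fun i j => b i j x)⁻¹ k l * θ l s t x

theorem contDiffOn_coordCoeff (h : IsRadialFrame r b θ) (s t k : Fin n) :
    ContDiffOn ℝ ∞ (coordCoeff b θ s t k) (Metric.ball 0 r) :=
  ContDiffOn.sum fun l _ =>
    (contDiffOn_matrix_inv (M := fun x => Matrix.of fun i j => b i j x) h.smooth_frame h.isUnit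
      k l).mul (h.smooth_coeff l s t)

theorem coeff_eq (h : IsRadialFrame r b θ) (l s t : Fin n) {x : E n}
    (hx : x ∈ Metric.ball (0 : E n) r) :
    θ l s t x = ∑ k, b l k x * coordCoeff b θ s t k x := by
  have h1 : (Matrix.of fun i j => b i j x) * (Matrix.of fun i j => b i j x)⁻¹ = 1 :=
    Matrix.mul_nonsing_inv _ ((Matrix.isUnit_iff_isUnit_det _).1 (h.isUnit x hx))
  have h2 : ∀ m, ∑ k, b l k x * (Matrix.of fun i j => b i j x)⁻¹ k m = if l = m then 1 else 0 :=
    fun m => by simpa [Matrix.mul_apply, Matrix.one_apply] using congrFun (congrFun h1 l) m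
  simp only [coordCoeff, Finset.mul_sum, ← mul_assoc]
  rw [Finset.sum_comm]
  simp [← Finset.sum_mul, h2]

theorem coordCoeff_zero (h : IsRadialFrame r b θ) (s t k : Fin n) : coordCoeff b θ s t k 0 = 0 :=
  radial_gauge_zero h.radius_pos (h.contDiffOn_coordCoeff s t) (fun x hx => h.radial x hx s t) k

theorem coeff_zero (h : IsRadialFrame r b θ) (l s t : Fin n) : θ l s t 0 = 0 := by
  rw [h.coeff_eq l s t h.zero_mem]
  simp [h.coordCoeff_zero]

/-- The coordinate coefficients vanish at the origin and the frame is the standard basis there, so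
to first order frame indices and coordinate indices may be interchanged. -/
theorem pd_coeff_zero (h : IsRadialFrame r b θ) (j l s t : Fin n) :
    pd j (θ l s t) 0 = pd j (coordCoeff b θ s t l) 0 := by
  have hb := fun k => differentiableAt_of_contDiffOn h.isOpen (h.smooth_frame l k) h.zero_mem
  have hc := fun k => differentiableAt_of_contDiffOn h.isOpen (h.contDiffOn_coordCoeff s t k)
    h.zero_mem
  rw [pd_eqOn h.isOpen (fun x hx => h.coeff_eq l s t hx) j h.zero_mem,
    pd_sum fun k _ => (hb k).fun_mul (hc k)]
  simp [pd_mul (hb _) (hc _), h.coordCoeff_zero, h.frame_zero]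

theorem pd_coeff_zero_antisymm (h : IsRadialFrame r b θ) (i j s t : Fin n) :
    pd i (θ j s t) 0 = -pd j (θ i s t) 0 := by
  rw [h.pd_coeff_zero, h.pd_coeff_zero, eq_neg_iff_add_eq_zero]
  exact radial_gauge_pd_zero h.radius_pos (h.contDiffOn_coordCoeff s t)
    (fun x hx => h.radial x hx s t) i j

theorem frameDeriv_zero {F : Type*} [NormedAddCommGroup F] [NormedSpace ℝ F]
    (h : IsRadialFrame r b θ) (f : E n → F) (i : Fin n) : frameDeriv b i f 0 = pd i f 0 := by
  simp [frameDeriv, h.frame_zero]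

/-- At the origin the terms quadratic in θ vanish, and the two derivatives of θ are opposite by the
radial gauge, so they add. This is the source of the factor ½ between the curvature and the linear
part of the connection. -/
theorem frameCurvature_zero (h : IsRadialFrame r b θ) (i j s t : Fin n) :
    frameCurvature b θ i j s t 0 = -2 * pd j (θ i s t) 0 := by
  simp only [frameCurvature, h.frameDeriv_zero, h.coeff_zero]
  rw [h.pd_coeff_zero_antisymm i j]
  simp
  ring

theorem pd_coeff (h : IsRadialFrame r b θ) (i j s t : Fin n) :
    pd j (θ i s t) 0 = -(1 / 2) * frameCurvature b θ i j s t 0 := by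
  rw [h.frameCurvature_zero]
  ring

end IsRadialFrame

theorem frameCurvature_self (b : Fin n → Fin n → E n → ℝ) (θ : Fin n → Fin n → Fin n → E n → ℝ)
    (i s t : Fin n) (x : E n) : frameCurvature b θ i i s t x = 0 := by
  simp [frameCurvature]

end RadialFrame


/-! ### The rescaled square of the Dirac operator -/

section RescaledDirac

variable {n N : ℕ} {r : ℝ} {b : Fin n → Fin n → E n → ℝ} {θ : Fin n → Fin n → Fin n → E n → ℝ}

/-- The coefficients of the rescaled square of the Dirac operator. -/
def rescaledDiracSquare (b : Fin n → Fin n → E n → ℝ) (θ : Fin n → Fin n → Fin n → E n → ℝ)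
    (lam : ℝ) : Coeffs n (Finset (Fin n)) :=
  cliffordCoeffs (fun s => rescaledClifford s lam) (fun j k x => coeffTwo b j k (lam • x))
    (fun k x => lam * coeffOne b θ k (lam • x))
    (fun k s t x => (lam : ℂ)⁻¹ * coeffOneClifford b θ k s t (lam • x))
    (fun x => (lam : ℂ) ^ 2 * coeffZero b θ (lam • x))
    (fun s t x => coeffZeroClifford b θ s t (lam • x))
    (fun s t p q x => ((lam : ℂ) ^ 2)⁻¹ * coeffZeroCliffordTwo θ s t p q (lam • x))

theorem getzlerConj_act_mul_act_mul (κ : SpinorModule n N) {lam : ℝ} (h : lam ≠ 0)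
    (s t p q : Fin n) :
    getzlerConj lam (cliffordMapC n (κ.symm
      ((κ.act (clGen s) * κ.act (clGen t)) * (κ.act (clGen p) * κ.act (clGen q))))) =
      ((lam : ℂ) ^ 4)⁻¹ • ((rescaledClifford s lam * rescaledClifford t lam) *
        (rescaledClifford p lam * rescaledClifford q lam)) := by
  rw [map_mul κ.symm, map_mul (cliffordMapC n), getzlerConj_mul h, getzlerConj_act_mul κ h,
    getzlerConj_act_mul κ h, Matrix.smul_mul, Matrix.mul_smul, smul_smul]
  congr 1
  rw [← mul_inv, ← pow_add]

/-- The linear map `A ↦ U_λ c(A) U_λ⁻¹`. -/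
def rescaleLin (κ : SpinorModule n N) (lam : ℝ) : Matrix (Fin N) (Fin N) ℂ →ₗ[ℂ] ExtMat n :=
  getzlerConjLin n lam ∘ₗ (cliffordMapC n).toLinearMap ∘ₗ κ.symm.toLinearMap

/-- Here the powers of λ are counted: λ² from the definition, λ⁻¹ for each of the |γ| derivatives by
undoing the dilation, λ⁻¹ for each Clifford generator. -/
theorem rescaledDiracSquare_eq (κ : SpinorModule n N) {lam : ℝ} (h : lam ≠ 0) (γ : Fin n → ℕ)
    (x : E n) :
    rescaledDiracSquare b θ lam γ x = ((lam : ℂ)⁻¹ ^ (∑ i, γ i) * (lam : ℂ) ^ 2) •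
      getzlerConj lam (cliffordMapC n (κ.symm (diracSquare b θ κ γ (lam • x)))) := by
  have h' : (lam : ℂ) ≠ 0 := by exact_mod_cast h
  have h1 : rescaleLin κ lam 1 = 1 := by
    change getzlerConj lam (cliffordMapC n (κ.symm 1)) = 1
    rw [map_one, map_one, getzlerConj_one h]
  have h2 : ∀ s t, rescaleLin κ lam (κ.act (clGen s) * κ.act (clGen t)) =
      ((lam : ℂ) ^ 2)⁻¹ • (rescaledClifford s lam * rescaledClifford t lam) :=
    fun s t => getzlerConj_act_mul κ h s t
  have h4 : ∀ s t p q, rescaleLin κ lam ((κ.act (clGen s) * κ.act (clGen t)) *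
      (κ.act (clGen p) * κ.act (clGen q))) = ((lam : ℂ) ^ 4)⁻¹ •
        ((rescaledClifford s lam * rescaledClifford t lam) *
          (rescaledClifford p lam * rescaledClifford q lam)) :=
    fun s t p q => getzlerConj_act_mul_act_mul κ h s t p q
  -- Under the indicator δ = γ the exponent |γ| becomes the explicit number |δ|, so each term can be
  -- compared by itself.
  have hite : ∀ (δ : Fin n → ℕ) (M : Matrix (Fin N) (Fin N) ℂ) (M' : ExtMat n),
      ((lam : ℂ)⁻¹ ^ (∑ i, δ i) * (lam : ℂ) ^ 2) • rescaleLin κ lam M = M' →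
      ((lam : ℂ)⁻¹ ^ (∑ i, γ i) * (lam : ℂ) ^ 2) • rescaleLin κ lam (if δ = γ then M else 0) =
        if δ = γ then M' else 0 := by
    intro δ M M' hM
    split_ifs with hδ
    · rw [← hδ, hM]
    · simp
  change _ = _ • rescaleLin κ lam (diracSquare b θ κ γ (lam • x))
  -- From here on only complex linearity matters, together with the values on 1 and on products of
  -- two and of four generators.
  generalize rescaleLin κ lam = Φ at *
  simp only [rescaledDiracSquare, diracSquare, cliffordCoeffs, secondOrderCoeffs, map_add, map_sum,
    smul_add, Finset.smul_sum]
  refine congrArg₂ (· + ·) (congrArg₂ (· + ·) ?_ ?_) ?_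
  · refine Finset.sum_congr rfl fun j _ => Finset.sum_congr rfl fun k _ => (hite _ _ _ ?_).symm
    rw [map_smul, h1, smul_smul]
    refine congrArg (· • (1 : ExtMat n)) ?_
    simp only [Pi.add_apply, Finset.sum_add_distrib, Finset.sum_pi_single', Finset.mem_univ,
      if_true, one_add_one_eq_two]
    field_simp
  · refine Finset.sum_congr rfl fun k _ => (hite _ _ _ ?_).symm
    simp only [map_add, map_sum, map_smul, h1, h2, smul_add, Finset.smul_sum, smul_smul,
      Finset.sum_pi_single', Finset.mem_univ, if_true]
    refine congrArg₂ (· + ·) (congrArg (· • (1 : ExtMat n)) ?_)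
      (Finset.sum_congr rfl fun s _ => Finset.sum_congr rfl fun t _ =>
        congrArg (· • (rescaledClifford s lam * rescaledClifford t lam)) ?_)
    · field_simp
    · field_simp
  · refine (hite _ _ _ ?_).symm
    simp only [map_add, map_sum, map_smul, h1, h2, h4, smul_add, Finset.smul_sum, smul_smul,
      Pi.zero_apply, Finset.sum_const_zero]
    refine congrArg₂ (· + ·) (congrArg₂ (· + ·) (congrArg (· • (1 : ExtMat n)) ?_)
      (Finset.sum_congr rfl fun s _ => Finset.sum_congr rfl fun t _ =>
        congrArg (· • (rescaledClifford s lam * rescaledClifford t lam)) ?_))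
      (Finset.sum_congr rfl fun s _ => Finset.sum_congr rfl fun t _ =>
        Finset.sum_congr rfl fun p _ => Finset.sum_congr rfl fun q _ =>
        congrArg (· • ((rescaledClifford s lam * rescaledClifford t lam) *
          (rescaledClifford p lam * rescaledClifford q lam))) ?_)
    · simp
    · field_simp
    · field_simp

theorem getzlerRescale_diracSquare (κ : SpinorModule n N) {lam : ℝ} (h : lam ≠ 0)
    (u : E n → Finset (Fin n) → ℂ) (x : E n) :
    getzlerRescale κ 2 (diracSquare b θ κ) lam u x =
      evalOp 2 (rescaledDiracSquare b θ lam) u x := by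
  simp only [getzlerRescale, evalOp]
  refine Finset.sum_congr rfl fun γ _ => ?_
  rw [pdPow_comp_smul, rescaledDiracSquare_eq κ h]
  beta_reduce
  rw [smul_smul, inv_mul_cancel₀ h, one_smul,
    ← Complex.coe_smul, Matrix.mulVec_smul, Matrix.smul_mulVec, Matrix.smul_mulVec, smul_smul]
  push_cast
  rfl

/-- The coefficients of the limit of the rescaled operators. -/
def limitDiracSquare (R : Fin n → Fin n → Fin n → Fin n → ℝ) : Coeffs n (Finset (Fin n)) :=
  cliffordCoeffs wedge (fun j k _ => if j = k then -1 else 0) (fun _ _ => 0)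
    (fun k s t x => (1 / 4) * ∑ q, ((R k q s t * x q : ℝ) : ℂ)) (fun _ => 0) (fun _ _ _ => 0)
    (fun s t p q x => -(1 / 64) * ∑ i, (∑ j, ((R i j s t * x j : ℝ) : ℂ)) *
      ∑ j, ((R i j p q * x j : ℝ) : ℂ))

theorem continuous_rescaledClifford (s : Fin n) :
    Continuous fun lam : ℝ => rescaledClifford s lam :=
  continuous_const.sub (((Complex.continuous_ofReal).pow 2).smul continuous_const)

namespace SmoothConverges

variable {V : Set (E n)}

theorem of_continuous {c : ℝ → ℂ} (hc : Continuous c) :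
    SmoothConverges V (fun lam _ => c lam) (fun _ => c 0) :=
  of_tendsto (hc.tendsto 0 |>.mono_left nhdsWithin_le_nhds)

theorem ite {p : Prop} [Decidable p] {f : ℝ → E n → ℂ} {f₀ : E n → ℂ}
    (hf : SmoothConverges V f f₀) :
    SmoothConverges V (fun lam x => if p then f lam x else 0) (fun x => if p then f₀ x else 0) := by
  by_cases h : p
  · simpa [h] using hf
  · simpa [h] using const 0

/-- The matrices and the scalar coefficients both vary with λ and may be treated separately, since
every entry is a finite sum of products of one entry of each kind. -/
theorem cliffordCoeffs (hV : IsOpen V) {ι : Type} [Fintype ι] [DecidableEq ι]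
    {W : ℝ → Fin n → Matrix ι ι ℂ} {W₀ : Fin n → Matrix ι ι ℂ}
    {c₂ : ℝ → Fin n → Fin n → E n → ℂ} {c₁ : ℝ → Fin n → E n → ℂ}
    {d₁ : ℝ → Fin n → Fin n → Fin n → E n → ℂ} {c₀ : ℝ → E n → ℂ}
    {d₀ : ℝ → Fin n → Fin n → E n → ℂ}
    {f₀ : ℝ → Fin n → Fin n → Fin n → Fin n → E n → ℂ}
    {l₂ : Fin n → Fin n → E n → ℂ} {l₁ : Fin n → E n → ℂ}
    {m₁ : Fin n → Fin n → Fin n → E n → ℂ} {l₀ : E n → ℂ} {m₀ : Fin n → Fin n → E n → ℂ}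
    {o₀ : Fin n → Fin n → Fin n → Fin n → E n → ℂ}
    (hW : ∀ s, Continuous fun lam => W lam s) (hW₀ : ∀ s, W 0 s = W₀ s)
    (h₂ : ∀ j k, SmoothConverges V (fun lam => c₂ lam j k) (l₂ j k))
    (h₁ : ∀ k, SmoothConverges V (fun lam => c₁ lam k) (l₁ k))
    (h₁' : ∀ k s t, SmoothConverges V (fun lam => d₁ lam k s t) (m₁ k s t))
    (h₀ : SmoothConverges V c₀ l₀)
    (h₀' : ∀ s t, SmoothConverges V (fun lam => d₀ lam s t) (m₀ s t))
    (h₀'' : ∀ s t p q, SmoothConverges V (fun lam => f₀ lam s t p q) (o₀ s t p q))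
    (γ : Fin n → ℕ) (I J : ι) :
    SmoothConverges V (fun lam x => Getzler.cliffordCoeffs (W lam) (c₂ lam) (c₁ lam) (d₁ lam)
      (c₀ lam) (d₀ lam) (f₀ lam) γ x I J)
      (fun x => Getzler.cliffordCoeffs W₀ l₂ l₁ m₁ l₀ m₀ o₀ γ x I J) := by
  have ite_app : ∀ (p : Prop) [Decidable p] (M : Matrix ι ι ℂ),
      (if p then M else 0) I J = if p then M I J else 0 := by
    intro p _ M
    split_ifs <;> rfl
  have hone : SmoothConverges V (fun _ _ => (1 : Matrix ι ι ℂ) I J) fun _ => (1 : Matrix ι ι ℂ) I J :=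
    const _
  have htwo : ∀ s t, SmoothConverges V (fun lam _ => (W lam s * W lam t) I J)
      fun _ => (W₀ s * W₀ t) I J := fun s t => by
    simpa only [hW₀] using of_continuous (V := V) (((hW s).matrix_mul (hW t)).matrix_elem I J)
  have hfour : ∀ s t p q,
      SmoothConverges V (fun lam _ => ((W lam s * W lam t) * (W lam p * W lam q)) I J)
      fun _ => ((W₀ s * W₀ t) * (W₀ p * W₀ q)) I J := fun s t p q => by
    simpa only [hW₀] using of_continuous (V := V)
      ((((hW s).matrix_mul (hW t)).matrix_mul ((hW p).matrix_mul (hW q))).matrix_elem I J)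
  simp only [Getzler.cliffordCoeffs, secondOrderCoeffs, Matrix.add_apply, Matrix.sum_apply, ite_app,
    Matrix.smul_apply, smul_eq_mul]
  refine ((SmoothConverges.sum hV _ fun j _ => SmoothConverges.sum hV _ fun k _ =>
      ((h₂ j k).mul hV hone).ite).add hV
    (SmoothConverges.sum hV _ fun k _ => (((h₁ k).mul hV hone).add hV
      (SmoothConverges.sum hV _ fun s _ => SmoothConverges.sum hV _ fun t _ =>
      (h₁' k s t).mul hV (htwo s t))).ite)).add hV (ite ?_)
  exact ((h₀.mul hV hone).add hV (SmoothConverges.sum hV _ fun s _ =>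
      SmoothConverges.sum hV _ fun t _ => (h₀' s t).mul hV (htwo s t))).add hV
    (SmoothConverges.sum hV _ fun s _ => SmoothConverges.sum hV _ fun t _ =>
      SmoothConverges.sum hV _ fun p _ => SmoothConverges.sum hV _ fun q _ =>
        (h₀'' s t p q).mul hV (hfour s t p q))

end SmoothConverges

/-- Since θ vanishes at the origin, division by λ extracts its linear part, which the radial gauge
identifies with -½ R_ijst x^j. -/
theorem IsRadialFrame.smoothConverges_coeff (h : IsRadialFrame r b θ) (i s t : Fin n) :
    SmoothConverges (Metric.ball 0 r) (fun lam x => (lam : ℂ)⁻¹ * θ i s t (lam • x))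
      (fun x => -(1 / 2) * ∑ j, ((frameCurvature b θ i j s t 0 * x j : ℝ) : ℂ)) := by
  refine (smoothConverges_inv_smul_comp_smul h.radius_pos
    (contDiffOn_ofReal (h.smooth_coeff i s t)) (by simp [h.coeff_zero])).congr h.isOpen
    (fun _ _ _ _ => rfl) fun x _ => ?_
  simp only [Finset.mul_sum]
  refine Finset.sum_congr rfl fun j _ => ?_
  rw [pd_ofReal (differentiableAt_of_contDiffOn h.isOpen (h.smooth_coeff i s t) h.zero_mem),
    h.pd_coeff]
  push_cast
  ring

theorem IsRadialFrame.smoothConverges_comp_smul (h : IsRadialFrame r b θ) {f : E n → ℝ}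
    (hf : ContDiffOn ℝ ∞ f (Metric.ball 0 r)) :
    SmoothConverges (Metric.ball 0 r) (fun lam x => (f (lam • x) : ℂ)) (fun _ => (f 0 : ℂ)) :=
  Getzler.smoothConverges_comp_smul h.radius_pos (contDiffOn_ofReal hf)

/-- Three mechanisms are at work. Coefficients without a power of λ tend to their value at the
origin; those with a positive power tend to zero, among them the scalar curvature; each negative
power is absorbed by a factor θ. -/
theorem IsRadialFrame.smoothConverges_rescaledDiracSquare (h : IsRadialFrame r b θ)
    (γ : Fin n → ℕ) (I J : Finset (Fin n)) :
    SmoothConverges (Metric.ball 0 r) (fun lam x => rescaledDiracSquare b θ lam γ x I J)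
      (fun x => limitDiracSquare (fun i j s t => frameCurvature b θ i j s t 0) γ x I J) := by
  have hV := h.isOpen
  have hlam : ∀ k : ℕ, k ≠ 0 → SmoothConverges (Metric.ball (0 : E n) r)
      (fun lam _ => (lam : ℂ) ^ k) (fun _ => 0) := fun k hk => by
    simpa [hk] using SmoothConverges.of_continuous (V := Metric.ball (0 : E n) r)
      (c := fun lam : ℝ => (lam : ℂ) ^ k) (Complex.continuous_ofReal.pow k)
  refine SmoothConverges.cliffordCoeffs hV continuous_rescaledClifford rescaledClifford_zero
    ?_ ?_ ?_ ?_ ?_ ?_ γ I J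
  · intro j k
    refine (h.smoothConverges_comp_smul (h.contDiffOn_coeffTwo j k)).congr hV
      (fun _ _ _ _ => rfl) fun x _ => ?_
    simp only [coeffTwo, h.frame_zero]
    simp [apply_ite, eq_comm]
  · intro k
    refine ((hlam 1 one_ne_zero).mul hV
      (h.smoothConverges_comp_smul (h.contDiffOn_coeffOne k))).congr hV
      (fun _ _ _ _ => by simp) fun x _ => ?_
    simp
  -- The factor λ⁻¹ goes with θ, and b tends to the identity; the constant is -½ · (-½) = ¼.
  · intro k s t
    refine ((SmoothConverges.const (-(1 / 2) : ℂ)).mul hV (SmoothConverges.sum hV Finset.univ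
      fun i _ => (h.smoothConverges_comp_smul (h.smooth_frame i k)).mul hV
        (h.smoothConverges_coeff i s t))).congr hV (fun lam _ x _ => ?_) fun x _ => ?_
    · simp only [coeffOneClifford]
      push_cast
      simp only [Finset.mul_sum]
      refine Finset.sum_congr rfl fun i _ => ?_
      ring
    · have e : ∀ i, ((b i k 0 : ℝ) : ℂ) = if i = k then 1 else 0 := fun i => by
        rw [h.frame_zero]
        split_ifs <;> simp
      simp only [e, ite_mul, one_mul, zero_mul, Finset.sum_ite_eq', Finset.mem_univ, if_true]
      ring
  · refine ((hlam 2 two_ne_zero).mul hV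
      (h.smoothConverges_comp_smul h.contDiffOn_coeffZero)).congr hV
      (fun _ _ _ _ => rfl) fun x _ => ?_
    simp
  -- The balanced term: its value at the origin is a multiple of ∑ ∂_i θ_ist(0), that is of ∑
  -- R_iist, which is zero.
  · intro s t
    refine (h.smoothConverges_comp_smul (h.contDiffOn_coeffZeroClifford s t)).congr hV
      (fun _ _ _ _ => rfl) fun x _ => ?_
    simp [coeffZeroClifford, h.frameDeriv_zero, h.coeff_zero, h.pd_coeff, frameCurvature_self]
  -- The factor λ⁻² is shared between the two θ; the constant is -1/16 · (-½)² = -1/64.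
  · intro s t p q
    refine ((SmoothConverges.const (-(1 / 16) : ℂ)).mul hV (SmoothConverges.sum hV Finset.univ
      fun i _ => (h.smoothConverges_coeff i s t).mul hV
        (h.smoothConverges_coeff i p q))).congr hV (fun lam _ x _ => ?_) fun x _ => ?_
    · simp only [coeffZeroCliffordTwo]
      push_cast
      simp only [Finset.mul_sum]
      refine Finset.sum_congr rfl fun i _ => ?_
      ring
    · simp only [Finset.mul_sum (s := Finset.univ) (a := (-(1 / 16) : ℂ)),
        Finset.mul_sum (s := Finset.univ) (a := (-(1 / 64) : ℂ))]
      refine Finset.sum_congr rfl fun i _ => ?_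
      ring

theorem IsRadialFrame.smoothCoeffs_rescaledDiracSquare (h : IsRadialFrame r b θ) {lam : ℝ}
    (hlam : lam ∈ Ioo (0 : ℝ) 1) : SmoothCoeffs (Metric.ball 0 r) 2 (rescaledDiracSquare b θ lam) :=
  fun γ _ I J => (h.smoothConverges_rescaledDiracSquare γ I J).smooth lam hlam

theorem IsRadialFrame.smoothCoeffs_limitDiracSquare (h : IsRadialFrame r b θ) :
    SmoothCoeffs (Metric.ball 0 r) 2
      (limitDiracSquare fun i j s t => frameCurvature b θ i j s t 0) :=
  fun γ _ I J => (h.smoothConverges_rescaledDiracSquare γ I J).smooth_limit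

/-- The endomorphism `(1/8) ∑ R_ijst x^j eˢ ∧ eᵗ ∧`. -/
def modelPotential (R : Fin n → Fin n → Fin n → Fin n → ℝ) (i : Fin n) (x : E n) : ExtMat n :=
  ∑ s, ∑ t, ((1 / 8 : ℂ) * ∑ j, ((R i j s t * x j : ℝ) : ℂ)) • (wedge s * wedge t)

theorem modelDeriv_eq (R : Fin n → Fin n → Fin n → Fin n → ℝ) (i : Fin n)
    (u : E n → Finset (Fin n) → ℂ) (x : E n) :
    modelDeriv R i u x = pd i u x - modelPotential R i x *ᵥ u x := by
  simp only [modelDeriv, modelPotential, Matrix.sum_mulVec, Matrix.smul_mulVec, Finset.smul_sum,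
    Finset.mul_sum, Finset.sum_smul, smul_smul]
  congr 1
  exact sum_rotate_three fun j s t =>
    ((1 / 8 : ℂ) * ((R i j s t * x j : ℝ) : ℂ)) • ((wedge s * wedge t) *ᵥ u x)

/-- The coefficient of x^i in the i-th potential is R_iist = 0, so ∂_i commutes with the potential
and squaring creates no derivative of it. -/
theorem pd_modelPotential_mulVec {R : Fin n → Fin n → Fin n → Fin n → ℝ}
    (hR : ∀ i s t, R i i s t = 0) (i : Fin n) {v : E n → Finset (Fin n) → ℂ} {x : E n}
    (hv : DifferentiableAt ℝ v x) :
    pd i (fun y => modelPotential R i y *ᵥ v y) x = modelPotential R i x *ᵥ pd i v x := by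
  have hc : ∀ s t, DifferentiableAt ℝ
      (fun y : E n => (1 / 8 : ℝ) * ∑ j, R i j s t * y j) x := fun s t =>
    (DifferentiableAt.fun_sum fun j _ => (differentiableAt_coord j x).const_mul _).const_mul _
  have hc' : ∀ s t, pd i (fun y : E n => (1 / 8 : ℝ) * ∑ j, R i j s t * y j) x = 0 := by
    intro s t
    rw [pd_mul (differentiableAt_const _)
      (DifferentiableAt.fun_sum fun j _ => (differentiableAt_coord j x).const_mul _),
      pd_sum fun j _ => (differentiableAt_coord j x).const_mul _]
    simp [pd_mul (differentiableAt_const _) (differentiableAt_coord _ x), pd_coord, hR]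
  let L : Fin n → Fin n → (Finset (Fin n) → ℂ) →L[ℝ] (Finset (Fin n) → ℂ) := fun s t =>
    LinearMap.toContinuousLinearMap ((Matrix.mulVecLin (wedge s * wedge t)).restrictScalars ℝ)
  have e : ∀ (w : Finset (Fin n) → ℂ) (y : E n), modelPotential R i y *ᵥ w =
      ∑ s, ∑ t, ((1 / 8 : ℝ) * ∑ j, R i j s t * y j) • L s t w := by
    intro w y
    simp only [modelPotential, Matrix.sum_mulVec, Matrix.smul_mulVec]
    refine Finset.sum_congr rfl fun s _ => Finset.sum_congr rfl fun t _ => ?_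
    rw [← Complex.coe_smul]
    push_cast
    rfl
  have hL : ∀ s t, DifferentiableAt ℝ (fun y => L s t (v y)) x := fun s t =>
    (L s t).differentiableAt.comp x hv
  simp only [e]
  rw [pd_sum fun s _ => DifferentiableAt.fun_sum fun t _ => (hc s t).fun_smul (hL s t)]
  refine Finset.sum_congr rfl fun s _ => ?_
  rw [pd_sum fun t _ => (hc s t).fun_smul (hL s t)]
  refine Finset.sum_congr rfl fun t _ => ?_
  rw [pd_smul (hc s t) (hL s t), hc', zero_smul, add_zero, pd_clm (L s t) hv]

theorem differentiableAt_modelPotential_mulVec (R : Fin n → Fin n → Fin n → Fin n → ℝ)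
    (i : Fin n) {v : E n → Finset (Fin n) → ℂ} {x : E n} (hv : DifferentiableAt ℝ v x) :
    DifferentiableAt ℝ (fun y => modelPotential R i y *ᵥ v y) x := by
  have hc : ∀ j, DifferentiableAt ℝ (fun y : E n => ((y j : ℝ) : ℂ)) x := fun j =>
    (contDiff_ofReal_coord j).differentiable (by simp) x
  rw [differentiableAt_pi] at hv ⊢
  intro I
  simp only [modelPotential, Matrix.mulVec, dotProduct, Complex.ofReal_mul, Matrix.sum_apply,
    Matrix.smul_apply, smul_eq_mul]
  exact DifferentiableAt.fun_sum fun K _ => (DifferentiableAt.fun_sum fun s _ =>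
    DifferentiableAt.fun_sum fun t _ => (((DifferentiableAt.fun_sum fun j _ =>
      (hc j).const_mul _).const_mul _).mul_const _)).fun_mul (hv K)

/-- With A_i the potential and [∂_i, A_i] = 0, each square gives -(∂_i - A_i)² = -∂_i² + 2 A_i ∂_i -
A_i². The constants are 2/8 = ¼ and 1/8² = 1/64, as in the limit of the rescaled operators. -/
theorem modelOp_eq_evalOp {V : Set (E n)} (hV : IsOpen V) {R : Fin n → Fin n → Fin n → Fin n → ℝ}
    (hR : ∀ i s t, R i i s t = 0) {u : E n → Finset (Fin n) → ℂ} (hu : ContDiffOn ℝ ∞ u V)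
    {x : E n} (hx : x ∈ V) : modelOp R u x = evalOp 2 (limitDiracSquare R) u x := by
  have hd := differentiableAt_of_contDiffOn hV hu hx
  have hd' : ∀ i, DifferentiableAt ℝ (pd i u) x := fun i =>
    differentiableAt_of_contDiffOn hV (contDiffOn_pd hV hu i) hx
  have h1 : ∀ i, modelDeriv R i (modelDeriv R i u) x = pd i (pd i u) x -
      (2 : ℂ) • (modelPotential R i x *ᵥ pd i u x) +
        modelPotential R i x *ᵥ (modelPotential R i x *ᵥ u x) := by
    intro i
    have e : modelDeriv R i u = fun y => pd i u y - modelPotential R i y *ᵥ u y :=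
      funext fun y => modelDeriv_eq R i u y
    rw [modelDeriv_eq, e, pd_sub (hd' i) (differentiableAt_modelPotential_mulVec R i hd),
      pd_modelPotential_mulVec hR i hd, Matrix.mulVec_sub, two_smul]
    abel
  have h2 : ∀ (i : Fin n) (w : Finset (Fin n) → ℂ),
      (2 : ℂ) • (modelPotential R i x *ᵥ w) = ∑ s, ∑ t,
        ((1 / 4 : ℂ) * ∑ q, ((R i q s t * x q : ℝ) : ℂ)) • (wedge s *ᵥ (wedge t *ᵥ w)) := by
    intro i w
    simp only [modelPotential, Matrix.sum_mulVec, Matrix.smul_mulVec, Finset.smul_sum,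
      Matrix.mulVec_mulVec, smul_smul]
    refine Finset.sum_congr rfl fun s _ => Finset.sum_congr rfl fun t _ => ?_
    congr 1
    ring
  have h3 : ∀ i, modelPotential R i x *ᵥ (modelPotential R i x *ᵥ u x) =
      ∑ s, ∑ t, ∑ p, ∑ q, ((1 / 64 : ℂ) * ((∑ j, ((R i j s t * x j : ℝ) : ℂ)) *
        ∑ j, ((R i j p q * x j : ℝ) : ℂ))) •
          (wedge s *ᵥ (wedge t *ᵥ (wedge p *ᵥ (wedge q *ᵥ u x)))) := by
    intro i
    have e : ∀ w : Finset (Fin n) → ℂ, modelPotential R i x *ᵥ w = ∑ s, ∑ t,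
        ((1 / 8 : ℂ) * ∑ j, ((R i j s t * x j : ℝ) : ℂ)) • (wedge s *ᵥ (wedge t *ᵥ w)) := by
      intro w
      simp only [modelPotential, Matrix.sum_mulVec, Matrix.smul_mulVec, Matrix.mulVec_mulVec]
    rw [e]
    refine Finset.sum_congr rfl fun s _ => Finset.sum_congr rfl fun t _ => ?_
    rw [e, Matrix.mulVec_sum, Matrix.mulVec_sum, Finset.smul_sum]
    refine Finset.sum_congr rfl fun p _ => ?_
    rw [Matrix.mulVec_sum, Matrix.mulVec_sum, Finset.smul_sum]
    refine Finset.sum_congr rfl fun q _ => ?_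
    rw [Matrix.mulVec_smul, Matrix.mulVec_smul, smul_smul]
    congr 1
    ring
  rw [limitDiracSquare, evalOp_cliffordCoeffs hV _ _ _ _ _ _ _ hu hx, modelOp]
  simp only [h1, h2, Finset.sum_add_distrib, Finset.sum_sub_distrib, zero_smul,
    Finset.sum_const_zero, zero_add]
  have h4 : ∑ j, ∑ k, (if j = k then (-1 : ℂ) else 0) • pd j (pd k u) x =
      -∑ i, pd i (pd i u) x := by
    simp [ite_smul]
  have h5 : ∑ s, ∑ t, ∑ p, ∑ q, (-(1 / 64 : ℂ) * ∑ i, (∑ j, ((R i j s t * x j : ℝ) : ℂ)) *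
      ∑ j, ((R i j p q * x j : ℝ) : ℂ)) •
        (wedge s *ᵥ (wedge t *ᵥ (wedge p *ᵥ (wedge q *ᵥ u x)))) =
      -∑ i, modelPotential R i x *ᵥ (modelPotential R i x *ᵥ u x) := by
    rw [Finset.sum_congr rfl fun i _ => h3 i, sum_rotate_five fun i s t p q =>
      ((1 / 64 : ℂ) * ((∑ j, ((R i j s t * x j : ℝ) : ℂ)) *
        ∑ j, ((R i j p q * x j : ℝ) : ℂ))) •
          (wedge s *ᵥ (wedge t *ᵥ (wedge p *ᵥ (wedge q *ᵥ u x))))]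
    simp only [← Finset.sum_neg_distrib, neg_mul, neg_smul, Finset.mul_sum (a := (1 / 64 : ℂ)),
      Finset.sum_smul]
  rw [h4, h5]
  abel

theorem IsRadialFrame.diffOpTendsto (h : IsRadialFrame r b θ) (κ : SpinorModule n N) :
    DiffOpTendsto (Metric.ball 0 r) 2
      (fun lam => getzlerRescale κ 2 (diracSquare b θ κ) lam)
      (modelOp fun i j s t => frameCurvature b θ i j s t 0) :=
  ⟨rescaledDiracSquare b θ, limitDiracSquare fun i j s t => frameCurvature b θ i j s t 0,
    fun _ hlam => ⟨h.smoothCoeffs_rescaledDiracSquare hlam, fun u _ x _ =>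
      getzlerRescale_diracSquare κ hlam.1.ne' u x⟩,
    ⟨h.smoothCoeffs_limitDiracSquare, fun _ hu _ hx =>
      modelOp_eq_evalOp h.isOpen (fun i s t => frameCurvature_self b θ i s t 0) hu hx⟩,
    fun γ _ I J β => ((h.smoothConverges_rescaledDiracSquare γ I J).pdPow h.isOpen β).tendsto⟩

end RescaledDirac


/-! ### Calculus in a chart -/

/-- The components of a tangent vector in a chart. -/
def push {n : ℕ} {M : Type*} [TopologicalSpace M] [ChartedSpace (E n) M]
    (X : OpenPartialHomeomorph M (E n)) (q : M) : TangentSpace (𝓡 n) q →L[ℝ] E n :=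
  mvfderiv (𝓡 n) X q

/-- The vector field on `ℝⁿ` which represents a vector field on `M` in a chart. -/
def pushField {n : ℕ} {M : Type*} [TopologicalSpace M] [ChartedSpace (E n) M]
    (X : OpenPartialHomeomorph M (E n)) (Y : Π q : M, TangentSpace (𝓡 n) q) (x : E n) :
    TangentSpace (𝓡 n) x :=
  push X (X.symm x) (Y (X.symm x))

section Chart

variable {n : ℕ} {M : Type*} [TopologicalSpace M] [ChartedSpace (E n) M]
  {F : Type*} [NormedAddCommGroup F] [NormedSpace ℝ F]
  {X : OpenPartialHomeomorph M (E n)}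

theorem mdifferentiable_of_mem_maximalAtlas (hX : X ∈ IsManifold.maximalAtlas (𝓡 n) ∞ M) :
    X.MDifferentiable (𝓡 n) (𝓡 n) :=
  ⟨(contMDiffOn_of_mem_maximalAtlas hX).mdifferentiableOn (by simp),
    (contMDiffOn_symm_of_mem_maximalAtlas hX).mdifferentiableOn (by simp)⟩

theorem contDiffOn_comp_symm (hX : X ∈ IsManifold.maximalAtlas (𝓡 n) ∞ M) {W : Set M} {f : M → F}
    (hf : ContMDiffOn (𝓡 n) 𝓘(ℝ, F) ∞ f W) :
    ContDiffOn ℝ ∞ (f ∘ X.symm) (X.target ∩ X.symm ⁻¹' W) := by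
  rw [← contMDiffOn_iff_contDiffOn]
  exact hf.comp ((contMDiffOn_symm_of_mem_maximalAtlas hX).mono inter_subset_left)
    fun x hx => hx.2

theorem contDiffOn_comp_symm_of_source (hX : X ∈ IsManifold.maximalAtlas (𝓡 n) ∞ M) {W : Set M} {f : M → F}
    (hf : ContMDiffOn (𝓡 n) 𝓘(ℝ, F) ∞ f (X.source ∩ W)) :
    ContDiffOn ℝ ∞ (f ∘ X.symm) (X.target ∩ X.symm ⁻¹' W) :=
  (contDiffOn_comp_symm hX hf).mono fun _ hx => ⟨hx.1, X.map_target hx.1, hx.2⟩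

theorem push_injective (hX : X ∈ IsManifold.maximalAtlas (𝓡 n) ∞ M) {q : M} (hq : q ∈ X.source) :
    Function.Injective (push X q) :=
  (mdifferentiable_of_mem_maximalAtlas hX).mfderiv_injective hq

theorem isInvertible_mfderiv_chart (hX : X ∈ IsManifold.maximalAtlas (𝓡 n) ∞ M) {q : M}
    (hq : q ∈ X.source) : (mfderiv (𝓡 n) (𝓡 n) X q).IsInvertible :=
  ⟨(mdifferentiable_of_mem_maximalAtlas hX).mfderiv hq, rfl⟩

theorem push_mpullback (hX : X ∈ IsManifold.maximalAtlas (𝓡 n) ∞ M) {q : M} (hq : q ∈ X.source)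
    (Y : Π y : E n, TangentSpace (𝓡 n) y) :
    push X q (VectorField.mpullback (𝓡 n) (𝓡 n) X Y q) = Y (X q) :=
  ((isInvertible_mfderiv_chart hX hq).inverse_apply_eq.1 rfl).symm

theorem push_coordField (hX : X ∈ IsManifold.maximalAtlas (𝓡 n) ∞ M) {q : M} (hq : q ∈ X.source)
    (i : Fin n) : push X q (coordField X i q) = EuclideanSpace.single i 1 :=
  push_mpullback hX hq _

theorem push_radialField (hX : X ∈ IsManifold.maximalAtlas (𝓡 n) ∞ M) {q : M} (hq : q ∈ X.source) :
    push X q (radialField X q) = X q :=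
  push_mpullback hX hq _

theorem mdifferentiableAt_comp_symm (hX : X ∈ IsManifold.maximalAtlas (𝓡 n) ∞ M) {q : M}
    (hq : q ∈ X.source) {f : M → F} (hf : MDifferentiableAt (𝓡 n) 𝓘(ℝ, F) f q) :
    DifferentiableAt ℝ (f ∘ X.symm) (X q) := by
  rw [← mdifferentiableAt_iff_differentiableAt]
  refine MDifferentiableAt.comp (I' := 𝓡 n) (X q) ?_
    ((mdifferentiable_of_mem_maximalAtlas hX).mdifferentiableAt_symm (X.map_source hq))
  rwa [X.left_inv hq]

theorem mvfderiv_congr {f g : M → F} {q : M}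
    (h : f =ᶠ[𝓝 q] g) (v : TangentSpace (𝓡 n) q) :
    mvfderiv (𝓡 n) f q v = mvfderiv (𝓡 n) g q v := by
  have h1 := h.mfderiv_eq (I := 𝓡 n) (I' := 𝓘(ℝ, F))
  change (show E n →L[ℝ] F from mfderiv (𝓡 n) 𝓘(ℝ, F) f q) v =
    (show E n →L[ℝ] F from mfderiv (𝓡 n) 𝓘(ℝ, F) g q) v
  exact congrArg (fun L : E n →L[ℝ] F => L v) h1

theorem mvfderiv_eq_sum_pd (hX : X ∈ IsManifold.maximalAtlas (𝓡 n) ∞ M) {q : M}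
    (hq : q ∈ X.source) {f : M → F} (hf : MDifferentiableAt (𝓡 n) 𝓘(ℝ, F) f q)
    (v : TangentSpace (𝓡 n) q) :
    mvfderiv (𝓡 n) f q v = ∑ i, push X q v i • pd i (f ∘ X.symm) (X q) := by
  have h1 : f =ᶠ[𝓝 q] (f ∘ X.symm) ∘ X := by
    filter_upwards [X.open_source.mem_nhds hq] with y hy
    simp [X.left_inv hy]
  have h2 := mdifferentiableAt_comp_symm hX hq hf
  have h3 : mfderiv (𝓡 n) 𝓘(ℝ, F) f q =
      (mfderiv 𝓘(ℝ, E n) 𝓘(ℝ, F) (f ∘ X.symm) (X q)).comp (mfderiv (𝓡 n) (𝓡 n) X q) := by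
    rw [h1.mfderiv_eq]
    exact mfderiv_comp q h2.mdifferentiableAt ((mdifferentiable_of_mem_maximalAtlas hX).mdifferentiableAt hq)
  rw [← fderiv_eq_sum_pd]
  change mfderiv (𝓡 n) 𝓘(ℝ, F) f q v = _
  rw [h3, mfderiv_eq_fderiv]
  rfl

theorem mvfderiv_comp_chart (hX : X ∈ IsManifold.maximalAtlas (𝓡 n) ∞ M) {q : M}
    (hq : q ∈ X.source) {f : M → F} {g : E n → F} (hg : DifferentiableAt ℝ g (X q))
    (h : f =ᶠ[𝓝 q] g ∘ X) (v : TangentSpace (𝓡 n) q) :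
    mvfderiv (𝓡 n) f q v = ∑ i, push X q v i • pd i g (X q) := by
  rw [mvfderiv_congr h, mvfderiv_eq_sum_pd hX hq (hg.mdifferentiableAt.comp q
    ((mdifferentiable_of_mem_maximalAtlas hX).mdifferentiableAt hq))]
  refine Finset.sum_congr rfl fun i _ => ?_
  rw [pd_eqOn (g := g) X.open_target (fun x hx => by simp [X.right_inv hx]) i (X.map_source hq)]

/-- The components of a tangent vector are its coordinates in the basis `∂/∂x^i`. -/
theorem sum_push_smul_coordField (hX : X ∈ IsManifold.maximalAtlas (𝓡 n) ∞ M) {q : M}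
    (hq : q ∈ X.source) (v : TangentSpace (𝓡 n) q) : ∑ i, push X q v i • coordField X i q = v := by
  apply push_injective hX hq
  rw [map_sum]
  simp only [map_smul, push_coordField hX hq]
  ext j
  simp [Pi.single_apply]

theorem mvfderiv_radialField (hX : X ∈ IsManifold.maximalAtlas (𝓡 n) ∞ M) {q : M} (hq : q ∈ X.source) {f : M → F}
    (hf : MDifferentiableAt (𝓡 n) 𝓘(ℝ, F) f q) :
    mvfderiv (𝓡 n) f q (radialField X q) = ∑ i, X q i • pd i (f ∘ X.symm) (X q) := by
  rw [mvfderiv_eq_sum_pd hX hq hf, push_radialField hX hq]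

theorem vielbeinB_apply {e : Fin n → Π q : M, TangentSpace (𝓡 n) q} (l j : Fin n) (x : E n) :
    vielbeinB X e x l j = push X (X.symm x) (e l (X.symm x)) j := rfl

theorem frameDeriv_vielbeinB (hX : X ∈ IsManifold.maximalAtlas (𝓡 n) ∞ M) 
    {e : Fin n → Π q : M, TangentSpace (𝓡 n) q} {x : E n} (hx : x ∈ X.target) {f : M → F}
    (hf : MDifferentiableAt (𝓡 n) 𝓘(ℝ, F) f (X.symm x)) (l : Fin n) :
    frameDeriv (fun l j x => vielbeinB X e x l j) l (f ∘ X.symm) x =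
      mvfderiv (𝓡 n) f (X.symm x) (e l (X.symm x)) := by
  rw [mvfderiv_eq_sum_pd hX (X.map_target hx) hf, X.right_inv hx]
  rfl

variable [IsManifold (𝓡 n) ∞ M]

theorem mdifferentiableAt_of_contMDiffOn {W : Set M} (hW : IsOpen W)
    {Y : Π q : M, TangentSpace (𝓡 n) q} (hY : ContMDiffOn (𝓡 n) (𝓡 n).tangent ∞
      (fun q => (⟨q, Y q⟩ : TangentBundle (𝓡 n) M)) W) {q : M} (hq : q ∈ W) :
    MDifferentiableAt (𝓡 n) (𝓡 n).tangent (fun q => (⟨q, Y q⟩ : TangentBundle (𝓡 n) M)) q :=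
  (hY.contMDiffAt (hW.mem_nhds hq)).mdifferentiableAt (by simp)

theorem contDiffOn_pushField (hX : X ∈ IsManifold.maximalAtlas (𝓡 n) ∞ M)
    {Y : Π q : M, TangentSpace (𝓡 n) q} (hY : ContMDiffOn (𝓡 n) (𝓡 n).tangent ∞
      (fun q => (⟨q, Y q⟩ : TangentBundle (𝓡 n) M)) X.source) :
    ContDiffOn ℝ ∞ (pushField X Y : E n → E n) X.target := by
  have h1 := (contMDiffOn_of_mem_maximalAtlas hX).contMDiffOn_tangentMapWithin
    (m := ∞) (by simp) X.open_source.uniqueMDiffOn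
  have h2 := h1.comp (hY.comp (contMDiffOn_symm_of_mem_maximalAtlas hX) X.mapsTo_symm)
    fun x hx => X.map_target hx
  have h3 : ContMDiffOn (𝓡 n) (𝓡 n).tangent ∞ (fun x : E n =>
      (⟨x, pushField X Y x⟩ : TangentBundle (𝓡 n) (E n))) X.target := by
    refine h2.congr fun x hx => ?_
    -- The composed section sits over X (X.symm x), which equals x only propositionally, so the base
    -- point is transported by hand.
    have e : ∀ (y : E n) (v : E n), x = y →
        (⟨x, v⟩ : TangentBundle (𝓡 n) (E n)) = ⟨y, v⟩ := by
      rintro y v rfl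
      rfl
    refine (e _ _ (X.right_inv hx).symm).trans ?_
    simp only [Function.comp_def, tangentMapWithin]
    rw [mfderivWithin_of_isOpen X.open_source (X.map_target hx)]
    rfl
  exact contMDiffOn_vectorSpace_iff_contDiffOn.1 h3

/-- Near q both fields are pullbacks by the chart of their coordinate representatives, and the Lie
bracket is natural under pullback. -/
theorem push_mlieBracket (hX : X ∈ IsManifold.maximalAtlas (𝓡 n) ∞ M)
    {Y Z : Π q : M, TangentSpace (𝓡 n) q} (hY : ContMDiffOn (𝓡 n) (𝓡 n).tangent ∞
      (fun q => (⟨q, Y q⟩ : TangentBundle (𝓡 n) M)) X.source)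
    (hZ : ContMDiffOn (𝓡 n) (𝓡 n).tangent ∞
      (fun q => (⟨q, Z q⟩ : TangentBundle (𝓡 n) M)) X.source) {q : M} (hq : q ∈ X.source) :
    push X q (VectorField.mlieBracket (𝓡 n) Y Z q) =
      VectorField.lieBracket ℝ (pushField X Y : E n → E n) (pushField X Z : E n → E n) (X q) := by
  have i2 : IsManifold (𝓡 n) (minSmoothness ℝ 2) M := by
    rw [minSmoothness_of_isRCLikeNormedField]
    exact IsManifold.of_le (n := ∞) (WithTop.coe_le_coe.2 (le_top : (2 : ℕ∞) ≤ ⊤))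
  have i3 : IsManifold (𝓡 n) (minSmoothness ℝ 3) M := by
    rw [minSmoothness_of_isRCLikeNormedField]
    exact IsManifold.of_le (n := ∞) (WithTop.coe_le_coe.2 (le_top : (3 : ℕ∞) ≤ ⊤))
  have hd : ∀ {Y : Π q : M, TangentSpace (𝓡 n) q}, ContMDiffOn (𝓡 n) (𝓡 n).tangent ∞
      (fun q => (⟨q, Y q⟩ : TangentBundle (𝓡 n) M)) X.source →
      MDifferentiableAt (𝓡 n) (𝓡 n).tangent (fun x : E n =>
        (⟨x, pushField X Y x⟩ : TangentBundle (𝓡 n) (E n))) (X q) := fun hY =>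
    ((contMDiffOn_vectorSpace_iff_contDiffOn.2 (contDiffOn_pushField hX hY)).contMDiffAt
      (X.open_target.mem_nhds (X.map_source hq))).mdifferentiableAt (by simp)
  have hp : ∀ Y : Π q : M, TangentSpace (𝓡 n) q,
      VectorField.mpullback (𝓡 n) (𝓡 n) X (pushField X Y) =ᶠ[𝓝 q] Y := by
    intro Y
    filter_upwards [X.open_source.mem_nhds hq] with y hy
    apply push_injective hX hy
    rw [push_mpullback hX hy, pushField, X.left_inv hy]
  rw [← (hp Y).mlieBracket_vectorField_eq (hp Z),
    ← VectorField.mpullback_mlieBracket (n := ∞) (hd hY) (hd hZ)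
      (contMDiffAt_of_mem_maximalAtlas hX hq) (by simpa using WithTop.coe_le_coe.2 (le_top : (2 : ℕ∞) ≤ ⊤)),
    push_mpullback hX hq,
    ← VectorField.mlieBracketWithin_univ, VectorField.mlieBracketWithin_eq_lieBracketWithin]
  exact congrFun VectorField.lieBracketWithin_univ _

end Chart


/-! ### The parallel frame in normal coordinates -/

section ParallelFrame

variable {n : ℕ} {M : Type*} [TopologicalSpace M] [ChartedSpace (E n) M]
  [RiemannianBundle (fun q : M => TangentSpace (𝓡 n) q)]

/-- A family of n orthonormal vectors spans the tangent space, by dimension. -/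
theorem sum_inner_smul_of_orthonormal {q : M} {v : Fin n → TangentSpace (𝓡 n) q}
    (hv : Orthonormal ℝ v) (w : TangentSpace (𝓡 n) q) : ∑ i, inner ℝ (v i) w • v i = w := by
  have hs : Submodule.span ℝ (range v) = ⊤ := by
    have : FiniteDimensional ℝ (TangentSpace (𝓡 n) q) :=
      inferInstanceAs (FiniteDimensional ℝ (E n))
    refine hv.linearIndependent.span_eq_top_of_card_eq_finrank' ?_
    have h : Module.finrank ℝ (TangentSpace (𝓡 n) q) = n :=
      (finrank_euclideanSpace_fin : Module.finrank ℝ (E n) = n)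
    simp [h]
  simpa using (OrthonormalBasis.mk hv hs.ge).sum_repr' w

variable [IsManifold (𝓡 n) ∞ M]

variable {cov : CovariantDerivative (𝓡 n) (E n) (TangentSpace (𝓡 n) : M → Type _)} {p : M} {r : ℝ}
  {X : OpenPartialHomeomorph M (E n)}

theorem IsNormalChart.symm_zero (hX : IsNormalChart cov p r X) : X.symm 0 = p := by
  rw [← hX.center_eq, X.left_inv hX.center_mem]

theorem IsNormalChart.zero_mem (hX : IsNormalChart cov p r X) : (0 : E n) ∈ X.target := by
  rw [← hX.center_eq]
  exact X.map_source hX.center_mem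

/-- A smooth function on the domain of a normal chart whose radial derivative vanishes is
constant. -/
theorem IsNormalChart.eq_center_of_radial (hX : IsNormalChart cov p r X) {F : Type*}
    [NormedAddCommGroup F] [NormedSpace ℝ F] {f : M → F}
    (hf : ContMDiffOn (𝓡 n) 𝓘(ℝ, F) ∞ f X.source)
    (h : ∀ q ∈ X.source, mvfderiv (𝓡 n) f q (radialField X q) = 0) {q : M} (hq : q ∈ X.source) :
    f q = f p := by
  have hs : ContDiffOn ℝ ∞ (f ∘ X.symm) (Metric.ball 0 r) := by
    refine (contDiffOn_comp_symm hX.mem_atlas hf).mono fun x hx => ?_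
    rw [← hX.target_eq] at hx
    exact ⟨hx, X.map_target hx⟩
  have := eq_at_zero_of_radial_deriv hs (fun x hx => ?_) (x := X q)
    (by rw [← hX.target_eq]; exact X.map_source hq)
  · simpa [X.left_inv hq, hX.symm_zero] using this
  · rw [← hX.target_eq] at hx
    have hx' := X.map_target hx
    have h1 := mvfderiv_radialField hX.mem_atlas hx'
      ((hf.contMDiffAt (X.open_source.mem_nhds hx')).mdifferentiableAt (by simp))
    rw [h _ hx', X.right_inv hx] at h1
    exact h1.symm

variable [IsContMDiffRiemannianBundle (𝓡 n) ∞ (E n) (fun q : M => TangentSpace (𝓡 n) q)]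

set_option synthInstance.maxHeartbeats 200000 in
theorem IsLeviCivita.mvfderiv_inner (hcov : IsLeviCivita cov) {Y Z : Π q : M, TangentSpace (𝓡 n) q}
    {q : M}
    (hY : MDifferentiableAt (𝓡 n) (𝓡 n).tangent (fun q => (⟨q, Y q⟩ : TangentBundle (𝓡 n) M)) q)
    (hZ : MDifferentiableAt (𝓡 n) (𝓡 n).tangent (fun q => (⟨q, Z q⟩ : TangentBundle (𝓡 n) M)) q)
    (v : TangentSpace (𝓡 n) q) :
    mvfderiv (𝓡 n) (fun y => (inner ℝ (Y y) (Z y) : ℝ)) q v =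
      inner ℝ (cov Y q v) (Z q) + inner ℝ (Y q) (cov Z q v) := by
  classical
  -- Metric compatibility is formulated with a direction field; the vector v is extended by zero
  -- away from q, as only its value at q matters.
  have := hcov.metric.mvfderiv_inner_eq (Function.update (fun _ => 0) q v) hY hZ
  simpa using this

theorem IsLeviCivita.torsion (hcov : IsLeviCivita cov) {Y Z : Π q : M, TangentSpace (𝓡 n) q}
    {q : M}
    (hY : MDifferentiableAt (𝓡 n) (𝓡 n).tangent (fun q => (⟨q, Y q⟩ : TangentBundle (𝓡 n) M)) q)
    (hZ : MDifferentiableAt (𝓡 n) (𝓡 n).tangent (fun q => (⟨q, Z q⟩ : TangentBundle (𝓡 n) M)) q) :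
    cov Z q (Y q) - cov Y q (Z q) = VectorField.mlieBracket (𝓡 n) Y Z q :=
  (CovariantDerivative.torsion_eq_zero_iff cov).1 hcov.torsion_free hY hZ

theorem contMDiffOn_inner {W : Set M} {Y Z : Π q : M, TangentSpace (𝓡 n) q}
    (hY : ContMDiffOn (𝓡 n) (𝓡 n).tangent ∞
      (fun q => (⟨q, Y q⟩ : TangentBundle (𝓡 n) M)) W)
    (hZ : ContMDiffOn (𝓡 n) (𝓡 n).tangent ∞
      (fun q => (⟨q, Z q⟩ : TangentBundle (𝓡 n) M)) W) :
    ContMDiffOn (𝓡 n) 𝓘(ℝ, ℝ) ∞ (fun y => (inner ℝ (Y y) (Z y) : ℝ)) W :=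
  hY.inner_bundle hZ

variable {e : Fin n → Π q : M, TangentSpace (𝓡 n) q}

/-- The coefficients `g(∇_{e_l} e_s, e_t)` of the Levi-Civita connection, in a chart. -/
def connCoeff (cov : CovariantDerivative (𝓡 n) (E n) (TangentSpace (𝓡 n) : M → Type _))
    (X : OpenPartialHomeomorph M (E n)) (e : Fin n → Π q : M, TangentSpace (𝓡 n) q)
    (l s t : Fin n) (x : E n) : ℝ :=
  inner ℝ (cov (e s) (X.symm x) (e l (X.symm x))) (e t (X.symm x))

/-- By metric compatibility the inner products of radially parallel fields have zero radial
derivative, so they keep their values at the centre. -/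
theorem IsParallelFrame.orthonormal (hcov : IsLeviCivita cov) (hX : IsNormalChart cov p r X)
    (he : IsParallelFrame cov p X e) {q : M} (hq : q ∈ X.source) :
    Orthonormal ℝ fun i => e i q := by
  have hp := orthonormal_iff_ite.1 hX.orthonormal
  rw [orthonormal_iff_ite]
  intro s t
  have hd := fun i q (hq : q ∈ X.source) =>
    mdifferentiableAt_of_contMDiffOn X.open_source (he.smooth i) hq
  have := hX.eq_center_of_radial (contMDiffOn_inner (he.smooth s) (he.smooth t)) (fun q hq => by
    rw [hcov.mvfderiv_inner (hd s q hq) (hd t q hq), he.parallel s q hq, he.parallel t q hq]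
    simp) hq
  rw [this, he.initial, he.initial, hp]

/-- Differentiate the constant functions g(f_s, f_t). -/
theorem IsLeviCivita.antisymm (hcov : IsLeviCivita cov) {f : Fin n → Π q : M, TangentSpace (𝓡 n) q}
    {W : Set M} (hW : IsOpen W) (hf : ∀ i, ContMDiffOn (𝓡 n) (𝓡 n).tangent ∞
      (fun q => (⟨q, f i q⟩ : TangentBundle (𝓡 n) M)) W)
    (ho : ∀ q ∈ W, Orthonormal ℝ fun i => f i q) {q : M} (hq : q ∈ W) (s t : Fin n)
    (v : TangentSpace (𝓡 n) q) :
    (inner ℝ (cov (f s) q v) (f t q) : ℝ) = -inner ℝ (cov (f t) q v) (f s q) := by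
  have hd := fun i => mdifferentiableAt_of_contMDiffOn hW (hf i) hq
  have h1 := hcov.mvfderiv_inner (hd s) (hd t) v
  have h2 : (fun y => (inner ℝ (f s y) (f t y) : ℝ)) =ᶠ[𝓝 q] fun _ => if s = t then 1 else 0 := by
    filter_upwards [hW.mem_nhds hq] with y hy
    exact orthonormal_iff_ite.1 (ho y hy) s t
  rw [mvfderiv_congr h2, mvfderiv_const, real_inner_comm _ (f s q)] at h1
  have h3 : (0 : ℝ) = inner ℝ (cov (f s) q v) (f t q) + inner ℝ (cov (f t) q v) (f s q) := h1
  linarith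

theorem IsParallelFrame.isUnit_vielbeinB (hcov : IsLeviCivita cov) (hX : IsNormalChart cov p r X)
    (he : IsParallelFrame cov p X e) {x : E n} (hx : x ∈ X.target) : IsUnit (vielbeinB X e x) := by
  have hx' := X.map_target hx
  rw [← Matrix.linearIndependent_rows_iff_isUnit]
  have h1 := (he.orthonormal hcov hX hx').linearIndependent
  have h2 := (h1.map' (push X (X.symm x) : TangentSpace (𝓡 n) (X.symm x) →ₗ[ℝ] E n)
    (LinearMap.ker_eq_bot.2 (push_injective hX.mem_atlas hx'))).map'
    (WithLp.linearEquiv 2 ℝ (Fin n → ℝ)).toLinearMap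
    (LinearEquiv.ker _)
  exact h2

/-- Both sides are the k-th component of [e_i, e_s]: computed in the chart on the left, and on the
right as ∇_{e_i} e_s - ∇_{e_s} e_i expanded in the orthonormal frame. -/
theorem IsParallelFrame.torsion (hcov : IsLeviCivita cov) (hX : IsNormalChart cov p r X)
    (he : IsParallelFrame cov p X e) {x : E n} (hx : x ∈ X.target) (i s k : Fin n) :
    frameDeriv (fun l j x => vielbeinB X e x l j) i (fun x => vielbeinB X e x s k) x -
      frameDeriv (fun l j x => vielbeinB X e x l j) s (fun x => vielbeinB X e x i k) x =
      ∑ t, (connCoeff cov X e i s t x - connCoeff cov X e s i t x) * vielbeinB X e x t k := by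
  have hx' := X.map_target hx
  have hd := fun i => mdifferentiableAt_of_contMDiffOn X.open_source (he.smooth i) hx'
  have hpd : ∀ i, DifferentiableAt ℝ (pushField X (e i) : E n → E n) x := fun i =>
    differentiableAt_of_contDiffOn X.open_target (contDiffOn_pushField hX.mem_atlas (he.smooth i))
      hx
  have hf : ∀ i s, frameDeriv (fun l j x => vielbeinB X e x l j) i
      (fun x => vielbeinB X e x s k) x =
      (fderiv ℝ (pushField X (e s) : E n → E n) x (pushField X (e i) x)) k := by
    intro i s
    have h1 : fderiv ℝ (fun x => vielbeinB X e x s k) x = (EuclideanSpace.proj k).comp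
        (fderiv ℝ (pushField X (e s) : E n → E n) x) :=
      ((EuclideanSpace.proj k : E n →L[ℝ] ℝ).hasFDerivAt.comp x (hpd s).hasFDerivAt).fderiv
    have h2 := fderiv_eq_sum_pd (fun x => vielbeinB X e x s k) x (pushField X (e i) x)
    rw [h1] at h2
    exact h2.symm
  have h1 := congrArg (fun w : E n => w k)
    (push_mlieBracket hX.mem_atlas (he.smooth i) (he.smooth s) hx')
  rw [← hcov.torsion (hd i) (hd s), X.right_inv hx] at h1
  have h2 := sum_inner_smul_of_orthonormal (he.orthonormal hcov hX hx')
    (cov (e s) (X.symm x) (e i (X.symm x)) - cov (e i) (X.symm x) (e s (X.symm x)))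
  rw [← h2, map_sum] at h1
  rw [hf, hf]
  refine Eq.trans ?_ (h1.symm.trans ?_)
  · simp [VectorField.lieBracket]
  · simp [inner_sub_right, connCoeff, vielbeinB_apply, real_inner_comm]

/-- The inverse vielbein expands the radial field in the frame, and e_s is parallel along the radial
field. -/
theorem IsParallelFrame.radial (hcov : IsLeviCivita cov) (hX : IsNormalChart cov p r X)
    (he : IsParallelFrame cov p X e) {x : E n} (hx : x ∈ X.target) (s t : Fin n) :
    ∑ k, x k * ∑ l, (vielbeinB X e x)⁻¹ k l * connCoeff cov X e l s t x = 0 := by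
  have hx' := X.map_target hx
  have h1 : radialField X (X.symm x) =
      ∑ k, ∑ l, (x k * (vielbeinB X e x)⁻¹ k l) • e l (X.symm x) := by
    apply push_injective hX.mem_atlas hx'
    rw [push_radialField hX.mem_atlas hx', X.right_inv hx]
    have h2 : (vielbeinB X e x)⁻¹ * vielbeinB X e x = 1 :=
      Matrix.nonsing_inv_mul _
        ((Matrix.isUnit_iff_isUnit_det _).1 (he.isUnit_vielbeinB hcov hX hx))
    have h3 : ∀ k j, ∑ l, (vielbeinB X e x)⁻¹ k l * vielbeinB X e x l j = if k = j then 1 else 0 :=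
      fun k j => by simpa [Matrix.mul_apply, Matrix.one_apply] using congrFun (congrFun h2 k) j
    ext j
    simp only [map_sum, map_smul, WithLp.ofLp_sum, WithLp.ofLp_smul, Finset.sum_apply,
      Pi.smul_apply, ← vielbeinB_apply, smul_eq_mul, mul_assoc, ← Finset.mul_sum, h3]
    simp
  have h4 : inner ℝ (cov (e s) (X.symm x) (radialField X (X.symm x))) (e t (X.symm x)) = (0 : ℝ) := by
    rw [he.parallel s _ hx']
    simp
  rw [h1] at h4
  simp only [map_sum, map_smul, sum_inner, inner_smul_left] at h4
  simp only [Finset.mul_sum, ← mul_assoc]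
  exact h4

/-- This transfers the geometry of the tangent frame to functions on a ball. Smoothness of the
connection coefficients is not assumed: they are determined by the smooth frame through the Koszul
formula. -/
theorem IsParallelFrame.isRadialFrame (hcov : IsLeviCivita cov) (hX : IsNormalChart cov p r X)
    (he : IsParallelFrame cov p X e) :
    IsRadialFrame r (fun l j x => vielbeinB X e x l j) (connCoeff cov X e) := by
  have hm : ∀ {x : E n}, x ∈ Metric.ball (0 : E n) r → x ∈ X.target := fun hx => by
    rwa [hX.target_eq]
  refine { toIsLeviCivitaFrame := isLeviCivitaFrame_of_torsion_free Metric.isOpen_ball ?_ ?_ ?_ ?_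
           radius_pos := hX.radius_pos
           frame_zero := ?_
           radial := fun x hx s t => he.radial hcov hX (hm hx) s t }
  · intro i j
    rw [← hX.target_eq]
    exact (EuclideanSpace.proj j : E n →L[ℝ] ℝ).contDiff.comp_contDiffOn
      (contDiffOn_pushField hX.mem_atlas (he.smooth i))
  · exact fun x hx => he.isUnit_vielbeinB hcov hX (hm hx)
  · exact fun i s t x hx => hcov.antisymm X.open_source he.smooth
      (fun q hq => he.orthonormal hcov hX hq) (X.map_target (hm hx)) s t _
  · exact fun i s k x hx => he.torsion hcov hX (hm hx) i s k
  · intro i j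
    rw [vielbeinB_apply, hX.symm_zero, he.initial, push_coordField hX.mem_atlas hX.center_mem]
    simp [eq_comm]

end ParallelFrame


/-! ### The curvature at the centre of a normal chart -/

section Curvature

variable {n : ℕ} {M : Type*} [TopologicalSpace M] [ChartedSpace (E n) M]

theorem contMDiffOn_comp_chart {X : OpenPartialHomeomorph M (E n)} {F : Type*}
    [NormedAddCommGroup F] [NormedSpace ℝ F] (hX : X ∈ IsManifold.maximalAtlas (𝓡 n) ∞ M)
    {f : E n → F} (hf : ContDiffOn ℝ ∞ f X.target) :
    ContMDiffOn (𝓡 n) 𝓘(ℝ, F) ∞ (f ∘ X) X.source :=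
  (contMDiffOn_iff_contDiffOn.2 hf).comp (contMDiffOn_of_mem_maximalAtlas hX) X.mapsTo

variable [IsManifold (𝓡 n) ∞ M] [RiemannianBundle (fun q : M => TangentSpace (𝓡 n) q)]

  {cov : CovariantDerivative (𝓡 n) (E n) (TangentSpace (𝓡 n) : M → Type _)} {p : M} {r : ℝ}
  {X : OpenPartialHomeomorph M (E n)} {e : Fin n → Π q : M, TangentSpace (𝓡 n) q}

theorem connCoeff_chart {q : M} (hq : q ∈ X.source) (l s t : Fin n) :
    connCoeff cov X e l s t (X q) = inner ℝ (cov (e s) q (e l q)) (e t q) := by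
  have h : ∀ y, y = q → (inner ℝ (cov (e s) y (e l y)) (e t y) : ℝ) =
      inner ℝ (cov (e s) q (e l q)) (e t q) := by
    rintro y rfl
    rfl
  exact h _ (X.left_inv hq)

variable [IsContMDiffRiemannianBundle (𝓡 n) ∞ (E n) (fun q : M => TangentSpace (𝓡 n) q)]

theorem IsParallelFrame.cov_eq_sum (hcov : IsLeviCivita cov) (hX : IsNormalChart cov p r X)
    (he : IsParallelFrame cov p X e) (j s : Fin n) {q : M} (hq : q ∈ X.source) :
    cov (e s) q (e j q) = ∑ t, connCoeff cov X e j s t (X q) • e t q := by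
  simp only [connCoeff_chart hq, real_inner_comm _ (cov _ _ _)]
  rw [sum_inner_smul_of_orthonormal (he.orthonormal hcov hX hq)]

/-- The expansion in the frame with smooth coefficients provides the regularity of ∇_{e_j} e_s that
metric compatibility requires when a second derivative is taken. -/
theorem IsParallelFrame.mdifferentiableAt_cov (hcov : IsLeviCivita cov)
    (hX : IsNormalChart cov p r X) (he : IsParallelFrame cov p X e) (j s : Fin n) {q : M}
    (hq : q ∈ X.source) : MDifferentiableAt (𝓡 n) (𝓡 n).tangent
      (fun q => (⟨q, cov (e s) q (e j q)⟩ : TangentBundle (𝓡 n) M)) q := by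
  have hθ := (he.isRadialFrame hcov hX).smooth_coeff
  rw [← hX.target_eq] at hθ
  have h1 : MDifferentiableAt (𝓡 n) (𝓡 n).tangent (fun q =>
      (⟨q, ∑ t, connCoeff cov X e j s t (X q) • e t q⟩ : TangentBundle (𝓡 n) M)) q := by
    refine MDifferentiableAt.sum_section (I := 𝓡 n) (F := E n)
      (t := fun t q => connCoeff cov X e j s t (X q) • e t q) fun t _ => ?_
    exact MDifferentiableAt.smul_section
      (((contMDiffOn_comp_chart hX.mem_atlas (hθ j s t)).contMDiffAt
        (X.open_source.mem_nhds hq)).mdifferentiableAt (by simp))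
      (mdifferentiableAt_of_contMDiffOn X.open_source (he.smooth t) hq)
  refine h1.congr_of_eventuallyEq ?_
  filter_upwards [X.open_source.mem_nhds hq] with y hy
  rw [he.cov_eq_sum hcov hX j s hy]

theorem IsParallelFrame.cov_center (hcov : IsLeviCivita cov) (hX : IsNormalChart cov p r X)
    (he : IsParallelFrame cov p X e) (i s : Fin n) : cov (e s) p (e i p) = 0 := by
  rw [he.cov_eq_sum hcov hX i s hX.center_mem, hX.center_eq]
  simp [(he.isRadialFrame hcov hX).coeff_zero]

/-- At the centre all ∇e_s vanish, so the bracket [e_i, e_j] vanishes too and each second covariant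
derivative reduces, against e_t, to an ordinary derivative of a connection coefficient. The terms
quadratic in θ on the other side are zero as well. -/
theorem IsParallelFrame.inner_curvature (hcov : IsLeviCivita cov) (hX : IsNormalChart cov p r X)
    (he : IsParallelFrame cov p X e) (i j s t : Fin n) :
    inner ℝ (curvature cov (e i) (e j) (e s) p) (e t p) =
      frameCurvature (fun l j x => vielbeinB X e x l j) (connCoeff cov X e) i j s t 0 := by
  have hR := he.isRadialFrame hcov hX
  have hd := fun i => mdifferentiableAt_of_contMDiffOn X.open_source (he.smooth i) hX.center_mem
  have h1 : ∀ i j, inner ℝ (cov (fun y => cov (e s) y (e j y)) p (e i p)) (e t p) =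
      pd i (connCoeff cov X e j s t) 0 := by
    intro i j
    have hZ := he.mdifferentiableAt_cov hcov hX j s hX.center_mem
    have h2 := hcov.mvfderiv_inner hZ (hd t) (e i p)
    rw [he.cov_center hcov hX i t, inner_zero_right, add_zero] at h2
    rw [← h2, ← hR.frameDeriv_zero]
    have hf := (((contMDiffOn_comp_chart hX.mem_atlas
      (hX.target_eq ▸ hR.smooth_coeff j s t)).contMDiffAt
        (X.open_source.mem_nhds hX.center_mem)).mdifferentiableAt (by simp))
    have h3 := frameDeriv_vielbeinB hX.mem_atlas (e := e) hX.zero_mem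
      (f := connCoeff cov X e j s t ∘ X) (by rwa [hX.symm_zero]) i
    rw [hX.symm_zero] at h3
    have h4 : (fun y => (inner ℝ (cov (e s) y (e j y)) (e t y) : ℝ)) =ᶠ[𝓝 p]
        connCoeff cov X e j s t ∘ X := by
      filter_upwards [X.open_source.mem_nhds hX.center_mem] with y hy
      exact (connCoeff_chart hy j s t).symm
    have h5 : mvfderiv (𝓡 n) (fun y => (inner ℝ (cov (e s) y (e j y)) (e t y) : ℝ)) p (e i p) =
        mvfderiv (𝓡 n) (connCoeff cov X e j s t ∘ X) p (e i p) :=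
      mvfderiv_congr h4 _
    rw [h5, ← h3]
    refine frameDeriv_eqOn X.open_target (fun x hx => ?_) i hX.zero_mem
    simp [X.right_inv hx]
  have h6 : VectorField.mlieBracket (𝓡 n) (e i) (e j) p = 0 := by
    rw [← hcov.torsion (hd i) (hd j), he.cov_center hcov hX, he.cov_center hcov hX, sub_zero]
  rw [curvature, h6, map_zero, sub_zero, inner_sub_left, h1, h1]
  simp only [frameCurvature, hR.frameDeriv_zero, hR.coeff_zero]
  simp

end Curvature


/-! ### Traces and commutants on the spinor module -/

section SpinorModule

variable {n N : ℕ}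

theorem SpinorModule.act_one (κ : SpinorModule n N) : κ.act 1 = 1 := by
  rw [SpinorModule.act, ← Algebra.TensorProduct.one_def, map_one]

theorem SpinorModule.act_mul (κ : SpinorModule n N) (c d : Cl n) :
    κ.act (c * d) = κ.act c * κ.act d := by
  simp only [SpinorModule.act, ← map_mul, Algebra.TensorProduct.tmul_mul_tmul, mul_one]

/-- The action of the Clifford algebra on the spinor module, as a linear map. -/
def SpinorModule.actLin (κ : SpinorModule n N) : Cl n →ₗ[ℝ] Matrix (Fin N) (Fin N) ℂ where
  toFun := κ.act
  map_add' c d := by simp only [SpinorModule.act, TensorProduct.tmul_add, map_add]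
  map_smul' r c := by
    simp only [SpinorModule.act, TensorProduct.tmul_smul, RingHom.id_apply]
    exact map_smul (κ.toLinearMap.restrictScalars ℝ) r _

theorem SpinorModule.act_clVec (κ : SpinorModule n N) (v : Fin n → ℝ) :
    κ.act (clVec v) = ∑ i, v i • κ.act (clGen i) := by
  have h : v = ∑ i, v i • (Pi.single i 1 : Fin n → ℝ) := by
    ext j
    simp [Finset.sum_apply, Pi.single_apply]
  have h1 : clVec v = ∑ i, v i • clGen i := by
    conv_lhs => rw [h]
    simp only [clVec, clGen, map_sum, map_smul]
  change κ.actLin _ = _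
  rw [h1, map_sum]
  simp only [map_smul]
  rfl

/-- A linear form on matrices which vanishes on commutators is a multiple of the trace. -/
theorem eq_trace_of_mul_comm (φ : Matrix (Fin N) (Fin N) ℂ →ₗ[ℂ] ℂ)
    (h : ∀ A B, φ (A * B) = φ (B * A)) (h1 : φ 1 = (1 : Matrix (Fin N) (Fin N) ℂ).trace)
    (A : Matrix (Fin N) (Fin N) ℂ) : φ A = A.trace := by
  have h2 : ∀ i j, φ (Matrix.single i j 1) = if i = j then φ (Matrix.single i i 1) else 0 := by
    intro i j
    split_ifs with hij
    · rw [hij]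
    · have := h (Matrix.single i i 1) (Matrix.single i j 1)
      rw [Matrix.single_mul_single_same, Matrix.single_mul_single_of_ne _ _ _ _ (Ne.symm hij),
        map_zero, one_mul] at this
      exact this
  have h3 : ∀ i j, φ (Matrix.single i i 1) = φ (Matrix.single j j 1) := by
    intro i j
    have := h (Matrix.single i j 1) (Matrix.single j i 1)
    simpa using this
  rcases Nat.eq_zero_or_pos N with h0 | h0
  · subst h0
    rw [Subsingleton.elim A 1, h1]
  · have hc : ∀ i, φ (Matrix.single i i 1) = 1 := by
      intro i
      have h4 : (1 : Matrix (Fin N) (Fin N) ℂ) = ∑ j, Matrix.single j j 1 := by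
        ext a b
        simp [Matrix.sum_apply, Matrix.single_apply, Matrix.one_apply,
          Finset.filter_eq', Finset.filter_and]
        by_cases hab : a = b <;> simp [hab]
      rw [Matrix.trace_one, h4, map_sum, Finset.sum_congr rfl fun j _ => h3 j i] at h1
      simp only [Finset.sum_const, Finset.card_univ, Fintype.card_fin, nsmul_eq_mul] at h1
      have hN : (N : ℂ) ≠ 0 := by exact_mod_cast h0.ne'
      exact mul_left_cancel₀ hN (h1.trans (mul_one _).symm)
    conv_lhs => rw [Matrix.matrix_eq_sum_single A]
    have h5 : ∀ i j, φ (Matrix.single i j (A i j)) = if i = j then A i i else 0 := by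
      intro i j
      rw [← mul_one (A i j), ← smul_eq_mul, ← Matrix.smul_single, map_smul, h2, hc]
      split_ifs with hij
      · simp [hij]
      · simp
    simp [h5, Matrix.trace]

/-- Transporting the trace by an anti-automorphism of the matrix algebra gives a linear form that
still vanishes on commutators and has the same value at 1, so it is the trace. The star is extended
complex linearly, which keeps the form complex linear. -/
theorem SpinorModule.trace_act_star (κ : SpinorModule n N) (c : Cl n) :
    (κ.act (star c)).trace = (κ.act c).trace := by
  let S : Cl n →ₗ[ℝ] Cl n :=
    { toFun := star
      map_add' := star_add
      map_smul' := fun r x => CliffordAlgebra.star_smul r x }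
  have hS : ∀ x y : ℂ ⊗[ℝ] Cl n, S.baseChange ℂ (x * y) = S.baseChange ℂ y * S.baseChange ℂ x := by
    intro x y
    induction x using TensorProduct.induction_on with
    | zero => simp
    | add a b ha hb => simp only [add_mul, mul_add, map_add, ha, hb]
    | tmul z c =>
      induction y using TensorProduct.induction_on with
      | zero => simp
      | add a b ha hb => simp only [add_mul, mul_add, map_add, ha, hb]
      | tmul w d =>
        simp only [Algebra.TensorProduct.tmul_mul_tmul, LinearMap.baseChange_tmul]
        rw [mul_comm z w]
        exact congrArg _ (star_mul c d)
  have h := eq_trace_of_mul_comm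
    (Matrix.traceLinearMap (Fin N) ℂ ℂ ∘ₗ κ.toLinearMap ∘ₗ S.baseChange ℂ ∘ₗ κ.symm.toLinearMap)
    (fun A B => by
      simp only [LinearMap.comp_apply, AlgEquiv.toLinearMap_apply, map_mul, hS,
        Matrix.traceLinearMap_apply]
      rw [Matrix.trace_mul_comm]) (by
      have : S.baseChange ℂ (1 : ℂ ⊗[ℝ] Cl n) = 1 := by
        rw [Algebra.TensorProduct.one_def, LinearMap.baseChange_tmul]
        exact congrArg _ (star_one (Cl n))
      simp [this]) (κ.act c)
  rw [← h]
  simp [SpinorModule.act, S]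

/-- A matrix which commutes with the Clifford multiplication by vectors is a scalar. -/
theorem SpinorModule.eq_scalar_of_commute (κ : SpinorModule n N) {A : Matrix (Fin N) (Fin N) ℂ}
    (h : ∀ i, Commute A (κ.act (clGen i))) : ∃ z : ℂ, A = z • 1 := by
  have h1 : ∀ c : Cl n, Commute A (κ.act c) := by
    intro c
    induction c using CliffordAlgebra.induction with
    | algebraMap r =>
      rw [Algebra.algebraMap_eq_smul_one]
      change Commute A (κ.actLin (r • 1))
      rw [map_smul]
      change Commute A (r • κ.act 1)
      rw [κ.act_one]
      exact (Commute.one_right A).smul_right r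
    | ι v =>
      change Commute A (κ.act (clVec v))
      rw [κ.act_clVec]
      exact Commute.sum_right _ _ _ fun i _ => (h i).smul_right _
    | mul c d hc hd =>
      rw [κ.act_mul]
      exact hc.mul_right hd
    | add c d hc hd =>
      change Commute A (κ.actLin (c + d))
      rw [map_add]
      exact hc.add_right hd
  have h2 : ∀ x : ℂ ⊗[ℝ] Cl n, Commute A (κ x) := by
    intro x
    induction x using TensorProduct.induction_on with
    | zero => simp
    | add a b ha hb =>
      rw [map_add]
      exact ha.add_right hb
    | tmul z c =>
      have : z ⊗ₜ[ℝ] c = z • ((1 : ℂ) ⊗ₜ[ℝ] c) := by simp [TensorProduct.smul_tmul']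
      rw [this, map_smul]
      exact (h1 c).smul_right z
  have h3 : A ∈ Set.range (Matrix.scalar (Fin N)) := by
    refine Matrix.mem_range_scalar_of_commute_single fun i j _ => ?_
    have := h2 (κ.symm (Matrix.single i j 1))
    rw [AlgEquiv.apply_symm_apply] at this
    exact this.symm
  obtain ⟨z, hz⟩ := h3
  exact ⟨z, by rw [← hz, Matrix.scalar_apply, Matrix.smul_one_eq_diagonal]⟩

/-- The trace of κ_s κ_t is symmetric in s and t by cyclicity alone, while w is antisymmetric. -/
theorem trace_spinLift (κ : Fin n → Matrix (Fin N) (Fin N) ℂ) {w : Fin n → Fin n → ℝ}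
    (hw : ∀ s t, w s t = -w t s) : (spinLift κ w).trace = 0 := by
  have h : ∑ s, ∑ t, (w s t • (κ s * κ t)).trace = -∑ s, ∑ t, (w s t • (κ s * κ t)).trace := by
    conv_lhs => rw [Finset.sum_comm]
    simp only [← Finset.sum_neg_distrib]
    refine Finset.sum_congr rfl fun s _ => Finset.sum_congr rfl fun t _ => ?_
    rw [hw t s, neg_smul, Matrix.trace_neg, Matrix.trace_smul, Matrix.trace_smul,
      Matrix.trace_mul_comm]
  rw [spinLift, Matrix.trace_smul]
  simp only [Matrix.trace_sum]
  rw [self_eq_neg.1 h, smul_zero]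

end SpinorModule

/-! ### Calculus of matrix valued functions -/

section MatrixCalculus

variable {n N : ℕ} {V : Set (E n)} {A B : E n → Matrix (Fin N) (Fin N) ℂ} {x : E n}

/-- The partial derivatives of the entries of a matrix. -/
def matPd (k : Fin n) (A : E n → Matrix (Fin N) (Fin N) ℂ) (x : E n) : Matrix (Fin N) (Fin N) ℂ :=
  Matrix.of fun i j => pd k (fun y => A y i j) x

/-- The entries of `A` are smooth on `V`. -/
def MatSmoothOn (V : Set (E n)) (A : E n → Matrix (Fin N) (Fin N) ℂ) : Prop :=
  ∀ i j, ContDiffOn ℝ ∞ (fun x => A x i j) V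

namespace MatSmoothOn

theorem differentiableAt (h : MatSmoothOn V A) (hV : IsOpen V) (hx : x ∈ V) (i j : Fin N) :
    DifferentiableAt ℝ (fun y => A y i j) x :=
  differentiableAt_of_contDiffOn hV (h i j) hx

theorem mono (h : MatSmoothOn V A) {W : Set (E n)} (hW : W ⊆ V) : MatSmoothOn W A :=
  fun i j => (h i j).mono hW

theorem mul (hA : MatSmoothOn V A) (hB : MatSmoothOn V B) : MatSmoothOn V fun x => A x * B x :=
  fun i j => by
    simp only [Matrix.mul_apply]
    exact ContDiffOn.sum fun k _ => (hA i k).mul (hB k j)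

theorem const (C : Matrix (Fin N) (Fin N) ℂ) : MatSmoothOn V fun _ => C :=
  fun _ _ => contDiffOn_const

theorem smul {f : E n → ℝ} (hf : ContDiffOn ℝ ∞ f V) (hA : MatSmoothOn V A) :
    MatSmoothOn V fun x => f x • A x :=
  fun i j => hf.smul (hA i j)

theorem sum {ι : Type*} {s : Finset ι} {A : ι → E n → Matrix (Fin N) (Fin N) ℂ}
    (hA : ∀ k ∈ s, MatSmoothOn V (A k)) : MatSmoothOn V fun x => ∑ k ∈ s, A k x :=
  fun i j => by
    simp only [Matrix.sum_apply]
    exact ContDiffOn.sum fun k hk => hA k hk i j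

theorem matPd (hA : MatSmoothOn V A) (hV : IsOpen V) (k : Fin n) : MatSmoothOn V (matPd k A) :=
  fun i j => contDiffOn_pd hV (hA i j) k

theorem trace (hA : MatSmoothOn V A) : ContDiffOn ℝ ∞ (fun x => (A x).trace) V :=
  ContDiffOn.sum fun i _ => hA i i

end MatSmoothOn

theorem matPd_eqOn (hV : IsOpen V) (h : EqOn A B V) (k : Fin n) :
    EqOn (matPd k A) (matPd k B) V := fun x hx => by
  ext i j
  exact pd_eqOn hV (fun y hy => by rw [h hy]) k hx

theorem matPd_mul (hA : ∀ i j, DifferentiableAt ℝ (fun y => A y i j) x)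
    (hB : ∀ i j, DifferentiableAt ℝ (fun y => B y i j) x) (k : Fin n) :
    matPd k (fun y => A y * B y) x = matPd k A x * B x + A x * matPd k B x := by
  ext i j
  simp only [matPd, Matrix.of_apply, Matrix.mul_apply, Matrix.add_apply]
  rw [pd_sum fun l _ => (hA i l).fun_mul (hB l j), ← Finset.sum_add_distrib]
  refine Finset.sum_congr rfl fun l _ => ?_
  rw [pd_mul (hA i l) (hB l j), add_comm]

@[simp] theorem matPd_const (C : Matrix (Fin N) (Fin N) ℂ) (k : Fin n) :
    matPd k (fun _ => C) x = 0 := by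
  ext i j
  simp [matPd]

theorem pd_trace (hA : ∀ i j, DifferentiableAt ℝ (fun y => A y i j) x) (k : Fin n) :
    pd k (fun y => (A y).trace) x = (matPd k A x).trace := by
  simp only [Matrix.trace, Matrix.diag_apply]
  rw [pd_sum fun l _ => hA l l]
  rfl

theorem matPd_comm (hV : IsOpen V) (hA : MatSmoothOn V A) (j k : Fin n) (hx : x ∈ V) :
    matPd j (matPd k A) x = matPd k (matPd j A) x := by
  ext a b
  exact pd_comm hV (hA a b) j k hx

theorem pd_mulVec {u : E n → Fin N → ℂ} (hA : ∀ i j, DifferentiableAt ℝ (fun y => A y i j) x)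
    (hu : DifferentiableAt ℝ u x) (k : Fin n) :
    pd k (fun y => A y *ᵥ u y) x = matPd k A x *ᵥ u x + A x *ᵥ pd k u x := by
  have hu' := differentiableAt_pi.1 hu
  have hd : ∀ i, DifferentiableAt ℝ (fun y => (A y *ᵥ u y) i) x := fun i => by
    simp only [Matrix.mulVec, dotProduct]
    exact DifferentiableAt.fun_sum fun j _ => (hA i j).fun_mul (hu' j)
  have hp : ∀ {f : E n → Fin N → ℂ}, DifferentiableAt ℝ f x → ∀ i,
      pd k f x i = pd k (fun y => f y i) x := fun hf i =>
    (pd_clm (ContinuousLinearMap.proj (R := ℝ) (φ := fun _ : Fin N => ℂ) i) hf k).symm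
  ext i
  rw [hp (differentiableAt_pi.2 hd)]
  simp only [Matrix.mulVec, dotProduct, Pi.add_apply]
  rw [pd_sum fun l _ => (hA i l).fun_mul (hu' l), ← Finset.sum_add_distrib]
  refine Finset.sum_congr rfl fun l _ => ?_
  rw [pd_mul (hA i l) (hu' l), hp hu, add_comm]
  rfl

end MatrixCalculus


/-! ### Clifford multiplication and connection form in a trivialisation of the spinor bundle -/

section Gauge

variable {n N : ℕ} {V : Set (E n)} {x : E n}

theorem matSmoothOn_inv {T : E n → Matrix (Fin N) (Fin N) ℂ} (hT : MatSmoothOn V T)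
    (hu : ∀ x ∈ V, IsUnit (T x)) : MatSmoothOn V fun x => (T x)⁻¹ :=
  contDiffOn_matrix_inv hT hu

theorem inv_mul_of_isUnit {A : Matrix (Fin N) (Fin N) ℂ} (h : IsUnit A) : A⁻¹ * A = 1 :=
  Matrix.nonsing_inv_mul _ ((Matrix.isUnit_iff_isUnit_det _).1 h)

theorem mul_inv_of_isUnit {A : Matrix (Fin N) (Fin N) ℂ} (h : IsUnit A) : A * A⁻¹ = 1 :=
  Matrix.mul_nonsing_inv _ ((Matrix.isUnit_iff_isUnit_det _).1 h)

theorem matPd_inv {T : E n → Matrix (Fin N) (Fin N) ℂ} (hV : IsOpen V) (hT : MatSmoothOn V T)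
    (hu : ∀ x ∈ V, IsUnit (T x)) (hx : x ∈ V) (k : Fin n) :
    matPd k (fun y => (T y)⁻¹) x = -((T x)⁻¹ * matPd k T x * (T x)⁻¹) := by
  have h1 := matPd_mul ((matSmoothOn_inv hT hu).differentiableAt hV hx)
    (hT.differentiableAt hV hx) k
  have h2 : matPd k (fun y => (T y)⁻¹ * T y) x = 0 := by
    rw [matPd_eqOn (B := fun _ => 1) hV (fun y hy => inv_mul_of_isUnit (hu y hy)) k hx, matPd_const]
  rw [h2] at h1
  have h3 := congrArg (· * (T x)⁻¹) h1
  simp only [zero_mul, add_mul, mul_assoc, mul_inv_of_isUnit (hu x hx), mul_one] at h3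
  rw [mul_assoc]
  exact eq_neg_of_add_eq_zero_left h3.symm

/-- The logarithmic derivatives of the determinant of an invertible matrix. -/
def logDet (T : E n → Matrix (Fin N) (Fin N) ℂ) (k : Fin n) (x : E n) : ℂ :=
  ((T x)⁻¹ * matPd k T x).trace

theorem contDiffOn_logDet {T : E n → Matrix (Fin N) (Fin N) ℂ} (hV : IsOpen V)
    (hT : MatSmoothOn V T) (hu : ∀ x ∈ V, IsUnit (T x)) (k : Fin n) :
    ContDiffOn ℝ ∞ (logDet T k) V :=
  ((matSmoothOn_inv hT hu).mul (hT.matPd hV k)).trace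

/-- The form tr(T⁻¹dT) is closed: its derivative consists of a second derivative of T, symmetric in
j and k, and of a quadratic term which cyclicity of the trace makes symmetric. No logarithm of the
determinant has to be chosen. -/
theorem pd_logDet_comm {T : E n → Matrix (Fin N) (Fin N) ℂ} (hV : IsOpen V)
    (hT : MatSmoothOn V T) (hu : ∀ x ∈ V, IsUnit (T x)) (hx : x ∈ V) (j k : Fin n) :
    pd j (logDet T k) x = pd k (logDet T j) x := by
  have h : ∀ j k, pd j (logDet T k) x =
      ((T x)⁻¹ * matPd j (matPd k T) x).trace -
        ((T x)⁻¹ * matPd j T x * ((T x)⁻¹ * matPd k T x)).trace := by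
    intro j k
    have hs := matSmoothOn_inv hT hu
    have h1 := pd_trace ((hs.mul (hT.matPd hV k)).differentiableAt hV hx) j
    refine h1.trans ?_
    rw [matPd_mul (hs.differentiableAt hV hx) ((hT.matPd hV k).differentiableAt hV hx),
      matPd_inv hV hT hu hx, Matrix.trace_add, neg_mul, Matrix.trace_neg, mul_assoc _ _ (matPd k T x)]
    ring
  rw [h, h, matPd_comm hV hT j k hx, Matrix.trace_mul_comm ((T x)⁻¹ * matPd j T x)]

theorem logDet_mul {L T : E n → Matrix (Fin N) (Fin N) ℂ} (hV : IsOpen V) (hL : MatSmoothOn V L)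
    (hT : MatSmoothOn V T) (hLu : IsUnit (L x)) (hu : IsUnit (T x)) (hx : x ∈ V) (k : Fin n) :
    logDet (fun y => L y * T y) k x = logDet L k x + logDet T k x := by
  simp only [logDet]
  rw [matPd_mul (hL.differentiableAt hV hx) (hT.differentiableAt hV hx), Matrix.mul_inv_rev, mul_add,
    Matrix.trace_add]
  congr 1
  · rw [mul_assoc, Matrix.trace_mul_comm, ← mul_assoc, mul_assoc, mul_inv_of_isUnit hu, mul_one]
  · rw [mul_assoc, ← mul_assoc _ (L x), inv_mul_of_isUnit hLu, one_mul]

theorem logDet_congr {T T' : E n → Matrix (Fin N) (Fin N) ℂ} (hV : IsOpen V) (h : EqOn T T' V)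
    (hx : x ∈ V) (k : Fin n) : logDet T k x = logDet T' k x := by
  simp only [logDet]
  rw [h hx, matPd_eqOn hV h k hx]

/-- Smoothness in the Clifford algebra is tested on real linear forms; the real and imaginary parts
of a matrix entry of the action are such forms. -/
theorem SpinorModule.matSmoothOn_act (ρ : SpinorModule n N) {c : E n → Cl n}
    (hc : ∀ φ : Cl n →ₗ[ℝ] ℝ, ContDiffOn ℝ ∞ (fun x => φ (c x)) V) :
    MatSmoothOn V fun x => ρ.act (c x) := by
  intro i j
  let ε : Matrix (Fin N) (Fin N) ℂ →ₗ[ℝ] ℂ :=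
    { toFun := fun A => A i j
      map_add' := fun _ _ => rfl
      map_smul' := fun _ _ => rfl }
  have h1 := hc (Complex.reLm ∘ₗ ε ∘ₗ ρ.actLin)
  have h2 := hc (Complex.imLm ∘ₗ ε ∘ₗ ρ.actLin)
  have h3 := (contDiffOn_ofReal h1).add ((contDiffOn_ofReal h2).mul (contDiffOn_const (c := Complex.I)))
  exact h3.congr fun x _ => (Complex.re_add_im _).symm

theorem SpinorModule.act_star_mul (ρ : SpinorModule n N) {c : Cl n} (h : star c * c = 1) :
    ρ.act (star c) * ρ.act c = 1 := by
  rw [← ρ.act_mul, h, ρ.act_one]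

/-- The logarithmic derivative of the determinant vanishes on unitary elements of the Clifford
algebra. -/
theorem SpinorModule.logDet_act (ρ : SpinorModule n N) {c : E n → Cl n} (hV : IsOpen V)
    (hc : ∀ φ : Cl n →ₗ[ℝ] ℝ, ContDiffOn ℝ ∞ (fun x => φ (c x)) V)
    (hu : ∀ x ∈ V, star (c x) * c x = 1) (hx : x ∈ V) (k : Fin n) :
    logDet (fun y => ρ.act (c y)) k x = 0 := by
  let S : Cl n →ₗ[ℝ] Cl n :=
    { toFun := star
      map_add' := star_add
      map_smul' := fun r x => CliffordAlgebra.star_smul r x }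
  have hL := ρ.matSmoothOn_act hc
  have hF : MatSmoothOn V fun x => ρ.act (star (c x)) := ρ.matSmoothOn_act fun φ => hc (φ ∘ₗ S)
  have hLd := hL.differentiableAt hV hx
  have hFd := hF.differentiableAt hV hx
  have hinv : (ρ.act (c x))⁻¹ = ρ.act (star (c x)) :=
    Matrix.inv_eq_left_inv (ρ.act_star_mul (hu x hx))
  have h1 : matPd k (fun y => ρ.act (star (c y)) * ρ.act (c y)) x = 0 := by
    rw [matPd_eqOn (B := fun _ => 1) hV (fun y hy => ρ.act_star_mul (hu y hy)) k hx, matPd_const]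
  rw [matPd_mul hFd hLd] at h1
  have hc1 : MatSmoothOn V fun _ => ρ.act (c x) := MatSmoothOn.const _
  have hc2 : MatSmoothOn V fun _ => ρ.act (star (c x)) := MatSmoothOn.const _
  -- Freeze one of the two factors at x. Invariance of the trace under the star then exchanges the
  -- roles of c and its star, so the two halves of the derivative of star c · c = 1 have equal
  -- traces and both vanish.
  have h2 : (matPd k (fun y => ρ.act (star (c y))) x * ρ.act (c x)).trace =
      (ρ.act (star (c x)) * matPd k (fun y => ρ.act (c y)) x).trace := by
    have e1 := pd_trace ((hF.mul hc1).differentiableAt hV hx) k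
    have e2 := pd_trace ((hc2.mul hL).differentiableAt hV hx) k
    rw [matPd_mul hFd (hc1.differentiableAt hV hx), matPd_const, mul_zero, add_zero] at e1
    rw [matPd_mul (hc2.differentiableAt hV hx) hLd, matPd_const, zero_mul, zero_add] at e2
    rw [← e1, ← e2]
    congr 2
    funext y
    rw [← ρ.act_mul, ← ρ.act_mul, ← ρ.trace_act_star, star_mul, star_star]
  have h3 := congrArg Matrix.trace h1
  rw [Matrix.trace_add, h2, Matrix.trace_zero, ← two_mul] at h3
  rw [logDet, hinv]
  simpa using h3

/-- Clifford multiplication by the vectors `∑_u m_su f_u`. -/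
def frameClifford (ρ : Fin n → Matrix (Fin N) (Fin N) ℂ) (m : Fin n → Fin n → E n → ℝ) (s : Fin n)
    (x : E n) : Matrix (Fin N) (Fin N) ℂ :=
  ∑ u, m s u x • ρ u

variable {ρ : Fin n → Matrix (Fin N) (Fin N) ℂ} {m : Fin n → Fin n → E n → ℝ}

theorem matSmoothOn_frameClifford (hm : ∀ s u, ContDiffOn ℝ ∞ (m s u) V) (s : Fin n) :
    MatSmoothOn V (frameClifford ρ m s) :=
  MatSmoothOn.sum fun u _ => (MatSmoothOn.const _).smul (hm s u)

theorem matPd_frameClifford (hm : ∀ s u, DifferentiableAt ℝ (m s u) x) (k s : Fin n) :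
    matPd k (frameClifford ρ m s) x = ∑ u, pd k (m s u) x • ρ u := by
  ext i j
  simp only [matPd, frameClifford, Matrix.of_apply, Matrix.sum_apply, Matrix.smul_apply]
  rw [pd_sum fun u _ => (hm s u).fun_smul (differentiableAt_const _)]
  refine Finset.sum_congr rfl fun u _ => ?_
  rw [pd_smul (hm s u) (differentiableAt_const _)]
  simp

/-- Clifford multiplication is parallel. -/
theorem matPd_frameClifford_eq (hρ : IsCliffordFamily ρ) (hm : ∀ s u, DifferentiableAt ℝ (m s u) x)
    {w θ : Fin n → Fin n → ℝ} {k : Fin n} (hw : ∀ s t, w s t = -w t s)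
    (h : ∀ s u, pd k (m s u) x = ∑ v, w u v * m s v x + ∑ t, θ s t * m t u x) (s : Fin n) :
    matPd k (frameClifford ρ m s) x = frameClifford ρ m s x * spinLift ρ w -
      spinLift ρ w * frameClifford ρ m s x + ∑ t, θ s t • frameClifford ρ m t x := by
  have h1 : spinLift ρ w * frameClifford ρ m s x - frameClifford ρ m s x * spinLift ρ w =
      ∑ v, ∑ u, (m s v x * w v u) • ρ u := by
    simp only [frameClifford, Finset.mul_sum, Finset.sum_mul, ← Finset.sum_sub_distrib,
      Matrix.mul_smul, Matrix.smul_mul, ← smul_sub]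
    refine Finset.sum_congr rfl fun v _ => ?_
    rw [spinLift_commutator hρ hw, Finset.smul_sum]
    simp only [smul_smul]
  rw [matPd_frameClifford hm, ← neg_sub, h1, Finset.sum_comm, ← Finset.sum_neg_distrib]
  simp only [frameClifford, Finset.smul_sum, smul_smul]
  rw [Finset.sum_comm (f := fun t u => (θ s t * m t u x) • ρ u), ← Finset.sum_add_distrib]
  refine Finset.sum_congr rfl fun u _ => ?_
  rw [h, add_smul, Finset.sum_smul, Finset.sum_smul, ← Finset.sum_neg_distrib]
  refine congrArg₂ _ (Finset.sum_congr rfl fun v _ => ?_) rfl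
  rw [hw v u, mul_neg, neg_smul, neg_neg, mul_comm]

/-- The connection form of the spinor bundle in the trivialisation `T`. -/
def gaugeForm (T : E n → Matrix (Fin N) (Fin N) ℂ) (Γ : Matrix (Fin N) (Fin N) ℂ) (k : Fin n)
    (x : E n) : Matrix (Fin N) (Fin N) ℂ :=
  (T x)⁻¹ * (matPd k T x + Γ * T x)

/-- Conjugation by T replaces the connection matrix Γ by the gauge form of T; an endomorphism whose
derivative is a commutator up to D keeps this shape. -/
theorem matPd_conj {T C : E n → Matrix (Fin N) (Fin N) ℂ} (hV : IsOpen V) (hT : MatSmoothOn V T)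
    (hC : MatSmoothOn V C) (hu : ∀ x ∈ V, IsUnit (T x)) (hx : x ∈ V)
    {Γ D : Matrix (Fin N) (Fin N) ℂ} {k : Fin n} (h : matPd k C x = C x * Γ - Γ * C x + D) :
    matPd k (fun y => (T y)⁻¹ * C y * T y) x =
      (T x)⁻¹ * C x * T x * gaugeForm T Γ k x - gaugeForm T Γ k x * ((T x)⁻¹ * C x * T x) +
        (T x)⁻¹ * D * T x := by
  have hs := matSmoothOn_inv hT hu
  rw [matPd_mul ((hs.mul hC).differentiableAt hV hx) (hT.differentiableAt hV hx),
    matPd_mul (hs.differentiableAt hV hx) (hC.differentiableAt hV hx), matPd_inv hV hT hu hx, h]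
  have h1 : ∀ B, T x * ((T x)⁻¹ * B) = B := fun B => by
    rw [← mul_assoc, mul_inv_of_isUnit (hu x hx), one_mul]
  simp only [gaugeForm, mul_add, add_mul, mul_sub, sub_mul, mul_assoc, h1, neg_mul]
  abel

theorem trace_gaugeForm {T : E n → Matrix (Fin N) (Fin N) ℂ} {Γ : Matrix (Fin N) (Fin N) ℂ}
    (hΓ : Γ.trace = 0) (hu : IsUnit (T x)) (k : Fin n) :
    (gaugeForm T Γ k x).trace = logDet T k x := by
  rw [gaugeForm, mul_add, Matrix.trace_add, ← mul_assoc, Matrix.trace_mul_comm _ (T x), ← mul_assoc,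
    mul_inv_of_isUnit hu, one_mul, hΓ, add_zero, logDet]

end Gauge


/-! ### Radially parallel trivialisations of the spinor bundle -/

section ParallelGauge

variable {n N : ℕ} {r : ℝ} {ι : Type*}

/-- Local functions which agree on overlaps are restrictions of a global function. -/
theorem exists_glue {α β : Type*} [Nonempty β] {V : ι → Set α} {f : ι → α → β}
    (h : ∀ a b, ∀ x ∈ V a ∩ V b, f a x = f b x) : ∃ g : α → β, ∀ a, EqOn g (f a) (V a) := by
  classical
  refine ⟨fun x => if hx : ∃ a, x ∈ V a then f hx.choose x else Classical.arbitrary β,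
    fun a x hx => ?_⟩
  have hx' : ∃ a, x ∈ V a := ⟨a, hx⟩
  simp only [dif_pos hx']
  exact h _ _ x ⟨hx'.choose_spec, hx⟩

/-- A spin bundle over a ball of `ℝⁿ`, given by trivialisations over open sets `V_a` with
transition functions `c_ab`, with a trivialisation `T` which is parallel along the rays from the
origin. The functions `m_su` and `w_kuv` are the coordinates of an orthonormal frame and the
coefficients of the connection in the frame `a`, and `θ_kst` are the coefficients in the given
frame. -/
structure IsParallelGauge (r : ℝ) (ρ κ : SpinorModule n N) (θ : Fin n → Fin n → Fin n → E n → ℝ)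
    (V : ι → Set (E n)) (m : ι → Fin n → Fin n → E n → ℝ)
    (w : ι → Fin n → Fin n → Fin n → E n → ℝ) (c : ι → ι → E n → Cl n)
    (T : ι → E n → Matrix (Fin N) (Fin N) ℂ) : Prop where
  radius_pos : 0 < r
  isOpen : ∀ a, IsOpen (V a)
  iUnion_eq : ⋃ a, V a = Metric.ball 0 r
  antisymm : ∀ k s t, ∀ x ∈ Metric.ball 0 r, θ k s t x = -θ k t s x
  radial : ∀ x ∈ Metric.ball 0 r, ∀ s t, ∑ k, x k * θ k s t x = 0
  smooth_frame : ∀ a s u, ContDiffOn ℝ ∞ (m a s u) (V a)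
  conn_antisymm : ∀ a k u v, ∀ x ∈ V a, w a k u v x = -w a k v u x
  pd_frame : ∀ a k s u, ∀ x ∈ V a,
    pd k (m a s u) x = ∑ v, w a k u v x * m a s v x + ∑ t, θ k s t x * m a t u x
  smooth_lift : ∀ a b, ∀ φ : Cl n →ₗ[ℝ] ℝ, ContDiffOn ℝ ∞ (fun x => φ (c a b x)) (V a ∩ V b)
  star_mul_lift : ∀ a b, ∀ x ∈ V a ∩ V b, star (c a b x) * c a b x = 1
  lift_frame : ∀ a b s, ∀ x ∈ V a ∩ V b,
    ρ.act (c a b x) * frameClifford (fun i => ρ.act (clGen i)) (m b) s x =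
      frameClifford (fun i => ρ.act (clGen i)) (m a) s x * ρ.act (c a b x)
  smooth : ∀ a, MatSmoothOn (V a) (T a)
  isUnit : ∀ a, ∀ x ∈ V a, IsUnit (T a x)
  compat : ∀ a b, ∀ x ∈ V a ∩ V b, T a x = ρ.act (c a b x) * T b x
  parallel : ∀ a, ∀ x ∈ V a, ∑ k, x k • gaugeForm (T a)
    (spinLift (fun i => ρ.act (clGen i)) fun u v => w a k u v x) k x = 0
  initial : ∀ a s, (0 : E n) ∈ V a →
    frameClifford (fun i => ρ.act (clGen i)) (m a) s 0 * T a 0 = T a 0 * κ.act (clGen s)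

namespace IsParallelGauge

variable {ρ κ : SpinorModule n N} {θ : Fin n → Fin n → Fin n → E n → ℝ}
  {V : ι → Set (E n)} {m : ι → Fin n → Fin n → E n → ℝ}
  {w : ι → Fin n → Fin n → Fin n → E n → ℝ} {c : ι → ι → E n → Cl n}
  {T : ι → E n → Matrix (Fin N) (Fin N) ℂ}

theorem subset_ball (h : IsParallelGauge r ρ κ θ V m w c T) (a : ι) : V a ⊆ Metric.ball 0 r := by
  rw [← h.iUnion_eq]
  exact subset_iUnion V a

theorem exists_mem (h : IsParallelGauge r ρ κ θ V m w c T) {x : E n}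
    (hx : x ∈ Metric.ball (0 : E n) r) : ∃ a, x ∈ V a := by
  rw [← h.iUnion_eq] at hx
  exact mem_iUnion.1 hx

theorem contDiffOn_of_eqOn (h : IsParallelGauge r ρ κ θ V m w c T) {F : Type*}
    [NormedAddCommGroup F] [NormedSpace ℝ F] {g : E n → F} {f : ι → E n → F}
    (hf : ∀ a, ContDiffOn ℝ ∞ (f a) (V a)) (hg : ∀ a, EqOn g (f a) (V a)) :
    ContDiffOn ℝ ∞ g (Metric.ball 0 r) := by
  intro x hx
  obtain ⟨a, ha⟩ := h.exists_mem hx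
  exact (((hf a).congr (hg a)).contDiffAt ((h.isOpen a).mem_nhds ha)).contDiffWithinAt

theorem isUnit_lift (h : IsParallelGauge r ρ κ θ V m w c T) (a b : ι) {x : E n}
    (hx : x ∈ V a ∩ V b) : IsUnit (ρ.act (c a b x)) :=
  IsUnit.of_mul_eq_one_right _ (ρ.act_star_mul (h.star_mul_lift a b x hx))

/-- Clifford multiplication by the vectors of the frame is constant in the trivialisation. -/
theorem frameClifford_mul (h : IsParallelGauge r ρ κ θ V m w c T) (a : ι) (s : Fin n) {x : E n}
    (hx : x ∈ V a) : frameClifford (fun i => ρ.act (clGen i)) (m a) s x * T a x =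
      T a x * κ.act (clGen s) := by
  set C := fun a s => frameClifford (fun i => ρ.act (clGen i)) (m a) s with hC
  -- Read in the trivialisation, Clifford multiplication by e_s does not depend on the spin frame a:
  -- the transition functions of T and of the Clifford action cancel.
  have hglue := fun s => exists_glue (V := V) (f := fun a x => (T a x)⁻¹ * C a s x * T a x)
    (fun a b x hx => by
      have hL := inv_mul_of_isUnit (h.isUnit_lift a b hx)
      rw [h.compat a b x hx, Matrix.mul_inv_rev]
      simp only [mul_assoc]
      rw [← mul_assoc (C a s x), ← h.lift_frame a b s x hx, mul_assoc,
        ← mul_assoc _ (ρ.act (c a b x)), hL, one_mul])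
  choose G hG using hglue
  have hCs := fun a s => matSmoothOn_frameClifford (ρ := fun i => ρ.act (clGen i))
    (h.smooth_frame a) s
  have hGs : ∀ s, MatSmoothOn (Metric.ball 0 r) (G s) := fun s i j =>
    h.contDiffOn_of_eqOn
      (fun a => (((matSmoothOn_inv (h.smooth a) (h.isUnit a)).mul (hCs a s)).mul (h.smooth a)) i j)
      fun a x hx => by rw [hG s a hx]
  have hGp : ∀ k s a, ∀ x ∈ V a, matPd k (G s) x =
      G s x * gaugeForm (T a) (spinLift (fun i => ρ.act (clGen i)) fun u v => w a k u v x) k x -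
      gaugeForm (T a) (spinLift (fun i => ρ.act (clGen i)) fun u v => w a k u v x) k x * G s x +
        ∑ t, θ k s t x • G t x := by
    intro k s a x hx
    rw [matPd_eqOn (h.isOpen a) (hG s a) k hx]
    refine (matPd_conj (h.isOpen a) (h.smooth a) (hCs a s) (h.isUnit a) hx
      (matPd_frameClifford_eq ρ.isCliffordFamily
        (fun s u => differentiableAt_of_contDiffOn (h.isOpen a) (h.smooth_frame a s u) hx)
        (fun u v => h.conn_antisymm a k u v x hx) (fun s u => h.pd_frame a k s u x hx) s)).trans ?_
    simp only [hG _ a hx, Finset.mul_sum, Finset.sum_mul, Matrix.mul_smul, Matrix.smul_mul]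
    rfl
  -- Contracted with x, the gauge form vanishes because T is radially parallel, and θ vanishes
  -- because e is; so Clifford multiplication is constant along rays, and κ is its value at the
  -- origin.
  have hGr : ∀ s, ∀ x ∈ Metric.ball (0 : E n) r, ∑ k, x k • matPd k (G s) x = 0 := by
    intro s x hx
    obtain ⟨a, ha⟩ := h.exists_mem hx
    have h1 := h.parallel a x ha
    have h2 := congrArg (G s x * ·) h1
    have h3 := congrArg (· * G s x) h1
    simp only [Finset.mul_sum, Finset.sum_mul, mul_zero, zero_mul, Matrix.mul_smul,
      Matrix.smul_mul] at h2 h3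
    have h4 : ∑ k, x k • ∑ t, θ k s t x • G t x = 0 := by
      simp only [Finset.smul_sum, smul_smul]
      rw [Finset.sum_comm]
      simp only [← Finset.sum_smul, h.radial x hx, zero_smul, Finset.sum_const_zero]
    simp only [fun k => hGp k s a x ha, smul_add, smul_sub, Finset.sum_add_distrib,
      Finset.sum_sub_distrib, h2, h3, h4, sub_zero, add_zero]
  have hGc : ∀ s, ∀ x ∈ Metric.ball (0 : E n) r, G s x = κ.act (clGen s) := by
    intro s x hx
    have h0 : G s 0 = κ.act (clGen s) := by
      obtain ⟨a, ha⟩ := h.exists_mem (Metric.mem_ball_self h.radius_pos)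
      rw [hG s a ha]
      simp only [hC, mul_assoc]
      rw [h.initial a s ha, ← mul_assoc, inv_mul_of_isUnit (h.isUnit a 0 ha), one_mul]
    rw [← h0]
    ext i j
    refine eq_at_zero_of_radial_deriv (hGs s i j) (fun y hy => ?_) hx
    have h1 := congrFun (congrFun (hGr s y hy) i) j
    simpa [Matrix.sum_apply, matPd] using h1
  have h1 := hGc s x (h.subset_ball a hx)
  rw [hG s a hx] at h1
  rw [← h1]
  simp only [← mul_assoc]
  rw [mul_inv_of_isUnit (h.isUnit a x hx), one_mul]

/-- The transition functions lie in the spin group and have zero logarithmic derivative of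
determinant, so the local one-forms glue. The result is closed, and its radial component is the
trace of the radial gauge form, which is zero; such a form vanishes on the ball. -/
theorem logDet_eq_zero (h : IsParallelGauge r ρ κ θ V m w c T) (a : ι) (k : Fin n) {x : E n}
    (hx : x ∈ V a) : logDet (T a) k x = 0 := by
  have hglue := fun k => exists_glue (V := V) (f := fun a => logDet (T a) k)
    (fun a b x hx => by
      have ho := (h.isOpen a).inter (h.isOpen b)
      rw [logDet_congr ho (h.compat a b) hx,
        logDet_mul ho (ρ.matSmoothOn_act (h.smooth_lift a b))
          ((h.smooth b).mono inter_subset_right) (h.isUnit_lift a b hx) (h.isUnit b x hx.2) hx,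
        ρ.logDet_act ho (h.smooth_lift a b) (h.star_mul_lift a b) hx, zero_add])
  choose ϑ hϑ using hglue
  rw [← hϑ k a hx]
  refine closed_radial_gauge_eq_zero (ζ := ϑ)
    (fun k => h.contDiffOn_of_eqOn
      (fun a => contDiffOn_logDet (h.isOpen a) (h.smooth a) (h.isUnit a) k) (hϑ k))
    (fun y hy => ?_) (fun y hy i j => ?_) k (h.subset_ball a hx)
  · obtain ⟨b, hb⟩ := h.exists_mem hy
    have h1 := congrArg Matrix.trace (h.parallel b y hb)
    simp only [Matrix.trace_sum, Matrix.trace_smul, Matrix.trace_zero] at h1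
    rw [← h1]
    refine Finset.sum_congr rfl fun k _ => ?_
    rw [hϑ k b hb, trace_gaugeForm (trace_spinLift _ fun u v => h.conn_antisymm b k u v y hb)
      (h.isUnit b y hb)]
  · obtain ⟨b, hb⟩ := h.exists_mem hy
    rw [pd_eqOn (h.isOpen b) (hϑ j b) i hb, pd_eqOn (h.isOpen b) (hϑ i b) j hb]
    exact pd_logDet_comm (h.isOpen b) (h.smooth b) (h.isUnit b) hb i j

/-- The connection form of the spinor bundle in the trivialisation. -/
theorem gaugeForm_eq (h : IsParallelGauge r ρ κ θ V m w c T) (a : ι) (k : Fin n) {x : E n}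
    (hx : x ∈ V a) :
    gaugeForm (T a) (spinLift (fun i => ρ.act (clGen i)) fun u v => w a k u v x) k x =
      spinLift (fun i => κ.act (clGen i)) fun s t => θ k s t x := by
  set Γ := spinLift (fun i => ρ.act (clGen i)) fun u v => w a k u v x with hΓ
  have hθ : ∀ s t, θ k s t x = -θ k t s x := fun s t => h.antisymm k s t x (h.subset_ball a hx)
  have hconj : ∀ s, EqOn (fun y => (T a y)⁻¹ * frameClifford (fun i => ρ.act (clGen i)) (m a) s y *
      T a y) (fun _ => κ.act (clGen s)) (V a) := by
    intro s y hy
    simp only [mul_assoc]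
    rw [h.frameClifford_mul a s hy, ← mul_assoc, inv_mul_of_isUnit (h.isUnit a y hy), one_mul]
  -- Differentiating the constancy of Clifford multiplication shows that the gauge form has the same
  -- commutators with the generators as the spin lift of θ.
  have hcomm : ∀ s, gaugeForm (T a) Γ k x * κ.act (clGen s) - κ.act (clGen s) * gaugeForm (T a) Γ k x =
      ∑ t, θ k s t x • κ.act (clGen t) := by
    intro s
    have h1 := matPd_conj (h.isOpen a) (h.smooth a)
      (matSmoothOn_frameClifford (ρ := fun i => ρ.act (clGen i)) (h.smooth_frame a) s)
      (h.isUnit a) hx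
      (matPd_frameClifford_eq ρ.isCliffordFamily
        (fun s u => differentiableAt_of_contDiffOn (h.isOpen a) (h.smooth_frame a s u) hx)
        (fun u v => h.conn_antisymm a k u v x hx) (fun s u => h.pd_frame a k s u x hx) s)
    have h2 := fun s => hconj s hx
    simp only at h2
    rw [matPd_eqOn (h.isOpen a) (hconj s) k hx, matPd_const, h2] at h1
    simp only [Finset.mul_sum, Finset.sum_mul, Matrix.mul_smul, Matrix.smul_mul, h2] at h1
    rw [← sub_eq_zero, ← neg_eq_zero, h1]
    abel
  -- By irreducibility the difference is a scalar. Taking traces then gives N z = 0: the spin lift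
  -- is traceless and the trace of the gauge form is the logarithmic derivative just shown to
  -- vanish.
  obtain ⟨z, hz⟩ := κ.eq_scalar_of_commute
    (A := gaugeForm (T a) Γ k x - spinLift (fun i => κ.act (clGen i)) fun s t => θ k s t x)
    (fun s => by
      have h1 := spinLift_commutator κ.isCliffordFamily hθ s
      rw [← hcomm s] at h1
      rw [Commute, SemiconjBy, sub_mul, mul_sub, sub_eq_sub_iff_sub_eq_sub]
      exact h1.symm)
  have h3 := congrArg Matrix.trace hz
  rw [Matrix.trace_sub, trace_spinLift _ hθ, sub_zero,
    trace_gaugeForm (trace_spinLift _ fun u v => h.conn_antisymm a k u v x hx) (h.isUnit a x hx),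
    h.logDet_eq_zero a k hx, Matrix.trace_smul, Matrix.trace_one, Fintype.card_fin] at h3
  rcases Nat.eq_zero_or_pos N with h0 | h0
  · subst h0
    exact Subsingleton.elim _ _
  · have hN : (N : ℂ) ≠ 0 := by exact_mod_cast h0.ne'
    have hz0 : z = 0 := by simpa [hN] using h3.symm
    rw [hz0, zero_smul] at hz
    exact sub_eq_zero.1 hz

theorem matPd_eq (h : IsParallelGauge r ρ κ θ V m w c T) (a : ι) (k : Fin n) {x : E n}
    (hx : x ∈ V a) :
    matPd k (T a) x + spinLift (fun i => ρ.act (clGen i)) (fun u v => w a k u v x) * T a x =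
      T a x * spinLift (fun i => κ.act (clGen i)) fun s t => θ k s t x := by
  rw [← h.gaugeForm_eq a k hx, gaugeForm, ← mul_assoc, mul_inv_of_isUnit (h.isUnit a x hx), one_mul]

end IsParallelGauge

end ParallelGauge


/-! ### The Dirac operator in the parallel trivialisation -/

section Algebra

variable {n N : ℕ}

theorem spinLift_mulVec (κ : Fin n → Matrix (Fin N) (Fin N) ℂ) (w : Fin n → Fin n → ℝ)
    (z : Fin N → ℂ) : spinLift κ w *ᵥ z =
      (1 / 4 : ℂ) • ∑ s, ∑ t, ((w s t : ℝ) : ℂ) • ((κ s * κ t) *ᵥ z) := by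
  have h : spinLift κ w = (1 / 4 : ℂ) • ∑ s, ∑ t, ((w s t : ℝ) : ℂ) • (κ s * κ t) := by
    simp only [spinLift, Complex.coe_smul]
    ext i j
    simp [Matrix.smul_apply]
  rw [h]
  simp only [Matrix.smul_mulVec, Matrix.sum_mulVec]

theorem spinLift_matCLM (κ : Fin n → Matrix (Fin N) (Fin N) ℂ) (w : Fin n → Fin n → ℝ)
    (z : Fin N → ℂ) : spinLift (fun i => matCLM (κ i)) w z = spinLift κ w *ᵥ z := by
  rw [spinLift_apply, spinLift]
  simp only [Matrix.smul_mulVec, Matrix.sum_mulVec, matCLM_apply, Matrix.mulVec_mulVec]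

theorem spinLift_sum_smul {ι : Type*} (s : Finset ι) (κ : Fin n → Matrix (Fin N) (Fin N) ℂ)
    (c : ι → ℝ) (w : ι → Fin n → Fin n → ℝ) :
    spinLift κ (fun u v => ∑ k ∈ s, c k * w k u v) = ∑ k ∈ s, c k • spinLift κ (w k) := by
  simp only [spinLift, Finset.sum_smul, Finset.smul_sum, mul_smul]
  refine Eq.trans (Finset.sum_congr rfl fun u _ => ?_) Finset.sum_comm
  refine Eq.trans (Finset.sum_congr rfl fun v _ => ?_) Finset.sum_comm
  exact Finset.sum_congr rfl fun k _ => smul_comm _ _ _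

end Algebra

/-! ### From the spin structure to the local Dirac operator -/

section Dirac

variable {n N : ℕ} {M : Type*} [TopologicalSpace M] [ChartedSpace (E n) M] [IsManifold (𝓡 n) ∞ M]
  [RiemannianBundle (fun q : M => TangentSpace (𝓡 n) q)]
  {cov : CovariantDerivative (𝓡 n) (E n) (TangentSpace (𝓡 n) : M → Type _)} {p : M} {r : ℝ}
  {X : OpenPartialHomeomorph M (E n)} {e : Fin n → Π q : M, TangentSpace (𝓡 n) q}
  {ι : Type*} {𝔖 : SpinStructure n M ι} {ρ κ : SpinorModule n N}
  {τ : ι → M → Matrix (Fin N) (Fin N) ℂ}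

/-- The coefficients `g(∇_{∂_k} f_s, f_t)` of the Levi-Civita connection, in a chart. -/
def coordConn (cov : CovariantDerivative (𝓡 n) (E n) (TangentSpace (𝓡 n) : M → Type _))
    (X : OpenPartialHomeomorph M (E n)) (f : Fin n → Π q : M, TangentSpace (𝓡 n) q)
    (k s t : Fin n) (x : E n) : ℝ :=
  inner ℝ (cov (f s) (X.symm x) (coordField X k (X.symm x))) (f t (X.symm x))

theorem inner_cov_eq_sum (hX : X ∈ IsManifold.maximalAtlas (𝓡 n) ∞ M)
    (f : Fin n → Π q : M, TangentSpace (𝓡 n) q) {x : E n} (hx : x ∈ X.target)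
    (v : TangentSpace (𝓡 n) (X.symm x)) (s t : Fin n) :
    (inner ℝ (cov (f s) (X.symm x) v) (f t (X.symm x)) : ℝ) =
      ∑ k, push X (X.symm x) v k * coordConn cov X f k s t x := by
  conv_lhs => rw [← sum_push_smul_coordField hX (X.map_target hx) v]
  simp [sum_inner, inner_smul_left, coordConn]

/-- The spinorial covariant derivative in a chart. -/
theorem spinDeriv_eq_sum (hX : X ∈ IsManifold.maximalAtlas (𝓡 n) ∞ M) {ψ : ι → M → Fin N → ℂ}
    {a : ι} {g : E n → Fin N → ℂ} {x : E n} (hx : x ∈ X.target) (hg : DifferentiableAt ℝ g x)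
    (h : ψ a =ᶠ[𝓝 (X.symm x)] g ∘ X) (v : TangentSpace (𝓡 n) (X.symm x)) :
    spinDeriv cov 𝔖 ρ ψ a (X.symm x) v = ∑ k, push X (X.symm x) v k • (pd k g x +
      spinLift (fun i => ρ.act (clGen i)) (fun s t => coordConn cov X (𝔖.frame a) k s t x) *ᵥ
        g x) := by
  have h0 : ψ a (X.symm x) = g x := by
    rw [h.eq_of_nhds, Function.comp_apply, X.right_inv hx]
  have h1 := mvfderiv_comp_chart hX (X.map_target hx) (by rwa [X.right_inv hx]) h v
  rw [X.right_inv hx] at h1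
  have h2 : (1 / 4 : ℂ) • ∑ s, ∑ t,
      ((inner ℝ (cov (𝔖.frame a s) (X.symm x) v) (𝔖.frame a t (X.symm x)) : ℝ) : ℂ) •
        (ρ.act (clGen s * clGen t) *ᵥ ψ a (X.symm x)) =
      spinLift (fun i => ρ.act (clGen i)) (fun s t => ∑ k, push X (X.symm x) v k *
        coordConn cov X (𝔖.frame a) k s t x) *ᵥ g x := by
    rw [spinLift_mulVec]
    simp only [h0, ρ.act_mul, inner_cov_eq_sum hX (𝔖.frame a) hx]
  rw [spinDeriv, h1, h2, spinLift_sum_smul]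
  simp only [smul_add, Finset.sum_add_distrib, Matrix.sum_mulVec, Matrix.smul_mulVec]

theorem isOpen_trivialisation (𝔖 : SpinStructure n M ι) (X : OpenPartialHomeomorph M (E n)) (a : ι) :
    IsOpen (X.target ∩ X.symm ⁻¹' 𝔖.U a) :=
  X.isOpen_inter_preimage_symm (𝔖.isOpen a)

theorem frameClifford_eq_cliffordAct (𝔖 : SpinStructure n M ι) (ρ : SpinorModule n N)
    (X : OpenPartialHomeomorph M (E n)) (e : Fin n → Π q : M, TangentSpace (𝓡 n) q) (a : ι)
    (s : Fin n) (x : E n) :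
    frameClifford (fun i => ρ.act (clGen i))
      (fun s u x => inner ℝ (𝔖.frame a u (X.symm x)) (e s (X.symm x))) s x =
      cliffordAct 𝔖 ρ a (X.symm x) (e s (X.symm x)) :=
  (ρ.act_clVec _).symm

theorem IsParallelSpinorFrame.matSmoothOn (hX : X ∈ IsManifold.maximalAtlas (𝓡 n) ∞ M)
    (hτ : IsParallelSpinorFrame cov 𝔖 ρ X τ) (a : ι) :
    MatSmoothOn (X.target ∩ X.symm ⁻¹' 𝔖.U a) fun x => τ a (X.symm x) := fun i j =>
  contDiffOn_pi.1 (contDiffOn_comp_symm_of_source hX ((hτ.section_col j).smooth a)) i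

theorem IsParallelSpinorFrame.compat (hτ : IsParallelSpinorFrame cov 𝔖 ρ X τ) (a b : ι) {q : M}
    (hq : q ∈ X.source ∩ (𝔖.U a ∩ 𝔖.U b)) : τ a q = ρ.act (𝔖.lift a b q) * τ b q := by
  ext i j
  exact congrFun ((hτ.section_col j).compat a b q hq) i

/-- The radial derivative is taken column by column, each column being a parallel section;
multiplication by the inverse of τ turns the result into the gauge form. -/
theorem IsParallelSpinorFrame.sum_gaugeForm (hX : X ∈ IsManifold.maximalAtlas (𝓡 n) ∞ M)
    (hτ : IsParallelSpinorFrame cov 𝔖 ρ X τ) (a : ι) {x : E n}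
    (hx : x ∈ X.target ∩ X.symm ⁻¹' 𝔖.U a) :
    ∑ k, x k • gaugeForm (fun y => τ a (X.symm y)) (spinLift (fun i => ρ.act (clGen i))
      fun u v => coordConn cov X (𝔖.frame a) k u v x) k x = 0 := by
  have hs := hτ.matSmoothOn hX a
  have ho := isOpen_trivialisation 𝔖 X a
  have h1 : ∑ k, x k • (matPd k (fun y => τ a (X.symm y)) x + spinLift (fun i => ρ.act (clGen i))
      (fun u v => coordConn cov X (𝔖.frame a) k u v x) * τ a (X.symm x)) = 0 := by
    ext i j
    have hd : DifferentiableAt ℝ (fun y i => τ a (X.symm y) i j) x :=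
      differentiableAt_pi.2 fun i => hs.differentiableAt ho hx i j
    have hp : ∀ k, pd k (fun y i => τ a (X.symm y) i j) x i =
        pd k (fun y => τ a (X.symm y) i j) x := fun k =>
      (pd_clm (ContinuousLinearMap.proj (R := ℝ) (φ := fun _ : Fin N => ℂ) i) hd k).symm
    have h2 := hτ.parallel j a (X.symm x) ⟨X.map_target hx.1, hx.2⟩
    rw [spinDeriv_eq_sum hX hx.1 hd (by
      filter_upwards [X.open_source.mem_nhds (X.map_target hx.1)] with y hy
      simp [X.left_inv hy])] at h2
    rw [push_radialField hX (X.map_target hx.1), X.right_inv hx.1] at h2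
    have h3 := congrFun h2 i
    simp only [Finset.sum_apply, Pi.smul_apply, Pi.add_apply, hp] at h3
    simp only [Matrix.sum_apply, Matrix.smul_apply, Matrix.add_apply]
    exact h3
  have h2 := congrArg ((τ a (X.symm x))⁻¹ * ·) h1
  simp only [Finset.mul_sum, Matrix.mul_smul, mul_zero] at h2
  exact h2

theorem sum_vielbeinB_mul_coordConn (hX : X ∈ IsManifold.maximalAtlas (𝓡 n) ∞ M) {x : E n} (hx : x ∈ X.target)
    (l s t : Fin n) : ∑ k, vielbeinB X e x l k * coordConn cov X e k s t x =
      connCoeff cov X e l s t x :=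
  (inner_cov_eq_sum hX e hx _ s t).symm

variable [IsContMDiffRiemannianBundle (𝓡 n) ∞ (E n) (fun q : M => TangentSpace (𝓡 n) q)]

theorem isParallelGauge (hcov : IsLeviCivita cov) (hX : IsNormalChart cov p r X)
    (he : IsParallelFrame cov p X e) (hτ : IsParallelSpinorFrame cov 𝔖 ρ X τ)
    (hκ : IsCliffordIdent 𝔖 ρ p X τ κ) :
    IsParallelGauge r ρ κ (coordConn cov X e) (fun a => X.target ∩ X.symm ⁻¹' 𝔖.U a)
      (fun a s u x => inner ℝ (𝔖.frame a u (X.symm x)) (e s (X.symm x)))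
      (fun a => coordConn cov X (𝔖.frame a)) (fun a b x => 𝔖.lift a b (X.symm x))
      (fun a x => τ a (X.symm x)) where
  radius_pos := hX.radius_pos
  isOpen a := isOpen_trivialisation 𝔖 X a
  iUnion_eq := by
    rw [← hX.target_eq, ← inter_iUnion, ← preimage_iUnion, inter_eq_left]
    exact fun x _ => mem_iUnion.2 (𝔖.cover _)
  antisymm k s t x hx := by
    rw [← hX.target_eq] at hx
    exact hcov.antisymm X.open_source he.smooth (fun q hq => he.orthonormal hcov hX hq)
      (X.map_target hx) s t _
  radial x hx s t := by
    rw [← hX.target_eq] at hx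
    have h1 := inner_cov_eq_sum (cov := cov) hX.mem_atlas e hx (radialField X (X.symm x)) s t
    rw [he.parallel s _ (X.map_target hx), inner_zero_left,
      push_radialField hX.mem_atlas (X.map_target hx), X.right_inv hx] at h1
    exact h1.symm
  smooth_frame a s u := contDiffOn_comp_symm_of_source hX.mem_atlas
    (contMDiffOn_inner ((𝔖.frame_smooth a u).mono inter_subset_right)
      ((he.smooth s).mono inter_subset_left))
  conn_antisymm a k u v x hx :=
    hcov.antisymm (𝔖.isOpen a) (𝔖.frame_smooth a) (𝔖.frame_orthonormal a) hx.2 u v _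
  -- Metric compatibility applied to g(f_u, e_s): the derivative of each vector is expanded in its
  -- own orthonormal frame.
  pd_frame a k s u x hx := by
    have hq := X.map_target hx.1
    have h1 := hcov.mvfderiv_inner
      (mdifferentiableAt_of_contMDiffOn (𝔖.isOpen a) (𝔖.frame_smooth a u) hx.2)
      (mdifferentiableAt_of_contMDiffOn X.open_source (he.smooth s) hq)
      (coordField X k (X.symm x))
    have hd : MDifferentiableAt (𝓡 n) 𝓘(ℝ, ℝ)
        (fun y => (inner ℝ (𝔖.frame a u y) (e s y) : ℝ)) (X.symm x) :=
      ((contMDiffOn_inner ((𝔖.frame_smooth a u).mono inter_subset_right)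
        ((he.smooth s).mono inter_subset_left)).contMDiffAt
        ((X.open_source.inter (𝔖.isOpen a)).mem_nhds ⟨hq, hx.2⟩)).mdifferentiableAt (by simp)
    rw [mvfderiv_eq_sum_pd hX.mem_atlas hq hd, push_coordField hX.mem_atlas hq,
      X.right_inv hx.1] at h1
    have h2 := sum_inner_smul_of_orthonormal (𝔖.frame_orthonormal a _ hx.2) (e s (X.symm x))
    have h3 := sum_inner_smul_of_orthonormal (he.orthonormal hcov hX hq)
      (cov (e s) (X.symm x) (coordField X k (X.symm x)))
    have h4 : (inner ℝ (cov (𝔖.frame a u) (X.symm x) (coordField X k (X.symm x)))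
        (e s (X.symm x)) : ℝ) = ∑ v, coordConn cov X (𝔖.frame a) k u v x *
          inner ℝ (𝔖.frame a v (X.symm x)) (e s (X.symm x)) := by
      conv_lhs => rw [← h2]
      simp [inner_sum, inner_smul_right, coordConn, mul_comm]
    have h5 : (inner ℝ (𝔖.frame a u (X.symm x)) (cov (e s) (X.symm x) (coordField X k (X.symm x))) :
        ℝ) = ∑ t, coordConn cov X e k s t x *
          inner ℝ (𝔖.frame a u (X.symm x)) (e t (X.symm x)) := by
      conv_lhs => rw [← h3]
      simp [inner_sum, inner_smul_right, coordConn, real_inner_comm (e _ _) (cov _ _ _)]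
    rw [← h4, ← h5, ← h1]
    simp [Function.comp_def]
  smooth_lift a b φ := (contDiffOn_comp_symm_of_source hX.mem_atlas
    ((𝔖.lift_smooth a b φ).mono inter_subset_right)).mono fun x hx => ⟨hx.1.1, hx.1.2, hx.2.2⟩
  star_mul_lift a b x hx := spinGroup.star_mul_self_of_mem (𝔖.lift_mem a b _ ⟨hx.1.2, hx.2.2⟩)
  lift_frame a b s x hx := by
    rw [frameClifford_eq_cliffordAct, frameClifford_eq_cliffordAct, cliffordAct, cliffordAct,
      ← ρ.act_mul, ← ρ.act_mul, 𝔖.lift_frame a b _ ⟨hx.1.2, hx.2.2⟩]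
  smooth a := hτ.matSmoothOn hX.mem_atlas a
  isUnit a x hx := hτ.isUnit a _ ⟨X.map_target hx.1, hx.2⟩
  compat a b x hx := hτ.compat a b ⟨X.map_target hx.1.1, hx.1.2, hx.2.2⟩
  parallel a x hx := hτ.sum_gaugeForm hX.mem_atlas a hx
  initial a s h0 := by
    rw [frameClifford_eq_cliffordAct, hX.symm_zero, he.initial]
    refine hκ a ?_ s
    have := h0.2
    rwa [mem_preimage, hX.symm_zero] at this

/-- In the parallel trivialisation, the Dirac operator is the local Dirac operator. -/
theorem dirac_eq_localDirac (hcov : IsLeviCivita cov) (hX : IsNormalChart cov p r X)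
    (he : IsParallelFrame cov p X e) (hτ : IsParallelSpinorFrame cov 𝔖 ρ X τ)
    (hκ : IsCliffordIdent 𝔖 ρ p X τ κ) {ψ : ι → M → Fin N → ℂ} {u : E n → Fin N → ℂ}
    (hu : ContDiffOn ℝ ∞ u X.target) {a : ι}
    (hψ : ∀ q ∈ X.source ∩ 𝔖.U a, ψ a q = τ a q *ᵥ u (X q)) {q : M} (hq : q ∈ X.source ∩ 𝔖.U a) :
    dirac cov 𝔖 ρ ψ a q = τ a q *ᵥ localDirac (fun l j x => vielbeinB X e x l j)
      (connCoeff cov X e) (fun i => matCLM (κ.act (clGen i))) u (X q) := by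
  have h := isParallelGauge hcov hX he hτ hκ
  obtain ⟨x, hx, rfl⟩ : ∃ x ∈ X.target ∩ X.symm ⁻¹' 𝔖.U a, X.symm x = q :=
    ⟨X q, ⟨X.map_source hq.1, by simpa [X.left_inv hq.1] using hq.2⟩, X.left_inv hq.1⟩
  rw [X.right_inv hx.1]
  have hT := (h.smooth a).differentiableAt (h.isOpen a) hx
  have hud := differentiableAt_of_contDiffOn X.open_target hu hx.1
  have hg : DifferentiableAt ℝ (fun y => τ a (X.symm y) *ᵥ u y) x := by
    refine differentiableAt_pi.2 fun i => ?_
    simp only [Matrix.mulVec, dotProduct]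
    exact DifferentiableAt.fun_sum fun j _ => (hT i j).fun_mul (differentiableAt_pi.1 hud j)
  have hev : ψ a =ᶠ[𝓝 (X.symm x)] (fun y => τ a (X.symm y) *ᵥ u y) ∘ X := by
    filter_upwards [(X.open_source.inter (𝔖.isOpen a)).mem_nhds hq] with y hy
    simp [X.left_inv hy.1, hψ y hy]
  -- These are the coordinate covariant derivatives as seen in the trivialisation;
  -- `IsParallelGauge.matPd_eq` says that τ intertwines them with those in the spin frame.
  set D : Fin n → Fin N → ℂ := fun k => pd k u x +
    spinLift (fun i => κ.act (clGen i)) (fun s t => coordConn cov X e k s t x) *ᵥ u x with hD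
  have h1 : ∀ v, spinDeriv cov 𝔖 ρ ψ a (X.symm x) v =
      ∑ k, push X (X.symm x) v k • (τ a (X.symm x) *ᵥ D k) := by
    intro v
    rw [spinDeriv_eq_sum hX.mem_atlas hx.1 hg hev]
    refine Finset.sum_congr rfl fun k _ => congrArg _ ?_
    rw [pd_mulVec hT hud, hD, Matrix.mulVec_add, Matrix.mulVec_mulVec, Matrix.mulVec_mulVec,
      ← h.matPd_eq a k hx, Matrix.add_mulVec]
    abel
  have h2 : ∀ i k, push X (X.symm x) (𝔖.frame a i (X.symm x)) k =
      ∑ l, (inner ℝ (𝔖.frame a i (X.symm x)) (e l (X.symm x)) : ℝ) * vielbeinB X e x l k := by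
    intro i k
    conv_lhs => rw [← sum_inner_smul_of_orthonormal (he.orthonormal hcov hX hq.1)
      (𝔖.frame a i (X.symm x)), map_sum]
    simp [vielbeinB_apply, real_inner_comm (𝔖.frame a i _)]
  have h3 : ∀ l, spinConn (fun l j x => vielbeinB X e x l j) (connCoeff cov X e)
      (fun i => matCLM (κ.act (clGen i))) l u x = ∑ k, vielbeinB X e x l k • D k := by
    intro l
    rw [spinConn, spinLift_matCLM]
    simp only [hD, smul_add, Finset.sum_add_distrib, ← sum_vielbeinB_mul_coordConn hX.mem_atlas hx.1,
      spinLift_sum_smul, Matrix.sum_mulVec, Matrix.smul_mulVec]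
    rfl
  -- Constancy of Clifford multiplication in τ moves the generator of κ to the left, as Clifford
  -- multiplication by e_l expanded in the spin frame. The sum over l then matches the sum over spin
  -- frame vectors: the Dirac operator does not depend on the orthonormal frame.
  have h4 : ∀ l, τ a (X.symm x) *ᵥ (κ.act (clGen l) *ᵥ ∑ k, vielbeinB X e x l k • D k) =
      ∑ i, ∑ k, ((inner ℝ (𝔖.frame a i (X.symm x)) (e l (X.symm x)) : ℝ) * vielbeinB X e x l k) •
        (ρ.act (clGen i) *ᵥ (τ a (X.symm x) *ᵥ D k)) := by
    intro l
    rw [Matrix.mulVec_mulVec, ← h.frameClifford_mul a l hx, frameClifford, Finset.sum_mul,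
      Matrix.sum_mulVec]
    refine Finset.sum_congr rfl fun i _ => ?_
    simp only [Matrix.smul_mul, Matrix.smul_mulVec, Matrix.mulVec_sum, Matrix.mulVec_smul,
      smul_smul, Matrix.mulVec_mulVec]
    exact Finset.sum_congr rfl fun k _ => by rw [mul_comm]
  have h5 : dirac cov 𝔖 ρ ψ a (X.symm x) = ∑ i, ∑ k, ∑ l,
      ((inner ℝ (𝔖.frame a i (X.symm x)) (e l (X.symm x)) : ℝ) * vielbeinB X e x l k) •
        (ρ.act (clGen i) *ᵥ (τ a (X.symm x) *ᵥ D k)) := by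
    simp only [dirac, h1, h2, Finset.sum_smul, Matrix.mulVec_sum, Matrix.mulVec_smul]
  have h6 : τ a (X.symm x) *ᵥ localDirac (fun l j x => vielbeinB X e x l j) (connCoeff cov X e)
      (fun i => matCLM (κ.act (clGen i))) u x =
      ∑ l, τ a (X.symm x) *ᵥ (κ.act (clGen l) *ᵥ ∑ k, vielbeinB X e x l k • D k) := by
    simp only [localDirac, h3, matCLM_apply]
    rw [Matrix.mulVec_sum]
  rw [h5, h6, Finset.sum_congr rfl fun l _ => h4 l]
  refine Eq.trans (Finset.sum_congr rfl fun i _ => ?_) Finset.sum_comm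
  exact Finset.sum_comm

theorem isDiffOpInFrame_diracSquare (hcov : IsLeviCivita cov) (hX : IsNormalChart cov p r X)
    (he : IsParallelFrame cov p X e) (hτ : IsParallelSpinorFrame cov 𝔖 ρ X τ)
    (hκ : IsCliffordIdent 𝔖 ρ p X τ κ) :
    IsDiffOpInFrame 𝔖 X τ 2 (fun ψ => dirac cov 𝔖 ρ (dirac cov 𝔖 ρ ψ))
      (diracSquare (fun l j x => vielbeinB X e x l j) (connCoeff cov X e) κ) := by
  have hF := (he.isRadialFrame hcov hX).toIsLeviCivitaFrame
  rw [← hX.target_eq] at hF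
  refine ⟨hF.smoothCoeffs_diracSquare κ, fun u hu a q hq => ?_⟩
  have h1 : ContDiffOn ℝ ∞ (localDirac (fun l j x => vielbeinB X e x l j) (connCoeff cov X e)
      (fun i => matCLM (κ.act (clGen i))) u) X.target :=
    ContDiffOn.sum fun i _ =>
      (matCLM (κ.act (clGen i))).contDiff.comp_contDiffOn (hF.contDiffOn_spinConn hu i)
  rw [← localDirac_localDirac_eq_evalOp hF κ hu (X.map_source hq.1)]
  -- The inner Dirac operator is known to have the form τ · (smooth function) only over U_p and
  -- within each U_a, which is all that the hypothesis on the spinor field asks for, so the formula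
  -- can be applied a second time.
  exact dirac_eq_localDirac hcov hX he hτ hκ h1
    (fun q hq => dirac_eq_localDirac hcov hX he hτ hκ hu (fun _ _ => rfl) hq) hq

end Dirac

end Getzler

end

/-! ### The square of the Dirac operator is geometric and rescalable -/

theorem proposition6p1 {n N : ℕ} (hn : Even n) {M : Type*} [TopologicalSpace M] [T2Space M]
    [ChartedSpace (Getzler.E n) M] [IsManifold (𝓡 n) ∞ M]
    [RiemannianBundle (fun q : M => TangentSpace (𝓡 n) q)]
    [IsContMDiffRiemannianBundle (𝓡 n) ∞ (Getzler.E n) (fun q : M => TangentSpace (𝓡 n) q)]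
    (cov : CovariantDerivative (𝓡 n) (Getzler.E n) (TangentSpace (𝓡 n) : M → Type _))
    (hcov : Getzler.IsLeviCivita cov)
    {ι : Type*} (𝔖 : Getzler.SpinStructure n M ι) (ρ : Getzler.SpinorModule n N)
    (p : M) (r : ℝ) (X : OpenPartialHomeomorph M (Getzler.E n))
    (hX : Getzler.IsNormalChart cov p r X)
    (e : Fin n → Π q : M, TangentSpace (𝓡 n) q) (he : Getzler.IsParallelFrame cov p X e)
    (τ : ι → M → Matrix (Fin N) (Fin N) ℂ) (hτ : Getzler.IsParallelSpinorFrame cov 𝔖 ρ X τ)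
    (κ : Getzler.SpinorModule n N) (hκ : Getzler.IsCliffordIdent 𝔖 ρ p X τ κ) :
    ∃ P : Getzler.Coeffs n (Fin N),
      Getzler.IsDiffOpInFrame 𝔖 X τ 2
        (fun ψ => Getzler.dirac cov 𝔖 ρ (Getzler.dirac cov 𝔖 ρ ψ)) P ∧
      Getzler.IsGeometric X e 2 P ∧
      Getzler.DiffOpTendsto (Metric.ball 0 r) 2 (fun lam => Getzler.getzlerRescale κ 2 P lam)
        (Getzler.modelOp fun i j s t =>
          inner ℝ (Getzler.curvature cov (e i) (e j) (e s) p) (e t p)) := by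
  have hR := he.isRadialFrame hcov hX
  refine ⟨Getzler.diracSquare (fun l j x => Getzler.vielbeinB X e x l j)
    (Getzler.connCoeff cov X e) κ,
    Getzler.isDiffOpInFrame_diracSquare hcov hX he hτ hκ, fun γ _ I J => ?_, ?_⟩
  · rw [hX.target_eq]
    exact hR.toIsLeviCivitaFrame.isGeometricOn_diracSquare κ γ I J
  · simp only [he.inner_curvature hcov hX]
    exact hR.diffOpTendsto κ
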